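/- Let $\Gamma$ be a compact tropical curve, i.e. the connected metric graph obtained from a finite graph (loops and multiple edges allowed) with finite positive edge lengths. A divisor is an element $D=\sum_v D(v)(v)$ of the free abelian group on the points of $\Gamma$; write $D\sim D'$ if $D=D'+\operatorname{div}(f)$ for a rational function $f$ (continuous, piecewise linear with finitely many pieces and integer slopes), where $\operatorname{div}(f)(v)$ is the sum of the outgoing slopes of $f$ at $v$. Let $|D|=\{F\ge 0: F\sim D\}$ and $r(D)=\min\{\deg F: F\ge 0,\ |D-F|=\emptyset\}-1$. A cut is a non-empty closed connected subset $X\subseteq\Gamma$; for $v\in X$ let $\deg^{\rm out}_X(v)$ be the number of unit tangent vectors at $v$ pointing out of $X$. A cut $X$ is saturated for $D$ if $\deg^{\rm out}_X(v)\le D(v)$ for all $v\in\partial X$. $D$ is $P$-reduced if $D(v)\ge 0$ for all $v\ne P$ and no cut avoiding $P$ is saturated for $D$. Let $N\ge 0$. The symmetric product $\Gamma^{(N)}=\Gamma^N/\mathfrak S_N$ has the quotient topology and the following cells: one fixes how many of the $N$ points sit at each vertex, and for each edge $e$ a sequence of positive multiplicities; the cell is parametrized by the polytope of all positions $0\le x^e_1\le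 x^e_2\le\dots\le\ell(e)$ of the points with these multiplicities on the edges $e$, with the standard integer lattice (its relative interior is given by strict inequalities). The cells of $|D|\subset\Gamma^{(\deg D)}$ are the closures of the connected components of the intersections of $|D|$ with the relative interiors of the cells of $\Gamma^{(\deg D)}$, in the same coordinates. A map $\varphi$ from $\Gamma$ to $\Gamma^{(N)}$ or to $|D|$ is integral affine if for every point $P$ and every unit tangent vector $u$ at $P$ there is $\varepsilon>0$ such that $\varphi$ maps $[P,P+\varepsilon u]$ into a single cell, in whose coordinates $t\mapsto\varphi(P+tu)$ has the form $a+tn$ with $n$ an integer vector. **Theorem.** Let $D$ be a divisor on $\Gamma$ with $r(D)\ge 0$. For every $P\in\Gamma$ there is a unique $P$-reduced divisor $D_P\sim D$; it is effective, of degree $\deg D$. The map $\mathrm{Red}:\Gamma\to|D|\subset\Gamma^{(\deg D)}$, $P\mapsto D_P$, is integral affine, both as a map to $|D|$ and as a map to $\Gamma^{(\deg D)}$, and it is continuous. Moreover, let $u$ be a unit tangent vector at a point $P$, and let $\mathcal F$ be the set of all cuts that are saturated for $D_P$, contain $P$, and out of which $u$ points. If $\mathcal F=\emptyset$, then $D_{P+\delta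 u}=D_P$ for all sufficiently small $\delta\ge0$. Otherwise $\mathcal F$ has a largest element $Y$, the integer $k=D_P(P)-\deg^{\rm out}_Y(P)+1$ is at least $1$, and for all sufficiently small $\delta\ge 0$ $$D_{P+\delta u}=k\,(P+\delta u)+\sum_{w\neq u}(v_w+k\delta w)+\sum_{v\ne P}\bigl(D_P(v)-\deg^{\rm out}_Y(v)\bigr)(v),$$ where $w$ runs over the unit tangent vectors other than $u$ that point out of $Y$, $w$ being based at $v_w\in\partial Y$, and $\deg^{\rm out}_Y(v)=0$ for $v\notin\partial Y$. -/

import Mathlib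

open Filter Topology

noncomputable section

namespace Trop

/-- A weighted graph with vertex type `V` and edge type `E` (used with `V`, `E` finite).
Loops and multiple edges are allowed; all edges have a finite positive length. -/
structure WGraph (V E : Type*) where
  src : E → V
  tgt : E → V
  len : E → ℝ
  len_pos : ∀ e, 0 < len e

variable {V E : Type*}

/-- The points of the geometric realization `Γ` of a weighted graph `G`: its vertices, and for each
edge `e` the points of the open interval `(0, len e)`. -/
inductive WGraph.Point (G : WGraph V E)
  | vertex (v : V) : WGraph.Point G
  | inner (e : E) (t : ℝ) (h : 0 < t ∧ t < G.len e) : WGraph.Point G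

namespace WGraph

variable (G : WGraph V E)

/-- The parametrization `[0, len e] → Γ` of the edge `e` by arc length
(parameters outside `[0, len e]` are sent to the nearest end). -/
def edgePt (e : E) (t : ℝ) : G.Point :=
  open Classical in
  if h : 0 < t ∧ t < G.len e then .inner e t h
  else if t ≤ 0 then .vertex (G.src e) else .vertex (G.tgt e)

/-- The topology of `Γ`: a set is open iff its preimage in every edge `[0, len e]` is open. This is
the quotient topology of the disjoint union of the (discrete) vertex set and the intervals
`[0, len e]`, glued at their ends. -/
instance : TopologicalSpace G.Point :=
  ⨆ e : E, TopologicalSpace.coinduced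
    (fun t : Set.Icc (0 : ℝ) (G.len e) => G.edgePt e t) inferInstance

/-- A unit tangent vector: an oriented edge (`fwd = true` for the orientation from `src` to `tgt`)
and a point of it other than its terminal point, at distance `pos` from its initial point. -/
structure Tangent where
  edge : E
  fwd : Bool
  pos : ℝ
  pos_nonneg : 0 ≤ pos
  pos_lt : pos < G.len edge

variable {G}

/-- The point `P + δ u`, for `u` a unit tangent vector at `P` and small `δ ≥ 0`. -/
def Tangent.move (u : G.Tangent) (δ : ℝ) : G.Point :=
  G.edgePt u.edge (if u.fwd then u.pos + δ else G.len u.edge - (u.pos + δ))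

/-- The point at which a unit tangent vector is based. -/
def Tangent.base (u : G.Tangent) : G.Point := u.move 0

/-- The length of the part of the (oriented) edge that lies ahead of `u`. -/
def Tangent.room (u : G.Tangent) : ℝ := G.len u.edge - u.pos

/-! ### Divisors and rational functions -/

variable (G) in
/-- The divisor group: the free abelian group on the points of `Γ`. -/
abbrev Div := G.Point →₀ ℤ

/-- The degree of a divisor. -/
def deg (D : G.Div) : ℤ := D.sum fun _ a => a

/-- Rational functions: continuous, and on every edge piecewise linear with integral slopes and
with finitely many linear parts (`S` is a finite set containing the break points). -/
def IsRational (f : G.Point → ℝ) : Prop :=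
  Continuous f ∧ ∀ e : E, ∃ S : Finset ℝ, ∀ a b : ℝ, 0 ≤ a → a < b → b ≤ G.len e →
    (∀ s ∈ S, s ∉ Set.Ioo a b) →
    ∃ m : ℤ, ∀ t ∈ Set.Icc a b, f (G.edgePt e t) = f (G.edgePt e a) + m * (t - a)

/-- `f` has slope `m` in the direction of `u`. -/
def HasSlope (f : G.Point → ℝ) (u : G.Tangent) (m : ℤ) : Prop :=
  ∃ ε > 0, ∀ δ ∈ Set.Icc (0 : ℝ) ε, f (u.move δ) = f u.base + m * δ

/-- The slope of a rational function in the direction of `u`. -/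
def outSlope (f : G.Point → ℝ) (u : G.Tangent) : ℤ :=
  open Classical in if h : ∃ m, HasSlope f u m then h.choose else 0

/-- The order of `f` at `P`: the sum of its outgoing slopes at `P`. -/
def ord (f : G.Point → ℝ) (P : G.Point) : ℤ :=
  ∑ᶠ u ∈ {u : G.Tangent | u.base = P}, outSlope f u

/-- Linear equivalence: `D = D' + div f` for a rational function `f`. -/
def LinEquiv (D D' : G.Div) : Prop :=
  ∃ f : G.Point → ℝ, IsRational f ∧ ∀ P, D P = D' P + ord f P

/-- The complete linear system `|D|`, as a set of effective divisors. -/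
def linearSystem (D : G.Div) : Set G.Div := {F | 0 ≤ F ∧ LinEquiv F D}

/-- The rank `r(D)`: one less than the minimal degree of an effective `F` with `|D - F| = ∅`. -/
def rank (D : G.Div) : ℤ :=
  (sInf {n : ℕ | ∃ F : G.Div, 0 ≤ F ∧ deg F = n ∧ linearSystem (D - F) = ∅} : ℕ) - 1

/-! ### Cuts and reduced divisors -/

/-- A cut: a non-empty closed connected subset of `Γ`. -/
def IsCut (X : Set G.Point) : Prop := IsClosed X ∧ IsConnected X

/-- The unit tangent vectors based at points of `X` and pointing out of `X`. -/
def outgoing (X : Set G.Point) : Set G.Tangent :=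
  {w | w.base ∈ X ∧ ∀ᶠ δ in 𝓝[>] (0 : ℝ), w.move δ ∉ X}

/-- The number of edges leaving `X` at `v`. -/
def outDeg (X : Set G.Point) (v : G.Point) : ℕ := {w ∈ outgoing X | w.base = v}.ncard

/-- A cut `X` is saturated if `outDeg X v ≤ D v` at each of its boundary points `v`. -/
def IsSaturated (D : G.Div) (X : Set G.Point) : Prop := ∀ v ∈ frontier X, (outDeg X v : ℤ) ≤ D v

/-- `D` is `P`-reduced. -/
def IsReduced (P : G.Point) (D : G.Div) : Prop :=
  (∀ v, v ≠ P → 0 ≤ D v) ∧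
  ∀ X : Set G.Point, IsCut X → P ∉ X → ∃ v ∈ frontier X, D v < outDeg X v

/-- The cuts that are saturated for `D`, contain the base point of `u`, and which `u` leaves. -/
def satCuts (D : G.Div) (u : G.Tangent) : Set (Set G.Point) :=
  {X | IsCut X ∧ u ∈ outgoing X ∧ IsSaturated D X}

/-! ### The symmetric product and its polyhedral structure -/

/-- The unordered tuple underlying an ordered one. -/
def toSym (X : Type*) (N : ℕ) (x : Fin N → X) : Sym X N :=
  ⟨Finset.univ.val.map x, by simp⟩

/-- `Γ^(N)` carries the quotient topology of `Γ^N`. -/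
instance (N : ℕ) : TopologicalSpace (Sym G.Point N) :=
  TopologicalSpace.coinduced (toSym G.Point N) inferInstance

/-- The effective divisor of degree `N` given by a point of `Γ^(N)`. -/
def toDiv {N : ℕ} (x : Sym G.Point N) : G.Div :=
  ((x : Multiset G.Point).map fun P => Finsupp.single P (1 : ℤ)).sum

/-- `|D|` as a subset of `Γ^(deg D)`. -/
def symLinearSystem (D : G.Div) : Set (Sym G.Point (deg D).toNat) :=
  {x | toDiv x ∈ linearSystem D}

variable (V E) in
/-- The combinatorial type of a cell of `Γ^(N)`: the number of the `N` points which sit at each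
vertex, and for every edge `e` a sequence of positive multiplicities, for points
`x₁ ≤ x₂ ≤ ⋯` on the edge `e`. -/
structure CellType [Fintype V] [Fintype E] (N : ℕ) where
  vmult : V → ℕ
  parts : E → List ℕ
  parts_pos : ∀ e, ∀ m ∈ parts e, 0 < m
  total : ∑ v, vmult v + ∑ e, (parts e).sum = N

section Cells

variable [Fintype V] [Fintype E] {N : ℕ}

/-- The coordinates on a cell: the positions of the points on the edges. The cell lives in
`ℝ ^ Coord`, with the lattice `ℤ ^ Coord`. -/
abbrev CellType.Coord (τ : CellType V E N) : Type _ := Σ e : E, Fin (τ.parts e).length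

variable (G) in
/-- The polytope `|τ|`: on each edge, `0 ≤ x₁ ≤ x₂ ≤ ⋯ ≤ len e`. -/
def cellPoly (τ : CellType V E N) : Set (τ.Coord → ℝ) :=
  {x | ∀ e, (∀ i, 0 ≤ x ⟨e, i⟩ ∧ x ⟨e, i⟩ ≤ G.len e) ∧ ∀ i j, i ≤ j → x ⟨e, i⟩ ≤ x ⟨e, j⟩}

variable (G) in
/-- The interior of `|τ|`: on each edge, `0 < x₁ < x₂ < ⋯ < len e`. -/
def cellInt (τ : CellType V E N) : Set (τ.Coord → ℝ) :=
  {x | ∀ e, (∀ i, 0 < x ⟨e, i⟩ ∧ x ⟨e, i⟩ < G.len e) ∧ ∀ i j, i < j → x ⟨e, i⟩ < x ⟨e, j⟩}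

variable (G) in
/-- The parametrization `|τ| → Γ^(N)` of the cell of type `τ`. -/
def cellParam (τ : CellType V E N) (x : τ.Coord → ℝ) : Sym G.Point N :=
  ⟨∑ v, Multiset.replicate (τ.vmult v) (Point.vertex v) +
    ∑ e, ∑ i : Fin (τ.parts e).length,
      Multiset.replicate ((τ.parts e).get i) (G.edgePt e (x ⟨e, i⟩)), by
    have h : ∀ l : List ℕ, ∑ i : Fin l.length, l.get i = l.sum := fun l => by
      simp
    simpa [Multiset.card_sum, h] using τ.total⟩

/-- A family of cells in `X`, each parametrized by a subset `poly` of a standard real vector space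
`ℝ ^ coord` with the lattice `ℤ ^ coord`. -/
structure Cells.{u, v, w} (X : Type u) where
  Cell : Type v
  coord : Cell → Type w
  poly : ∀ c, Set (coord c → ℝ)
  param : ∀ c, (coord c → ℝ) → X

variable (G) in
/-- The polyhedral structure of `Γ^(N)`. -/
def symCells (N : ℕ) : Cells (Sym G.Point N) where
  Cell := CellType V E N
  coord τ := τ.Coord
  poly τ := cellPoly G τ
  param τ := cellParam G τ

/-- The part of `|D|` in the relative interior of the cell of type `τ`, in coordinates. -/
def sysInt (D : G.Div) (τ : CellType V E (deg D).toNat) : Set (τ.Coord → ℝ) :=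
  {x | x ∈ cellInt G τ ∧ cellParam G τ x ∈ symLinearSystem D}

/-- The polyhedral structure of `|D|`: its cells are the closures of the connected components of
the intersections of `|D|` with the relative interiors of the cells of `Γ^(deg D)`. A cell is
indexed by a point of the connected component. -/
def sysCells (D : G.Div) : Cells (Sym G.Point (deg D).toNat) where
  Cell := Σ τ : CellType V E (deg D).toNat, sysInt D τ
  coord c := c.1.Coord
  poly c := closure (connectedComponentIn (sysInt D c.1) c.2)
  param c := cellParam G c.1

end Cells

/-- A map from `Γ` is integral affine if in the direction of any unit tangent vector `u`, a small
segment starting at the base point of `u` is mapped into a single cell, along a straight line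
traversed with integral constant velocity `n` in the coordinates of that cell. -/
def IsIntegralAffine {X : Type*} (C : Cells X) (φ : G.Point → X) : Prop :=
  ∀ u : G.Tangent, ∃ ε : ℝ, 0 < ε ∧ ε ≤ u.room ∧
    ∃ (c : C.Cell) (a : C.coord c → ℝ) (n : C.coord c → ℤ),
      ∀ t ∈ Set.Icc (0 : ℝ) ε,
        (fun i => a i + t * n i) ∈ C.poly c ∧ C.param c (fun i => a i + t * n i) = φ (u.move t)

/-! ### The reduced divisor map -/

/-- `Red` is the reduced divisor map of `D`: for every `P` it takes a value in `|D|`, and this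
value is the one and only `P`-reduced divisor linearly equivalent to `D`. -/
def IsReducedMap (D : G.Div) (Red : G.Point → Sym G.Point (deg D).toNat) : Prop :=
  ∀ P, Red P ∈ symLinearSystem D ∧
    ∀ D' : G.Div, (LinEquiv D' D ∧ IsReduced P D') ↔ D' = toDiv (Red P)

/-- The excess of `F` at `P` with respect to a cut `Y`. -/
def excess (F : G.Div) (Y : Set G.Point) (P : G.Point) : ℤ := F P - outDeg Y P + 1

/-- The modification of a divisor `F` along a cut `Y` which a unit tangent vector `u` leaves at its
base point `P`, with `k` the excess of `F` at `P`: `k` points sit at `P + δ u`, one at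
`v + k δ w` for each other unit tangent vector `w` leaving `Y`, based at `v`, and at each point
`v ≠ P` there remain `F v - outDeg Y v` points. -/
def modify (F : G.Div) (Y : Set G.Point) (u : G.Tangent) (δ : ℝ) : G.Div :=
  excess F Y u.base • Finsupp.single (u.move δ) 1
    + (∑ᶠ w ∈ outgoing Y \ {u}, Finsupp.single (w.move (excess F Y u.base * δ)) 1)
    + ((F - ∑ᶠ w ∈ outgoing Y, Finsupp.single w.base 1).erase u.base)

end WGraph

end Trop

end

/-!
The proof compares divisors by means of rational functions. For an effective divisor `F` the
functions `f` with `F + div f ≥ 0` are stable under maxima, and `F` is `P`-reduced iff each of them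
takes its maximum at `P`. In one direction (`IsReduced.le`), the components of the locus where `f`
is maximal are saturated cuts, so one of them has to contain `P`; in the other (`isReduced_of_le`),
firing a saturated cut off `P` gives a function whose maximum is not at `P`. Applied to `f` and
`-f`, the first direction gives the uniqueness of reduced divisors.

For the existence (`exists_isReduced`), consider the supremum `f` of all functions of this kind that
vanish at `P`. The slopes of these functions are bounded by `deg F` (`IsPL.outSlope_le_deg`: raise
the function to its value at the point in question and use that principal divisors have degree
zero), and on the open segments between vertices and points of `F` they are convex with integral
slopes. So `f` is itself a rational function with `F + div f ≥ 0`, and `F + div f` is reduced because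
`f` is largest.

For the local form, let `F` be reduced at the base of `u` and let `Q` be a point at a small distance
`δ` in the direction `u`. A function `f ≥ 0` with `F + div f ≥ 0` and `f Q = 0` is at most
`δ * F(base)`, hence of small variation. Being convex on the segments between vertices and points of
`F`, it is constant there except close to the ends, and up to such small pieces the locus where it
is positive is a union of saturated cuts that contain the base of `u` and are left by `u`
(`subset_sUnion_satCuts`). If there are no such cuts, then `f` vanishes at the base, thus everywhere,
and `F` is `Q`-reduced. Otherwise these cuts have a largest element, their union `Y`
(`isGreatest_sUnion_satCuts`). Firing `Y` with weight `k` in the direction `u` and weight `1` in all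
others gives a function which is `k δ` on `Y` and zero at `Q`, and `le_fire` shows that it is the
largest possible `f`; so the divisor that it produces, which is `modify F Y u δ`, is `Q`-reduced
(`isReduced_modify`).

Finally, as `δ` grows the points of `modify F Y u δ` move along the edges with integral velocities,
and they do not meet each other or the vertices for small `δ > 0`. Hence they run on a straight line
in the interior of one cell of the symmetric product (`exists_cell`). Both affineness statements
follow, and so does continuity, which can be tested on the germs of segments (`isOpen_iff_germ`).
-/

noncomputable section

namespace Trop.WGraph

variable {V E : Type*} {G : WGraph V E}

/-! ### Tangent vectors and germs -/

lemma edgePt_of_mem {e : E} {t : ℝ} (h : 0 < t ∧ t < G.len e) : G.edgePt e t = .inner e t h := by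
  simp [edgePt, h]

lemma edgePt_of_nonpos {e : E} {t : ℝ} (h : t ≤ 0) : G.edgePt e t = .vertex (G.src e) := by
  simp [edgePt, h, not_lt.2 h]

lemma edgePt_of_len_le {e : E} {t : ℝ} (h : G.len e ≤ t) : G.edgePt e t = .vertex (G.tgt e) := by
  have := G.len_pos e
  simp [edgePt, not_lt.2 h, not_le.2 (this.trans_le h)]

lemma edgePt_eq_inner {e e' : E} {t t' : ℝ} {h : 0 < t' ∧ t' < G.len e'}
    (H : G.edgePt e t = .inner e' t' h) : e = e' ∧ t = t' := by
  unfold edgePt at H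
  split_ifs at H
  simpa using H

namespace Tangent

/-- The parameter on its edge of the point at distance `s` ahead of a tangent vector. -/
def par (u : G.Tangent) (s : ℝ) : ℝ := if u.fwd then u.pos + s else G.len u.edge - (u.pos + s)

lemma move_eq (u : G.Tangent) (s : ℝ) : u.move s = G.edgePt u.edge (u.par s) := rfl

lemma room_pos (u : G.Tangent) : 0 < u.room := sub_pos.2 u.pos_lt

lemma par_mem {u : G.Tangent} {s : ℝ} (h0 : 0 < s) (h1 : s < u.room) :
    0 < u.par s ∧ u.par s < G.len u.edge := by
  have := u.pos_nonneg
  unfold room at h1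
  unfold par
  split_ifs <;> constructor <;> linarith

lemma move_inner {u : G.Tangent} {s : ℝ} (h0 : 0 < s) (h1 : s < u.room) :
    u.move s = .inner u.edge (u.par s) (par_mem h0 h1) := edgePt_of_mem _

/-- The tangent vector at distance `s` ahead of `u`, pointing in the same direction. -/
def shift (u : G.Tangent) (s : ℝ) (h0 : 0 ≤ s) (h1 : s < u.room) : G.Tangent where
  edge := u.edge
  fwd := u.fwd
  pos := u.pos + s
  pos_nonneg := add_nonneg u.pos_nonneg h0
  pos_lt := by unfold room at h1; linarith

/-- The tangent vector at distance `s` ahead of `u`, pointing back to the base of `u`. -/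
def rev (u : G.Tangent) (s : ℝ) (h0 : 0 < s) (h1 : s ≤ u.room) : G.Tangent where
  edge := u.edge
  fwd := !u.fwd
  pos := G.len u.edge - (u.pos + s)
  pos_nonneg := by unfold room at h1; linarith
  pos_lt := by linarith [u.pos_nonneg]

@[simp] lemma shift_move (u : G.Tangent) {s : ℝ} (h0 h1) (d : ℝ) :
    (u.shift s h0 h1).move d = u.move (s + d) := by
  simp only [move_eq, par, shift]
  congr 1
  split_ifs <;> ring

@[simp] lemma rev_move (u : G.Tangent) {s : ℝ} (h0 h1) (d : ℝ) :
    (u.rev s h0 h1).move d = u.move (s - d) := by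
  simp only [move_eq, par, rev]
  congr 1
  cases u.fwd <;> simp <;> ring

@[simp] lemma shift_base (u : G.Tangent) {s : ℝ} (h0 h1) : (u.shift s h0 h1).base = u.move s := by
  simp [base]

@[simp] lemma rev_base (u : G.Tangent) {s : ℝ} (h0 h1) : (u.rev s h0 h1).base = u.move s := by
  simp [base]

@[simp] lemma shift_room (u : G.Tangent) {s : ℝ} (h0 h1) :
    (u.shift s h0 h1).room = u.room - s := by
  simp only [room, shift]; ring

lemma rev_room (u : G.Tangent) {s : ℝ} (h0 h1) : (u.rev s h0 h1).room = u.pos + s := by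
  simp only [room, rev]; ring

lemma le_rev_room (u : G.Tangent) {s : ℝ} (h0 h1) : s ≤ (u.rev s h0 h1).room := by
  rw [rev_room]; linarith [u.pos_nonneg]

@[simp] lemma shift_zero (u : G.Tangent) (h0 h1) : u.shift 0 h0 h1 = u := by
  cases u; simp [shift]

lemma par_inj {u : G.Tangent} {s s' : ℝ} (h : u.par s = u.par s') : s = s' := by
  unfold par at h
  split_ifs at h <;> linarith

lemma eq_of_base_eq {u w : G.Tangent} (hb : u.base = w.base) (he : u.edge = w.edge)
    (hf : u.fwd = w.fwd) : u = w := by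
  obtain ⟨e, f, p, hp, hl⟩ := u
  obtain ⟨e', f', p', hp', hl'⟩ := w
  obtain rfl : e = e' := he
  obtain rfl : f = f' := hf
  suffices p = p' by subst this; rfl
  have key : ∀ a b : ℝ, 0 < a → a < G.len e → G.edgePt e a = G.edgePt e b → a = b := by
    intro a b h1 h2 h
    rw [edgePt_of_mem ⟨h1, h2⟩] at h
    exact (edgePt_eq_inner h.symm).2.symm
  simp only [base, move, add_zero] at hb
  rcases hp.eq_or_lt with rfl | hp
  · rcases hp'.eq_or_lt with rfl | hp'
    · rfl
    · cases f
      · have := key (G.len e - p') (G.len e - 0) (by linarith) (by linarith) (by simpa using hb.symm)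
        linarith
      · exact (key p' 0 hp' hl' (by simpa using hb.symm)).symm
  · cases f
    · have := key (G.len e - p) (G.len e - p') (by linarith) (by linarith) (by simpa using hb)
      linarith
    · exact key p p' hp hl (by simpa using hb)

lemma finite_base [Finite E] (x : G.Point) : {u : G.Tangent | u.base = x}.Finite := by
  refine Set.Finite.of_finite_image (f := fun u : G.Tangent => (u.edge, u.fwd))
    (Set.toFinite _) ?_
  rintro u rfl w hw h
  simp only [Prod.mk.injEq] at h
  exact eq_of_base_eq hw.symm h.1 h.2

lemma move_eq_move {u w : G.Tangent} {s s' : ℝ} (h0 : 0 < s) (h1 : s < u.room)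
    (h : w.move s' = u.move s) : w.edge = u.edge ∧ w.par s' = u.par s := by
  rw [move_inner h0 h1] at h
  exact edgePt_eq_inner h

lemma move_injOn {u : G.Tangent} {s s' : ℝ} (h0 : 0 < s) (h1 : s < u.room)
    (h : u.move s' = u.move s) : s' = s := par_inj (move_eq_move h0 h1 h).2

/-- At a point inside an edge there are exactly two tangent vectors. -/
lemma eq_shift_or_rev {u w : G.Tangent} {s : ℝ} (h0 : 0 < s) (h1 : s < u.room)
    (h : w.base = u.move s) : w = u.shift s h0.le h1 ∨ w = u.rev s h0 h1.le := by
  have he := (move_eq_move h0 h1 h).1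
  by_cases hf : w.fwd = u.fwd
  · exact .inl (eq_of_base_eq (by simpa using h) he hf)
  · refine .inr (eq_of_base_eq (by simpa using h) he ?_)
    simp only [rev]
    revert hf; cases w.fwd <;> cases u.fwd <;> simp

lemma shift_ne_rev (u : G.Tangent) {s : ℝ} (h0 h1 h2 h3) :
    u.shift s h0 h1 ≠ u.rev s h2 h3 := by
  intro h
  have := congrArg Tangent.fwd h
  simp [shift, rev] at this

lemma move_room (u : G.Tangent) : ∃ v, u.move u.room = .vertex v := by
  unfold move room
  split_ifs
  · exact ⟨_, edgePt_of_len_le (by linarith)⟩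
  · exact ⟨_, edgePt_of_nonpos (by linarith)⟩

lemma exists_move_of_inner (e : E) (t : ℝ) (h : 0 < t ∧ t < G.len e) :
    ∃ (u : G.Tangent) (s : ℝ), 0 < s ∧ s < u.room ∧ u.move s = .inner e t h := by
  refine ⟨⟨e, true, 0, le_rfl, G.len_pos e⟩, t, h.1, by simpa [room] using h.2, ?_⟩
  rw [move_inner h.1 (by simpa [room] using h.2)]
  simp [par]

end Tangent

open Tangent

/-! ### The topology in terms of germs -/

lemma isOpen_iff_edge {U : Set G.Point} :
    IsOpen U ↔ ∀ e, IsOpen {t : Set.Icc (0 : ℝ) (G.len e) | G.edgePt e t ∈ U} := by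
  change IsOpen[⨆ e : E, _] U ↔ _
  simp only [isOpen_iSup_iff, isOpen_coinduced]
  rfl

lemma continuous_edgePt (e : E) : Continuous (G.edgePt e) := by
  have h : Continuous fun t : Set.Icc (0 : ℝ) (G.len e) => G.edgePt e t :=
    ⟨fun U hU => isOpen_iff_edge.1 hU e⟩
  have h' := h.comp (continuous_projIcc (a := (0 : ℝ)) (b := G.len e) (h := (G.len_pos e).le))
  refine h'.congr fun t => ?_
  simp only [Function.comp]
  rcases le_or_gt t 0 with h0 | h0
  · rw [Set.projIcc_of_le_left _ h0, edgePt_of_nonpos h0, edgePt_of_nonpos le_rfl]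
  · rcases le_or_gt (G.len e) t with h1 | h1
    · rw [Set.projIcc_of_right_le _ h1, edgePt_of_len_le h1, edgePt_of_len_le le_rfl]
    · rw [Set.projIcc_of_mem _ ⟨h0.le, h1.le⟩]

lemma Tangent.continuous_par (u : G.Tangent) : Continuous u.par := by
  unfold par; split_ifs <;> fun_prop

lemma Tangent.continuous_move (u : G.Tangent) : Continuous u.move :=
  (continuous_edgePt _).comp u.continuous_par

/-- A set is open iff with each of its points it contains the germs of all segments issuing from
this point. -/
lemma isOpen_iff_germ {U : Set G.Point} :
    IsOpen U ↔ ∀ w : G.Tangent, w.base ∈ U → ∀ᶠ s in 𝓝[>] (0 : ℝ), w.move s ∈ U := by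
  constructor
  · intro h w hw
    exact nhdsWithin_le_nhds ((h.preimage w.continuous_move).mem_nhds hw)
  · intro h
    rw [isOpen_iff_edge]
    intro e
    rw [isOpen_iff_mem_nhds]
    rintro ⟨t, ht0, ht1⟩ htU
    simp only [Set.mem_ofPred_eq] at htU
    have hr : ∃ ε > 0, ∀ s, t ≤ s → s < t + ε → s ≤ G.len e → G.edgePt e s ∈ U := by
      rcases ht1.lt_or_eq with ht1 | ht1
      · have := h ⟨e, true, t, ht0, ht1⟩ (by simpa [base, move] using htU)
        rw [eventually_nhdsWithin_iff, Metric.eventually_nhds_iff] at this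
        obtain ⟨ε, hε, H⟩ := this
        refine ⟨ε, hε, fun s h1 h2 h3 => ?_⟩
        rcases h1.eq_or_lt with rfl | h1
        · exact htU
        · have := @H (s - t) (by rw [Real.dist_eq, sub_zero, abs_of_pos] <;> linarith)
            (by simpa using h1)
          simpa [move] using this
      · exact ⟨1, one_pos, fun s h1 h2 h3 => by
          rwa [show s = t by linarith]⟩
    have hl : ∃ ε > 0, ∀ s, s ≤ t → t - ε < s → 0 ≤ s → G.edgePt e s ∈ U := by
      rcases ht0.lt_or_eq with ht0 | ht0
      · have := h ⟨e, false, G.len e - t, by linarith, by linarith⟩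
          (by simpa [base, move] using htU)
        rw [eventually_nhdsWithin_iff, Metric.eventually_nhds_iff] at this
        obtain ⟨ε, hε, H⟩ := this
        refine ⟨ε, hε, fun s h1 h2 h3 => ?_⟩
        rcases h1.eq_or_lt with rfl | h1
        · exact htU
        · have := @H (t - s) (by rw [Real.dist_eq, sub_zero, abs_of_pos] <;> linarith)
            (by simpa using h1)
          simpa [move] using this
      · exact ⟨1, one_pos, fun s h1 h2 h3 => by
          rwa [show s = t by linarith]⟩
    obtain ⟨ε, hε, hr⟩ := hr
    obtain ⟨ε', hε', hl⟩ := hl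
    rw [mem_nhds_subtype]
    refine ⟨Set.Ioo (t - ε') (t + ε), Ioo_mem_nhds (by linarith) (by linarith), ?_⟩
    rintro ⟨s, hs0, hs1⟩ ⟨h1, h2⟩
    simp only [Set.mem_ofPred_eq] at h1 h2 ⊢
    rcases le_total t s with h | h
    · exact hr s h h2 hs1
    · exact hl s h h1 hs0

lemma isClosed_iff_germ {X : Set G.Point} :
    IsClosed X ↔ ∀ w : G.Tangent, w.base ∉ X → ∀ᶠ s in 𝓝[>] (0 : ℝ), w.move s ∉ X := by
  rw [← isOpen_compl_iff, isOpen_iff_germ]; rfl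

lemma eventually_lt_room (u : G.Tangent) : ∀ᶠ s in 𝓝[>] (0 : ℝ), 0 < s ∧ s < u.room :=
  Ioo_mem_nhdsGT u.room_pos

lemma exists_Ioc_of_eventually {p : ℝ → Prop} (h : ∀ᶠ s in 𝓝[>] (0 : ℝ), p s) {r : ℝ}
    (hr : 0 < r) : ∃ ε, 0 < ε ∧ ε < r ∧ ∀ s, 0 < s → s ≤ ε → p s := by
  obtain ⟨ε, hε, H⟩ := mem_nhdsGT_iff_exists_Ioc_subset.1 h
  have hε : 0 < ε := hε
  exact ⟨min ε (r / 2), by positivity, (min_le_right _ _).trans_lt (by linarith),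
    fun s h0 h1 => H ⟨h0, h1.trans (min_le_left _ _)⟩⟩

lemma eventually_of_Ioo {p : ℝ → Prop} {ε : ℝ} (hε : 0 < ε) (h : ∀ s, 0 < s → s < ε → p s) :
    ∀ᶠ s in 𝓝[>] (0 : ℝ), p s :=
  Filter.mem_of_superset (Ioo_mem_nhdsGT hε) fun s hs => h s hs.1 hs.2

/-- The points of an open segment inside an edge form an open set. -/
lemma isOpen_segment (u : G.Tangent) {a b : ℝ} (ha : 0 ≤ a) (hb : b ≤ u.room) :
    IsOpen (u.move '' Set.Ioo a b) := by
  rw [isOpen_iff_germ]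
  rintro w ⟨s, ⟨h1, h2⟩, h⟩
  rcases eq_shift_or_rev (ha.trans_lt h1) (h2.trans_le hb) h.symm with rfl | rfl
  · refine eventually_of_Ioo (sub_pos.2 h2) fun d h3 h4 => ⟨s + d, ⟨?_, ?_⟩, by simp⟩ <;> linarith
  · refine eventually_of_Ioo (sub_pos.2 h1) fun d h3 h4 => ⟨s - d, ⟨?_, ?_⟩, by simp⟩ <;> linarith

lemma isClosed_segment (u : G.Tangent) (a b : ℝ) :
    IsClosed (u.move '' Set.Icc a b) := by
  rw [isClosed_iff_germ]
  intro w hw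
  have hlim : Tendsto w.par (𝓝[>] 0) (𝓝 (w.par 0)) :=
    w.continuous_par.continuousAt.mono_left nhdsWithin_le_nhds
  have hC : IsClosed (u.par '' Set.Icc a b) := (isCompact_Icc.image u.continuous_par).isClosed
  by_cases he : w.edge = u.edge
  · have hn : w.par 0 ∉ u.par '' Set.Icc a b := by
      rintro ⟨s, hs, h⟩
      exact hw ⟨s, hs, by rw [move_eq, h, ← he]; rfl⟩
    filter_upwards [hlim (hC.isOpen_compl.mem_nhds hn), eventually_lt_room w] with s hs hs'
    rintro ⟨s', h', h⟩
    exact hs ⟨s', h', (move_eq_move hs'.1 hs'.2 h).2⟩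
  · filter_upwards [eventually_lt_room w] with s hs
    rintro ⟨s', -, h⟩
    exact he (move_eq_move hs.1 hs.2 h).1.symm

lemma isConnected_segment (u : G.Tangent) {a b : ℝ} (h : a ≤ b) :
    IsConnected (u.move '' Set.Icc a b) :=
  (isConnected_Icc h).image _ u.continuous_move.continuousOn

lemma isClosed_singleton_point (x : G.Point) : IsClosed ({x} : Set G.Point) := by
  rw [isClosed_iff_germ]
  intro w hw
  cases x with
  | vertex v =>
    filter_upwards [eventually_lt_room w] with s hs
    simp [move_inner hs.1 hs.2]
  | inner e t h =>
    obtain ⟨u, s, h0, h1, h2⟩ := exists_move_of_inner e t h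
    rw [← h2] at hw ⊢
    have := isClosed_iff_germ.1 (isClosed_segment u s s) w (by simpa using hw)
    simpa using this

instance : T1Space G.Point := ⟨isClosed_singleton_point⟩

instance [Finite V] [Finite E] : CompactSpace G.Point := by
  refine ⟨?_⟩
  have : (Set.univ : Set G.Point) =
      Set.range Point.vertex ∪ ⋃ e, G.edgePt e '' Set.Icc 0 (G.len e) := by
    symm
    rw [Set.eq_univ_iff_forall]
    rintro (v | ⟨e, t, h⟩)
    · exact .inl ⟨v, rfl⟩
    · exact .inr (Set.mem_iUnion.2 ⟨e, t, ⟨h.1.le, h.2.le⟩, edgePt_of_mem h⟩)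
  rw [this]
  exact (Set.finite_range _).isCompact.union
    (isCompact_iUnion fun e => isCompact_Icc.image (continuous_edgePt e))

/-- A set that contains a point together with all germs there is a neighbourhood of the point. -/
lemma mem_nhds_of_germ [Finite E] {A : Set G.Point} {x : G.Point} (hx : x ∈ A)
    (h : ∀ w : G.Tangent, w.base = x → ∀ᶠ s in 𝓝[>] (0 : ℝ), w.move s ∈ A) : A ∈ 𝓝 x := by
  have : ∀ w : G.Tangent, ∃ ε, 0 < ε ∧ ε < w.room ∧ (w.base = x → ∀ s, 0 < s → s ≤ ε →
      w.move s ∈ A) := fun w => by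
    by_cases hw : w.base = x
    · obtain ⟨ε, h1, h2, h3⟩ := exists_Ioc_of_eventually (h w hw) w.room_pos
      exact ⟨ε, h1, h2, fun _ => h3⟩
    · exact ⟨w.room / 2, by linarith [w.room_pos], by linarith [w.room_pos], fun h => (hw h).elim⟩
  choose ε hε hr H using this
  refine mem_of_superset (x := {x} ∪ ⋃ w ∈ {w : G.Tangent | w.base = x}, w.move '' Set.Ioo 0 (ε w))
    (IsOpen.mem_nhds ?_ (by simp)) ?_
  · rw [isOpen_iff_germ]
    rintro w (hw | hw)
    · refine eventually_of_Ioo (hε w) fun s h0 h1 => .inr ?_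
      exact Set.mem_biUnion (show w ∈ {w : G.Tangent | w.base = x} from hw) ⟨s, ⟨h0, h1⟩, rfl⟩
    · obtain ⟨w', hw', hm⟩ := Set.mem_iUnion₂.1 hw
      have := isOpen_iff_germ.1 (isOpen_segment w' le_rfl (hr w').le) w hm
      filter_upwards [this] with s hs
      exact .inr (Set.mem_biUnion hw' hs)
  · rintro y (rfl | hy)
    · exact hx
    · obtain ⟨w', hw', s, hs, rfl⟩ := Set.mem_iUnion₂.1 hy
      exact H w' hw' s hs.1 hs.2.le

/-! ### Slopes and orders of rational functions -/

/-- A function with an integral slope in the direction of every unit tangent vector. By compactness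
of the edges these are precisely the rational functions, see `isRational_iff`. -/
def IsPL (f : G.Point → ℝ) : Prop := ∀ u : G.Tangent, ∃ m : ℤ, HasSlope f u m

lemma HasSlope.eventually {f : G.Point → ℝ} {u : G.Tangent} {m : ℤ} (h : HasSlope f u m) :
    ∀ᶠ s in 𝓝[>] (0 : ℝ), f (u.move s) = f u.base + m * s := by
  obtain ⟨ε, hε, h⟩ := h
  exact eventually_of_Ioo hε fun s h0 h1 => h s ⟨h0.le, h1.le⟩

lemma hasSlope_of_eventually {f : G.Point → ℝ} {u : G.Tangent} {m : ℤ}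
    (h : ∀ᶠ s in 𝓝[>] (0 : ℝ), f (u.move s) = f u.base + m * s) : HasSlope f u m := by
  obtain ⟨ε, hε, -, h⟩ := exists_Ioc_of_eventually h one_pos
  refine ⟨ε, hε, fun s hs => ?_⟩
  rcases hs.1.eq_or_lt with rfl | h0
  · simp [base]
  · exact h s h0 hs.2

lemma HasSlope.le {f g : G.Point → ℝ} {u : G.Tangent} {m n : ℤ} (hf : HasSlope f u m)
    (hg : HasSlope g u n) (h0 : g u.base ≤ f u.base)
    (h : ∀ᶠ s in 𝓝[>] (0 : ℝ), f (u.move s) ≤ g (u.move s)) : m ≤ n := by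
  obtain ⟨ε, hε, -, H⟩ :=
    exists_Ioc_of_eventually ((h.and hf.eventually).and hg.eventually) one_pos
  obtain ⟨⟨h1, h2⟩, h3⟩ := H ε hε le_rfl
  have : (m : ℝ) * ε ≤ n * ε := by linarith
  exact_mod_cast le_of_mul_le_mul_right this hε

lemma HasSlope.unique {f : G.Point → ℝ} {u : G.Tangent} {m n : ℤ} (hm : HasSlope f u m)
    (hn : HasSlope f u n) : m = n :=
  le_antisymm (hm.le hn le_rfl (.of_forall fun _ => le_rfl))
    (hn.le hm le_rfl (.of_forall fun _ => le_rfl))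

lemma HasSlope.outSlope_eq {f : G.Point → ℝ} {u : G.Tangent} {m : ℤ} (h : HasSlope f u m) :
    outSlope f u = m := by
  have h' : ∃ m, HasSlope f u m := ⟨m, h⟩
  rw [outSlope, dif_pos h']
  exact h'.choose_spec.unique h

lemma IsPL.hasSlope {f : G.Point → ℝ} (hf : IsPL f) (u : G.Tangent) :
    HasSlope f u (outSlope f u) := by
  obtain ⟨m, hm⟩ := hf u
  rwa [hm.outSlope_eq]

lemma hasSlope_const (c : ℝ) (u : G.Tangent) : HasSlope (fun _ => c) u 0 := ⟨1, one_pos, by simp⟩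

lemma HasSlope.add {f g : G.Point → ℝ} {u : G.Tangent} {m n : ℤ} (hf : HasSlope f u m)
    (hg : HasSlope g u n) : HasSlope (f + g) u (m + n) := by
  refine hasSlope_of_eventually ?_
  filter_upwards [hf.eventually, hg.eventually] with s h1 h2
  simp only [Pi.add_apply, h1, h2]; push_cast; ring

lemma HasSlope.neg {f : G.Point → ℝ} {u : G.Tangent} {m : ℤ} (hf : HasSlope f u m) :
    HasSlope (-f) u (-m) := by
  refine hasSlope_of_eventually ?_
  filter_upwards [hf.eventually] with s h1
  simp only [Pi.neg_apply, h1]; push_cast; ring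

lemma HasSlope.tendsto {f : G.Point → ℝ} {u : G.Tangent} {m : ℤ} (hf : HasSlope f u m) :
    Tendsto (fun s => f (u.move s)) (𝓝[>] 0) (𝓝 (f u.base)) := by
  have : Tendsto (fun s : ℝ => f u.base + m * s) (𝓝[>] 0) (𝓝 (f u.base + m * 0)) :=
    Continuous.tendsto (by fun_prop) 0 |>.mono_left nhdsWithin_le_nhds
  rw [mul_zero, add_zero] at this
  exact this.congr' (hf.eventually.mono fun s h => h.symm)

lemma HasSlope.sup_of_lt {f g : G.Point → ℝ} {u : G.Tangent} {m n : ℤ} (hf : HasSlope f u m)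
    (hg : HasSlope g u n) (h : g u.base < f u.base) : HasSlope (f ⊔ g) u m := by
  refine hasSlope_of_eventually ?_
  filter_upwards [hf.eventually, hg.tendsto.eventually_lt hf.tendsto h] with s h1 h2
  rw [Pi.sup_apply, Pi.sup_apply, sup_of_le_left h2.le, sup_of_le_left h.le, h1]

lemma HasSlope.sup_of_eq {f g : G.Point → ℝ} {u : G.Tangent} {m n : ℤ} (hf : HasSlope f u m)
    (hg : HasSlope g u n) (h : g u.base = f u.base) : HasSlope (f ⊔ g) u (m ⊔ n) := by
  refine hasSlope_of_eventually ?_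
  filter_upwards [hf.eventually, hg.eventually, self_mem_nhdsWithin] with s h1 h2 h3
  have h3 : 0 < s := h3
  simp only [Pi.sup_apply, h1, h2, h, sup_idem]
  push_cast
  rw [max_mul_of_nonneg _ _ h3.le, max_add_add_left]

lemma isPL_const (c : ℝ) : IsPL (fun _ : G.Point => c) := fun u => ⟨0, hasSlope_const c u⟩

lemma IsPL.add {f g : G.Point → ℝ} (hf : IsPL f) (hg : IsPL g) : IsPL (f + g) :=
  fun u => ⟨_, (hf.hasSlope u).add (hg.hasSlope u)⟩

lemma IsPL.neg {f : G.Point → ℝ} (hf : IsPL f) : IsPL (-f) := fun u => ⟨_, (hf.hasSlope u).neg⟩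

lemma IsPL.sup {f g : G.Point → ℝ} (hf : IsPL f) (hg : IsPL g) : IsPL (f ⊔ g) := fun u => by
  rcases lt_trichotomy (g u.base) (f u.base) with h | h | h
  · exact ⟨_, (hf.hasSlope u).sup_of_lt (hg.hasSlope u) h⟩
  · exact ⟨_, (hf.hasSlope u).sup_of_eq (hg.hasSlope u) h⟩
  · rw [sup_comm]; exact ⟨_, (hg.hasSlope u).sup_of_lt (hf.hasSlope u) h⟩

lemma IsPL.continuous {f : G.Point → ℝ} (hf : IsPL f) : Continuous f := by
  refine ⟨fun U hU => isOpen_iff_germ.2 fun w hw => ?_⟩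
  exact (hf.hasSlope w).tendsto (hU.mem_nhds hw)

lemma IsPL.outSlope_add {f g : G.Point → ℝ} (hf : IsPL f) (hg : IsPL g) (u : G.Tangent) :
    outSlope (f + g) u = outSlope f u + outSlope g u :=
  ((hf.hasSlope u).add (hg.hasSlope u)).outSlope_eq

lemma IsPL.outSlope_neg {f : G.Point → ℝ} (hf : IsPL f) (u : G.Tangent) :
    outSlope (-f) u = -outSlope f u := (hf.hasSlope u).neg.outSlope_eq

lemma outSlope_const (c : ℝ) (u : G.Tangent) : outSlope (fun _ => c) u = 0 :=
  (hasSlope_const c u).outSlope_eq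

lemma IsPL.outSlope_le {f g : G.Point → ℝ} (hf : IsPL f) (hg : IsPL g) {u : G.Tangent}
    (h0 : g u.base ≤ f u.base) (h : ∀ᶠ s in 𝓝[>] (0 : ℝ), f (u.move s) ≤ g (u.move s)) :
    outSlope f u ≤ outSlope g u := (hf.hasSlope u).le (hg.hasSlope u) h0 h

section Ord
variable [Finite E]

/-- The finitely many unit tangent vectors at a point. -/
def tangents (x : G.Point) : Finset G.Tangent := (finite_base x).toFinset

@[simp] lemma mem_tangents {x : G.Point} {u : G.Tangent} : u ∈ tangents x ↔ u.base = x := by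
  simp [tangents]

lemma ord_eq_sum (f : G.Point → ℝ) (x : G.Point) : ord f x = ∑ u ∈ tangents x, outSlope f u :=
  finsum_mem_eq_finite_toFinset_sum _ (finite_base x)

lemma IsPL.ord_add {f g : G.Point → ℝ} (hf : IsPL f) (hg : IsPL g) (x : G.Point) :
    ord (f + g) x = ord f x + ord g x := by
  simp only [ord_eq_sum, ← Finset.sum_add_distrib, hf.outSlope_add hg]

lemma IsPL.ord_neg {f : G.Point → ℝ} (hf : IsPL f) (x : G.Point) :
    ord (-f) x = -ord f x := by
  simp only [ord_eq_sum, ← Finset.sum_neg_distrib, hf.outSlope_neg]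

lemma ord_const (c : ℝ) (x : G.Point) : ord (fun _ => c) x = 0 := by
  simp [ord_eq_sum, outSlope_const]

lemma IsPL.ord_add_const {f : G.Point → ℝ} (hf : IsPL f) (c : ℝ) (x : G.Point) :
    ord (fun y => f y + c) x = ord f x := by
  have := hf.ord_add (isPL_const c) x
  rwa [ord_const, add_zero] at this

lemma IsPL.ord_le_sup {f g : G.Point → ℝ} (hf : IsPL f) (hg : IsPL g) {x : G.Point}
    (h : g x ≤ f x) : ord f x ≤ ord (f ⊔ g) x := by
  simp only [ord_eq_sum]
  refine Finset.sum_le_sum fun u hu => ?_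
  obtain rfl := mem_tangents.1 hu
  exact hf.outSlope_le (hf.sup hg) (by simp [h]) (.of_forall fun s => le_sup_left)

/-- The effective divisors `F + div f` are stable under maxima of the functions `f`. -/
lemma IsPL.nonneg_sup {F : G.Point → ℤ} {f g : G.Point → ℝ} (hf : IsPL f) (hg : IsPL g)
    (h1 : ∀ x, 0 ≤ F x + ord f x) (h2 : ∀ x, 0 ≤ F x + ord g x) (x : G.Point) :
    0 ≤ F x + ord (f ⊔ g) x := by
  rcases le_total (g x) (f x) with h | h
  · linarith [h1 x, hf.ord_le_sup hg h]
  · rw [sup_comm]; linarith [h2 x, hg.ord_le_sup hf h]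

lemma ord_move (f : G.Point → ℝ) {u : G.Tangent} {s : ℝ} (h0 : 0 < s) (h1 : s < u.room) :
    ord f (u.move s) = outSlope f (u.shift s h0.le h1) + outSlope f (u.rev s h0 h1.le) := by
  classical
  rw [ord_eq_sum, ← Finset.sum_pair (shift_ne_rev u _ _ _ _)]
  congr 1
  ext w
  simp only [mem_tangents, Finset.mem_insert, Finset.mem_singleton]
  constructor
  · exact eq_shift_or_rev h0 h1
  · rintro (rfl | rfl) <;> simp

end Ord

/-! ### From local to global along an edge -/

/-- A property of intervals that holds for all short intervals with a given end, and passes to the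
union of adjacent intervals, holds for all intervals. -/
lemma interval_induction {P : ℝ → ℝ → Prop} {a b : ℝ} (hab : a < b)
    (glue : ∀ x y z, a ≤ x → x < y → y < z → z ≤ b → P x y → P y z → P x z)
    (right : ∀ x, a ≤ x → x < b → ∀ᶠ d in 𝓝[>] (0 : ℝ), x + d ≤ b → P x (x + d))
    (left : ∀ x, a < x → x ≤ b → ∀ᶠ d in 𝓝[>] (0 : ℝ), a ≤ x - d → P (x - d) x) : P a b := by
  let T : Set ℝ := {x | a < x ∧ x ≤ b ∧ P a x}
  have hne : T.Nonempty := by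
    obtain ⟨ε, h0, h1, h2⟩ := exists_Ioc_of_eventually (right a le_rfl hab) (sub_pos.2 hab)
    exact ⟨a + ε, by linarith, by linarith, h2 ε h0 le_rfl (by linarith)⟩
  have hbdd : BddAbove T := ⟨b, fun x hx => hx.2.1⟩
  set c := sSup T
  obtain ⟨x₀, hx₀⟩ := hne
  have hac : a < c := hx₀.1.trans_le (le_csSup hbdd hx₀)
  have hcb : c ≤ b := csSup_le ⟨x₀, hx₀⟩ fun x hx => hx.2.1
  have hcT : P a c := by
    obtain ⟨ε, h0, h1, h2⟩ := exists_Ioc_of_eventually (left c hac hcb) (sub_pos.2 hac)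
    obtain ⟨x, hx, hxc⟩ := exists_lt_of_lt_csSup ⟨x₀, hx₀⟩ (show c - ε < c by linarith)
    rcases (le_csSup hbdd hx).eq_or_lt with h | h
    · rw [← show x = c from h]; exact hx.2.2
    · refine glue a x c le_rfl hx.1 h hcb hx.2.2 ?_
      have h : x < c := h
      have := h2 (c - x) (by linarith) (by linarith) (by linarith [hx.1])
      rwa [sub_sub_cancel] at this
  rcases hcb.eq_or_lt with h | h
  · rwa [← h]
  · obtain ⟨ε, h0, h1, h2⟩ := exists_Ioc_of_eventually (right c hac.le h) (sub_pos.2 h)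
    have : c + ε ∈ T := ⟨by linarith, by linarith,
      glue a c _ le_rfl hac (by linarith) (by linarith) hcT (h2 ε h0 le_rfl (by linarith))⟩
    linarith [le_csSup hbdd this]

/-- To prove a property of all subsegments of an edge, it suffices to treat the segments on which
a given piecewise linear function is linear, and unions of adjacent segments. -/
lemma IsPL.segment_induction {f : G.Point → ℝ} (hf : IsPL f) (u : G.Tangent) {l : ℝ}
    (hl : l ≤ u.room) {P : ℝ → ℝ → Prop}
    (lin : ∀ a b, ∀ m : ℤ, 0 ≤ a → a < b → b ≤ l →
      (∀ t ∈ Set.Icc a b, f (u.move t) = f (u.move a) + m * (t - a)) → P a b)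
    (glue : ∀ a s b, 0 ≤ a → a < s → s < b → b ≤ l → P a s → P s b → P a b)
    {a b : ℝ} (ha : 0 ≤ a) (hab : a < b) (hb : b ≤ l) : P a b := by
  refine interval_induction hab
    (fun x y z h1 h2 h3 h4 => glue x y z (ha.trans h1) h2 h3 (h4.trans hb)) ?_ ?_
  · intro x h1 h2
    obtain ⟨ε, hε, H⟩ := hf.hasSlope (u.shift x (ha.trans h1) (h2.trans_le (hb.trans hl)))
    refine eventually_of_Ioo hε fun d h3 h4 h5 => lin _ _
      (outSlope f (u.shift x (ha.trans h1) (h2.trans_le (hb.trans hl)))) (ha.trans h1)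
      (by linarith) (h5.trans hb) fun t ht => ?_
    have := H (t - x) ⟨by linarith [ht.1], by linarith [ht.2]⟩
    simpa using this
  · intro x h1 h2
    obtain ⟨ε, hε, H⟩ := hf.hasSlope (u.rev x (ha.trans_lt h1) (h2.trans (hb.trans hl)))
    refine eventually_of_Ioo hε fun d h3 h4 h5 => lin _ _
      (-outSlope f (u.rev x (ha.trans_lt h1) (h2.trans (hb.trans hl)))) (ha.trans h5) (by linarith)
      (h2.trans hb) fun t ht => ?_
    have h6 := H (x - t) ⟨by linarith [ht.2], by linarith [ht.1]⟩
    have h7 := H d ⟨by linarith, by linarith⟩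
    simp only [rev_move, rev_base, sub_sub_cancel] at h6 h7
    rw [h6, h7]; push_cast; ring

/-- The rational functions are the functions with integral slopes everywhere. -/
lemma isRational_iff {f : G.Point → ℝ} : IsRational f ↔ IsPL f := by
  constructor
  · rintro ⟨-, h⟩ u
    obtain ⟨S, hS⟩ := h u.edge
    have hfin : ∀ᶠ s in 𝓝[>] (0 : ℝ), ∀ x ∈ S, x ∉ Set.uIoo (u.par 0) (u.par s) := by
      rw [Filter.eventually_all_finset]
      intro x _
      have hlim : Tendsto u.par (𝓝[>] 0) (𝓝 (u.par 0)) :=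
        u.continuous_par.continuousAt.mono_left nhdsWithin_le_nhds
      rcases lt_trichotomy x (u.par 0) with hx | hx | hx
      · filter_upwards [hlim (lt_mem_nhds hx)] with s hs h
        simp only [Set.mem_preimage, Set.mem_ofPred_eq, Set.uIoo, Set.mem_Ioo] at hs h
        exact (lt_irrefl x) ((lt_min hx hs).trans h.1)
      · exact .of_forall fun s h => Set.left_notMem_uIoo (hx ▸ h)
      · filter_upwards [hlim (gt_mem_nhds hx)] with s hs h
        simp only [Set.mem_preimage, Set.mem_ofPred_eq, Set.uIoo, Set.mem_Ioo] at hs h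
        exact (lt_irrefl x) (h.2.trans (max_lt hx hs))
    obtain ⟨ε, h0, h1, hε⟩ := exists_Ioc_of_eventually hfin u.room_pos
    have hp := u.pos_nonneg
    have hε' := hε ε h0 le_rfl
    have hr : ε < G.len u.edge - u.pos := h1
    by_cases hu : u.fwd
    · simp only [par, hu, if_true, add_zero] at hε'
      rw [Set.uIoo_of_le (by linarith)] at hε'
      obtain ⟨m, hm⟩ := hS u.pos (u.pos + ε) hp (by linarith) (by linarith) hε'
      refine ⟨m, ε, h0, fun s hs => ?_⟩
      have := hm (u.pos + s) ⟨by linarith [hs.1], by linarith [hs.2]⟩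
      simpa [base, move, hu] using this
    · simp only [par, hu] at hε'
      rw [Set.uIoo_of_ge (by simp; linarith)] at hε'
      obtain ⟨m, hm⟩ := hS (G.len u.edge - (u.pos + ε)) (G.len u.edge - u.pos) (by linarith)
        (by linarith) (by linarith) (by simpa using hε')
      refine ⟨-m, ε, h0, fun s hs => ?_⟩
      have h2 := hm (G.len u.edge - (u.pos + s)) ⟨by linarith [hs.2], by linarith [hs.1]⟩
      have h3 := hm (G.len u.edge - u.pos) ⟨by linarith, by linarith⟩
      simp only [base, move, hu, Bool.false_eq_true, if_false, add_zero]
      rw [h2, h3]; push_cast; ring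
  · intro hf
    refine ⟨hf.continuous, fun e => ?_⟩
    have hm : ∀ t, Tangent.move (G := G) ⟨e, true, 0, le_rfl, G.len_pos e⟩ t = G.edgePt e t := by
      simp [move]
    have := hf.segment_induction ⟨e, true, 0, le_rfl, G.len_pos e⟩ (l := G.len e)
      (P := fun a b => ∃ S : Finset ℝ, ∀ a' b' : ℝ, a ≤ a' → a' < b' → b' ≤ b →
        (∀ s ∈ S, s ∉ Set.Ioo a' b') →
        ∃ m : ℤ, ∀ t ∈ Set.Icc a' b', f (G.edgePt e t) = f (G.edgePt e a') + m * (t - a'))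
      (by simp [room]) ?_ ?_ (a := 0) (b := G.len e) le_rfl (G.len_pos e) le_rfl
    · exact this
    · intro a b m h0 hab hb H
      refine ⟨∅, fun a' b' h1 h2 h3 _ => ⟨m, fun t ht => ?_⟩⟩
      have h4 := H t ⟨by linarith [ht.1], by linarith [ht.2]⟩
      have h5 := H a' ⟨by linarith, by linarith⟩
      simp only [hm] at h4 h5
      rw [h4, h5]; ring
    · classical
      rintro a s b h0 h1 h2 h3 ⟨S, hS⟩ ⟨S', hS'⟩
      refine ⟨insert s (S ∪ S'), fun a' b' h4 h5 h6 h => ?_⟩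
      simp only [Finset.mem_insert, Finset.mem_union] at h
      have hs := h s (.inl rfl)
      rcases le_or_gt b' s with h7 | h7
      · exact hS a' b' h4 h5 h7 fun x hx => h x (.inr (.inl hx))
      · exact hS' a' b' (not_lt.1 fun h8 => hs ⟨h8, h7⟩) h5 h6 fun x hx => h x (.inr (.inr hx))

/-! ### Principal divisors have degree zero -/

/-- The unit tangent vector at the beginning of an oriented edge. -/
def start (G : WGraph V E) (e : E) (b : Bool) : G.Tangent := ⟨e, b, 0, le_rfl, G.len_pos e⟩

lemma start_room (e : E) (b : Bool) : (start G e b).room = G.len e := by simp [room, start]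

lemma start_move (e : E) (t : ℝ) : (start G e true).move t = G.edgePt e t := by
  simp [start, move]

lemma start_rev (e : E) (h0 h1) :
    (start G e true).rev (start G e true).room h0 h1 = start G e false := by
  simp [start, rev, room]

lemma base_eq_vertex {u : G.Tangent} {v : V} (h : u.base = .vertex v) : u = start G u.edge u.fwd := by
  obtain ⟨e, b, p, h0, h1⟩ := u
  rcases h0.eq_or_lt with rfl | h0
  · rfl
  · exfalso
    cases b
    · simp only [base, move, add_zero, Bool.false_eq_true, if_false] at h
      rw [edgePt_of_mem ⟨by linarith, by linarith⟩] at h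
      cases h
    · simp only [base, move, add_zero, if_true] at h
      rw [edgePt_of_mem ⟨h0, h1⟩] at h
      cases h

lemma start_base_true (e : E) : (start G e true).base = .vertex (G.src e) := by
  simp [start, base, move, edgePt_of_nonpos]

lemma start_base_false (e : E) : (start G e false).base = .vertex (G.tgt e) := by
  simp [start, base, move, edgePt_of_len_le]

section
variable [Finite E]

/-- Slopes of a piecewise linear function along a segment: the outgoing slopes at the two ends and
the orders inside add up to zero. -/
lemma IsPL.telescope {f : G.Point → ℝ} (hf : IsPL f) (u : G.Tangent) :
    {s | s ∈ Set.Ioo 0 u.room ∧ ord f (u.move s) ≠ 0}.Finite ∧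
    outSlope f u + outSlope f (u.rev u.room u.room_pos le_rfl) +
      ∑ᶠ s ∈ Set.Ioo 0 u.room, ord f (u.move s) = 0 := by
  have key := hf.segment_induction u (l := u.room) le_rfl (P := fun a b =>
    {s | s ∈ Set.Ioo a b ∧ ord f (u.move s) ≠ 0}.Finite ∧ ∀ h0 h1 h2 h3,
      outSlope f (u.shift a h0 h1) + outSlope f (u.rev b h2 h3) +
      ∑ᶠ s ∈ Set.Ioo a b, ord f (u.move s) = 0) ?_ ?_ le_rfl u.room_pos le_rfl
  · refine ⟨key.1, ?_⟩
    simpa using key.2 le_rfl u.room_pos u.room_pos le_rfl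
  · intro a b m h0 hab hb H
    have hsl : ∀ s (h : a ≤ s) (h' : s < b),
        outSlope f (u.shift s (h0.trans h) (h'.trans_le hb)) = m := fun s h h' =>
      HasSlope.outSlope_eq ⟨b - s, sub_pos.2 h', fun d hd => by
        have h1 := H (s + d) ⟨by linarith [hd.1], by linarith [hd.2]⟩
        have h2 := H s ⟨h, h'.le⟩
        simp only [shift_move, shift_base, h1, h2]; ring⟩
    have hsr : ∀ s (h : a < s) (h' : s ≤ b),
        outSlope f (u.rev s (h0.trans_lt h) (h'.trans hb)) = -m := fun s h h' =>
      HasSlope.outSlope_eq ⟨s - a, sub_pos.2 h, fun d hd => by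
        have h1 := H (s - d) ⟨by linarith [hd.2], by linarith [hd.1]⟩
        have h2 := H s ⟨h.le, h'⟩
        simp only [rev_move, rev_base, h1, h2]; push_cast; ring⟩
    have hord : ∀ s ∈ Set.Ioo a b, ord f (u.move s) = 0 := fun s hs => by
      rw [ord_move f (h0.trans_lt hs.1) (hs.2.trans_le hb), hsl s hs.1.le hs.2,
        hsr s hs.1 hs.2.le, add_neg_cancel]
    refine ⟨?_, fun _ _ _ _ => ?_⟩
    · convert Set.finite_empty
      ext s
      simp only [Set.mem_ofPred_eq, ne_eq, Set.mem_empty_iff_false, iff_false, not_and, not_not]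
      exact hord s
    · rw [hsl a le_rfl hab, hsr b hab le_rfl, finsum_mem_congr rfl hord]
      simp
  · rintro a s b h0 has hsb hb ⟨hf1, h1⟩ ⟨hf2, h2⟩
    have hU : Set.Ioo a b = Set.Ioo a s ∪ ({s} ∪ Set.Ioo s b) := by
      ext t
      simp only [Set.mem_Ioo, Set.mem_union, Set.mem_singleton_iff]
      constructor
      · rintro ⟨h3, h4⟩
        rcases lt_trichotomy t s with h | h | h
        exacts [.inl ⟨h3, h⟩, .inr (.inl h), .inr (.inr ⟨h, h4⟩)]
      · rintro (h | rfl | h) <;> constructor <;> linarith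
    have hfin : {s' | s' ∈ {s} ∪ Set.Ioo s b ∧ ord f (u.move s') ≠ 0}.Finite :=
      ((Set.finite_singleton s).union hf2).subset fun t ht => ht.1.imp id fun h => ⟨h, ht.2⟩
    refine ⟨(hf1.union hfin).subset ?_, fun h3 h4 h5 h6 => ?_⟩
    · rintro t ⟨ht, ht'⟩
      rw [hU] at ht
      exact ht.imp (fun h => ⟨h, ht'⟩) fun h => ⟨h, ht'⟩
    · rw [hU, finsum_mem_union' _ hf1 hfin, finsum_mem_union' _ _ hf2, finsum_mem_singleton]
      · have e1 := h1 h3 (by linarith) (by linarith) (by linarith)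
        have e2 := h2 (by linarith) (by linarith) (by linarith) h6
        have e3 := ord_move f (u := u) (s := s) (by linarith) (by linarith)
        linarith
      · simp
      · exact (Set.finite_singleton s).subset fun t ht => ht.1
      · rw [Set.disjoint_left]
        rintro t h7 (rfl | h8)
        · exact lt_irrefl _ h7.2
        · exact lt_asymm h7.2 h8.1

lemma IsPL.finite_support_ord [Finite V] {f : G.Point → ℝ} (hf : IsPL f) :
    (Function.support (ord f)).Finite := by
  refine ((Set.finite_range Point.vertex).union (Set.finite_iUnion fun e =>
    ((hf.telescope (start G e true)).1.image (start G e true).move))).subset ?_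
  rintro (v | ⟨e, t, h⟩) hx
  · exact .inl ⟨v, rfl⟩
  · refine .inr (Set.mem_iUnion.2 ⟨e, t, ⟨by rwa [start_room], ?_⟩, ?_⟩)
    · rw [start_move, edgePt_of_mem h]; exact hx
    · rw [start_move, edgePt_of_mem h]

end

/-- A sum over the points of a divisor, rearranged edge by edge. -/
lemma sum_eq_edges [Fintype V] [Fintype E] (D : G.Div) {M : Type*} [AddCommMonoid M]
    (g : G.Point → ℤ → M) (hg : ∀ x, g x 0 = 0) :
    D.sum g = ∑ v, g (.vertex v) (D (.vertex v)) +
      ∑ e, ∑ᶠ t ∈ Set.Ioo 0 (G.len e), g (G.edgePt e t) (D (G.edgePt e t)) := by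
  classical
  let κ : G.Point → V ⊕ E := fun x => match x with
    | .vertex v => .inl v
    | .inner e _ _ => .inr e
  rw [Finsupp.sum, ← Finset.sum_fiberwise D.support κ, Fintype.sum_sum_type]
  congr 1
  · refine Finset.sum_congr rfl fun v _ => ?_
    rw [Finset.sum_subset (s₂ := {Point.vertex v}), Finset.sum_singleton]
    · rintro (w | ⟨e, t, h⟩) hx <;> simp_all [κ]
    · simp +contextual [κ, hg]
  · refine Finset.sum_congr rfl fun e _ => ?_
    have hinj : Set.InjOn (G.edgePt e) (Set.Ioo 0 (G.len e)) := fun t ht t' ht' h => by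
      rw [edgePt_of_mem ht'] at h
      exact (edgePt_eq_inner h).2
    rw [← finsum_mem_image (f := fun x => g x (D x)) hinj]
    symm
    apply finsum_mem_eq_sum_of_inter_support_eq
    ext x
    simp only [Set.mem_inter_iff, Set.mem_image, Function.mem_support, Finset.coe_filter,
      Finsupp.mem_support_iff, Set.mem_ofPred_eq]
    constructor
    · rintro ⟨⟨t, ht, rfl⟩, h⟩
      exact ⟨⟨fun h' => h (by rw [h', hg]), by simp [κ, edgePt_of_mem ht]⟩, h⟩
    · rintro ⟨⟨h, h'⟩, h''⟩
      refine ⟨?_, h''⟩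
      obtain v | ⟨e', t, ht⟩ := x
      · simp [κ] at h'
      · obtain rfl : e' = e := by simpa [κ] using h'
        exact ⟨t, ht, edgePt_of_mem ht⟩

/-- The degree of a divisor, edge by edge. -/
lemma deg_eq [Fintype V] [Fintype E] (D : G.Div) :
    deg D = ∑ v, D (.vertex v) + ∑ e, ∑ᶠ t ∈ Set.Ioo 0 (G.len e), D (G.edgePt e t) :=
  sum_eq_edges D (fun _ a => a) fun _ => rfl

/-- The principal divisor of a rational function. -/
def divisor [Finite V] [Finite E] (f : G.Point → ℝ) (hf : IsPL f) : G.Div :=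
  Finsupp.ofSupportFinite (ord f) hf.finite_support_ord

@[simp] lemma divisor_apply [Finite V] [Finite E] {f : G.Point → ℝ} (hf : IsPL f) (x : G.Point) :
    divisor f hf x = ord f x := rfl

lemma deg_add (D D' : G.Div) : deg (D + D') = deg D + deg D' :=
  Finsupp.sum_add_index' (fun _ => rfl) fun _ _ _ => rfl

/-- A principal divisor has degree zero. -/
lemma deg_divisor [Fintype V] [Fintype E] {f : G.Point → ℝ} (hf : IsPL f) :
    deg (divisor f hf) = 0 := by
  classical
  rw [deg_eq]
  have h1 : ∑ v, divisor f hf (.vertex v) =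
      ∑ e, (outSlope f (start G e true) + outSlope f (start G e false)) := by
    have : ∀ v, divisor f hf (.vertex v) =
        ∑ p : E × Bool, if (start G p.1 p.2).base = .vertex v then
          outSlope f (start G p.1 p.2) else 0 := fun v => by
      rw [divisor_apply, ord_eq_sum, ← Finset.sum_filter]
      symm
      refine Finset.sum_nbij' (fun p => start G p.1 p.2) (fun u => (u.edge, u.fwd)) ?_ ?_ ?_ ?_ ?_
      · simp
      · intro u hu
        simp only [Finset.mem_filter, Finset.mem_univ, true_and]
        rw [← base_eq_vertex (mem_tangents.1 hu), mem_tangents.1 hu]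
      · simp [start]
      · intro u hu
        exact (base_eq_vertex (mem_tangents.1 hu)).symm
      · simp
    simp only [this]
    rw [Finset.sum_comm, Fintype.sum_prod_type]
    refine Finset.sum_congr rfl fun e _ => ?_
    simp [start_base_true, start_base_false]
  rw [h1, ← Finset.sum_add_distrib]
  refine Finset.sum_eq_zero fun e _ => ?_
  have := (hf.telescope (start G e true)).2
  rw [start_rev, start_room] at this
  simpa only [start_move, divisor_apply] using this

lemma LinEquiv.symm [Finite E] {D D' : G.Div} (h : LinEquiv D D') : LinEquiv D' D := by
  obtain ⟨f, hf, h⟩ := h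
  rw [isRational_iff] at hf
  exact ⟨-f, isRational_iff.2 hf.neg, fun P => by rw [h, hf.ord_neg]; ring⟩

lemma LinEquiv.trans [Finite E] {D D' D'' : G.Div} (h : LinEquiv D D') (h' : LinEquiv D' D'') :
    LinEquiv D D'' := by
  obtain ⟨f, hf, h⟩ := h
  obtain ⟨g, hg, h'⟩ := h'
  rw [isRational_iff] at hf hg
  exact ⟨f + g, isRational_iff.2 (hf.add hg), fun P => by rw [h, hf.ord_add hg, h']; ring⟩

lemma LinEquiv.refl [Finite E] (D : G.Div) : LinEquiv D D :=
  ⟨fun _ => 0, isRational_iff.2 (isPL_const 0), fun P => by rw [ord_const, add_zero]⟩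

lemma linEquiv_add_divisor [Finite V] [Finite E] (D : G.Div) {f : G.Point → ℝ} (hf : IsPL f) :
    LinEquiv (D + divisor f hf) D := ⟨f, isRational_iff.2 hf, fun _ => rfl⟩

lemma LinEquiv.deg_eq [Fintype V] [Fintype E] {D D' : G.Div} (h : LinEquiv D D') :
    deg D = deg D' := by
  obtain ⟨f, hf, h⟩ := h
  rw [isRational_iff] at hf
  have : D = D' + divisor f hf := Finsupp.ext h
  rw [this, deg_add, deg_divisor, add_zero]

/-! ### Convexity and the bound on slopes -/

section
variable [Finite E]

/-- If `f` has non-negative order on the interior of a segment, then it is convex there: it lies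
above its tangent line at the beginning of the segment. -/
lemma IsPL.tangent_le {f : G.Point → ℝ} (hf : IsPL f) (u : G.Tangent) {l : ℝ} (hl : l ≤ u.room)
    (h : ∀ s, 0 < s → s < l → 0 ≤ ord f (u.move s)) {s : ℝ} (h0 : 0 ≤ s) (hs : s ≤ l) :
    f u.base + outSlope f u * s ≤ f (u.move s) := by
  rcases h0.eq_or_lt with rfl | h0
  · simp [base]
  have key := hf.segment_induction u hl (P := fun a b => ∀ h0 h1 h2 h3,
    outSlope f (u.shift a h0 h1) ≤ - outSlope f (u.rev b h2 h3) ∧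
    f (u.move a) + outSlope f (u.shift a h0 h1) * (b - a) ≤ f (u.move b)) ?_ ?_ le_rfl h0 hs
  · have := (key le_rfl u.room_pos h0 (hs.trans hl)).2
    simpa [base] using this
  · intro a b m ha hab hb H h1 h2 h3 h4
    have e1 : outSlope f (u.shift a h1 h2) = m := HasSlope.outSlope_eq
      ⟨b - a, sub_pos.2 hab, fun d hd => by
        simpa using H (a + d) ⟨by linarith [hd.1], by linarith [hd.2]⟩⟩
    have e2 : outSlope f (u.rev b h3 h4) = -m := HasSlope.outSlope_eq
      ⟨b - a, sub_pos.2 hab, fun d hd => by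
        have h5 := H (b - d) ⟨by linarith [hd.2], by linarith [hd.1]⟩
        have h6 := H b ⟨hab.le, le_rfl⟩
        simp only [rev_move, rev_base, h5, h6]; push_cast; ring⟩
    rw [e1, e2, neg_neg]
    exact ⟨le_rfl, (H b ⟨hab.le, le_rfl⟩).ge⟩
  · intro a s b ha has hsb hb h1 h2 h3 h4 h5 h6
    obtain ⟨i1, i2⟩ := h1 h3 h4 (by linarith) (by linarith)
    obtain ⟨i3, i4⟩ := h2 (by linarith) (by linarith) h5 h6
    have h7 := h s (by linarith) (by linarith)
    rw [ord_move f (by linarith) (by linarith)] at h7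
    have h8 : outSlope f (u.shift a h3 h4) ≤ outSlope f (u.shift s (by linarith) (by linarith)) := by
      linarith
    refine ⟨h8.trans i3, ?_⟩
    have h9 : (outSlope f (u.shift a h3 h4) : ℝ) ≤
      outSlope f (u.shift s (by linarith) (by linarith)) := by exact_mod_cast h8
    nlinarith

lemma IsPL.tangent_le_shift {f : G.Point → ℝ} (hf : IsPL f) (u : G.Tangent) {l : ℝ}
    (hl : l ≤ u.room) (h : ∀ s, 0 < s → s < l → 0 ≤ ord f (u.move s)) {a s : ℝ} (h0 : 0 ≤ a)
    (h1 : a < u.room) (has : a ≤ s) (hs : s ≤ l) :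
    f (u.move a) + outSlope f (u.shift a h0 h1) * (s - a) ≤ f (u.move s) := by
  have := hf.tangent_le (u.shift a h0 h1) (l := l - a) (by simpa using hl)
    (fun t h2 h3 => by rw [shift_move]; exact h _ (by linarith) (by linarith))
    (s := s - a) (by linarith) (by linarith)
  simpa using this

lemma IsPL.tangent_le_rev {f : G.Point → ℝ} (hf : IsPL f) (u : G.Tangent) {l : ℝ}
    (h : ∀ s, 0 < s → s < l → 0 ≤ ord f (u.move s)) {b s : ℝ} (h0 : 0 < b)
    (h1 : b ≤ u.room) (hb : b ≤ l) (h2 : 0 ≤ s) (hs : s ≤ b) :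
    f (u.move b) + outSlope f (u.rev b h0 h1) * (b - s) ≤ f (u.move s) := by
  have := hf.tangent_le (u.rev b h0 h1) (l := b) (le_rev_room _ _ _)
    (fun t h2 h3 => by rw [rev_move]; exact h _ (by linarith) (by linarith))
    (s := b - s) (by linarith) (by linarith)
  simpa using this

/-- Convexity on a segment, in terms of the values at three points. -/
lemma IsPL.le_chord {f : G.Point → ℝ} (hf : IsPL f) (u : G.Tangent) {l : ℝ} (hl : l ≤ u.room)
    (h : ∀ s, 0 < s → s < l → 0 ≤ ord f (u.move s)) {s b : ℝ} (h0 : 0 < s) (hsb : s < b)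
    (hb : b ≤ l) : b * f (u.move s) ≤ (b - s) * f u.base + s * f (u.move b) := by
  have h1 := hf.tangent_le_shift u hl h h0.le (by linarith) hsb.le hb
  have h2 := hf.tangent_le_rev u h h0 (by linarith) (by linarith) le_rfl h0.le
  have h3 := h s h0 (by linarith)
  rw [ord_move f h0 (by linarith)] at h3
  have h4 : (0 : ℝ) ≤ outSlope f (u.shift s h0.le (by linarith)) +
    outSlope f (u.rev s h0 (by linarith)) := by exact_mod_cast h3
  have h5 : 0 ≤ s * (b - s) := mul_nonneg h0.le (by linarith)
  change _ ≤ (b - s) * f (u.move 0) + _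
  nlinarith [mul_le_mul_of_nonneg_left h1 h0.le,
    mul_le_mul_of_nonneg_left h2 (show 0 ≤ b - s by linarith), mul_nonneg h5 h4]

end

/-- If `F + div f` is effective, then the slopes of `f` are bounded by the degree of the effective
divisor `F`. -/
lemma IsPL.outSlope_le_deg [Fintype V] [Fintype E] {F : G.Div} (hF : 0 ≤ F) {f : G.Point → ℝ}
    (hf : IsPL f) (h : ∀ x, 0 ≤ F x + ord f x) (u : G.Tangent) : outSlope f u ≤ deg F := by
  -- Raising `f` to its value at the base of `u` makes all slopes at this point non-negative. Their
  -- sum is at most a coefficient of the effective divisor `F + div g`, which has degree `deg F`.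
  set g : G.Point → ℝ := f ⊔ fun _ => f u.base with hg
  have hgPL : IsPL g := hf.sup (isPL_const _)
  have hmono : ∀ x, 0 ≤ F x + ord g x := by
    refine hf.nonneg_sup (isPL_const _) h fun x => ?_
    rw [ord_const, add_zero]; exact hF x
  have h1 : outSlope f u ≤ outSlope g u :=
    hf.outSlope_le hgPL (by simp [hg]) (.of_forall fun s => le_sup_left)
  have h2 : ∀ w : G.Tangent, w.base = u.base → 0 ≤ outSlope g w := fun w hw => by
    rw [← outSlope_const (f u.base) w]
    exact (isPL_const _).outSlope_le hgPL (by simp [hg, hw]) (.of_forall fun s => le_sup_right)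
  have h3 : outSlope g u ≤ ord g u.base := by
    rw [ord_eq_sum]
    exact Finset.single_le_sum (fun w hw => h2 w (mem_tangents.1 hw)) (mem_tangents.2 rfl)
  have h4 : F u.base + ord g u.base ≤ deg (F + divisor g hgPL) := by
    by_cases h0 : (F + divisor g hgPL) u.base = 0
    · rw [show F u.base + ord g u.base = 0 from h0]
      exact Finset.sum_nonneg fun x _ => hmono x
    · exact Finset.single_le_sum (f := fun x => (F + divisor g hgPL) x)
        (fun x _ => hmono x) (Finsupp.mem_support_iff.2 h0)
  rw [deg_add, deg_divisor, add_zero] at h4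
  linarith [hF u.base, show (0 : G.Div) u.base = 0 from rfl]

lemma IsPL.neg_deg_le_outSlope [Fintype V] [Fintype E] {F : G.Div} (hF : 0 ≤ F) {f : G.Point → ℝ}
    (hf : IsPL f) (h : ∀ x, 0 ≤ F x + ord f x) (u : G.Tangent) : -deg F ≤ outSlope f u := by
  obtain ⟨ε, h0, h1, H⟩ := exists_Ioc_of_eventually (hf.hasSlope u).eventually u.room_pos
  have h2 : outSlope f (u.rev ε h0 h1.le) = -outSlope f u := HasSlope.outSlope_eq
    ⟨ε / 2, by linarith, fun d hd => by
      simp only [rev_move, rev_base]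
      rw [H ε h0 le_rfl, H (ε - d) (by linarith [hd.2]) (by linarith [hd.1])]
      push_cast; ring⟩
  have := hf.outSlope_le_deg hF h (u.rev ε h0 h1.le)
  linarith

/-! ### Cuts -/

/-- In any direction at any point, a closed connected set either contains a small segment, or
leaves at once. -/
lemma IsCut.germ {X : Set G.Point} (hX : IsCut X) (w : G.Tangent) :
    (∀ᶠ s in 𝓝[>] (0 : ℝ), w.move s ∈ X) ∨ ∀ᶠ s in 𝓝[>] (0 : ℝ), w.move s ∉ X := by
  by_cases hb : w.base ∈ X
  swap
  · exact .inr (isClosed_iff_germ.1 hX.1 w hb)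
  by_contra! hcon
  obtain ⟨h1, h2⟩ := hcon
  -- Three points on the segment, alternately off `X`, on `X` and off `X`, disconnect `X`.
  obtain ⟨c, hc, hc0, hcr⟩ := (h1.and_eventually (eventually_lt_room w)).exists
  obtain ⟨b, hb', hb0, hbc⟩ := (h2.and_eventually (Ioo_mem_nhdsGT hc0)).exists
  obtain ⟨a, ha, ha0, hab⟩ := (h1.and_eventually (Ioo_mem_nhdsGT hb0)).exists
  have hpre := hX.2.isPreconnected
  have hne : w.base ∉ w.move '' Set.Icc a c := by
    rintro ⟨s, ⟨h3, h4⟩, h⟩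
    have := move_injOn (u := w) (s := s) (s' := 0) (by linarith) (by linarith) h.symm
    linarith
  obtain ⟨x, hx, ⟨s, hs, rfl⟩, hx2⟩ := hpre (w.move '' Set.Ioo a c) (w.move '' Set.Icc a c)ᶜ
    (isOpen_segment w ha0.le hcr.le) (isClosed_segment w a c).isOpen_compl
    (fun x hx => by
      by_cases h : x ∈ w.move '' Set.Icc a c
      · obtain ⟨s, ⟨h3, h4⟩, rfl⟩ := h
        refine .inl ⟨s, ⟨lt_of_le_of_ne h3 ?_, lt_of_le_of_ne h4 ?_⟩, rfl⟩
        · rintro rfl; exact ha hx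
        · rintro rfl; exact hc hx
      · exact .inr h)
    ⟨_, hb', b, ⟨hab, hbc⟩, rfl⟩ ⟨_, hb, hne⟩
  exact hx2 ⟨s, Set.Ioo_subset_Icc_self hs, rfl⟩

lemma base_mem_frontier {X : Set G.Point} {w : G.Tangent} (hw : w ∈ outgoing X) :
    w.base ∈ frontier X := by
  rw [frontier_eq_closure_inter_closure]
  refine ⟨subset_closure hw.1, ?_⟩
  have : Tendsto w.move (𝓝[>] 0) (𝓝 w.base) :=
    w.continuous_move.continuousAt.mono_left nhdsWithin_le_nhds
  exact mem_closure_of_tendsto this hw.2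

section
variable [Finite E]

lemma IsCut.exists_outgoing {X : Set G.Point} (hX : IsCut X) {x : G.Point} (hx : x ∈ frontier X) :
    ∃ w ∈ outgoing X, w.base = x := by
  have hxX : x ∈ X := hX.1.frontier_subset hx
  by_contra! hcon
  refine hx.2 (mem_interior_iff_mem_nhds.2 (mem_nhds_of_germ hxX fun w hw => ?_))
  exact (hX.germ w).resolve_right fun h => hcon w ⟨hw ▸ hxX, h⟩ hw

open Classical in
lemma outDeg_eq (X : Set G.Point) (x : G.Point) :
    outDeg X x = {w ∈ tangents x | w ∈ outgoing X}.card := by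
  rw [outDeg, ← Set.ncard_coe_finset]
  congr 1
  ext w
  simp [and_comm]

lemma outDeg_pos {X : Set G.Point} {w : G.Tangent} (hw : w ∈ outgoing X) :
    0 < outDeg X w.base := by
  classical
  rw [outDeg_eq]
  exact Finset.card_pos.2 ⟨w, by simpa using hw⟩

lemma IsSaturated.pos {F : G.Div} {X : Set G.Point} (hX : IsCut X) (hs : IsSaturated F X)
    {x : G.Point} (hx : x ∈ frontier X) : 0 < F x := by
  obtain ⟨w, hw, rfl⟩ := hX.exists_outgoing hx
  have h1 := hs _ hx
  have h2 := outDeg_pos hw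
  omega

lemma IsSaturated.finite_outgoing {F : G.Div} {X : Set G.Point} (hX : IsCut X)
    (hs : IsSaturated F X) : (outgoing X).Finite := by
  refine (Set.Finite.biUnion F.support.finite_toSet fun x _ => finite_base (G := G) x).subset ?_
  intro w hw
  simp only [Set.mem_iUnion]
  exact ⟨w.base, Finsupp.mem_support_iff.2 (hs.pos hX (base_mem_frontier hw)).ne', rfl⟩

/-- A connected set without points of `F` meets a saturated cut for `F` either not at all, or is
contained in it. -/
lemma IsSaturated.subset {F : G.Div} {X A : Set G.Point} (hX : IsCut X)
    (hs : IsSaturated F X) (hA : IsPreconnected A) (hF : ∀ x ∈ A, F x = 0)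
    (hne : (A ∩ X).Nonempty) : A ⊆ X := by
  by_contra h
  obtain ⟨x, hx, hxX⟩ := Set.not_subset.1 h
  have hint : ∀ y ∈ A, y ∈ X → y ∈ interior X := fun y hy hyX => by
    by_contra hyi
    exact (hs.pos hX ⟨subset_closure hyX, hyi⟩).ne' (hF y hy)
  obtain ⟨z, hz, hzX⟩ := hne
  obtain ⟨y, -, hy1, hy2⟩ := hA (interior X) Xᶜ isOpen_interior hX.1.isOpen_compl
    (fun y hy => (em (y ∈ X)).imp (hint y hy) id) ⟨z, hz, hint z hz hzX⟩ ⟨x, hx, hxX⟩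
  exact hy2 (interior_subset hy1)

lemma IsSaturated.mem_outgoing {F : G.Div} {X : Set G.Point} (hX : IsCut X)
    (hs : IsSaturated F X) {u : G.Tangent} {d : ℝ} (h0 : 0 < d)
    (hF : ∀ s, 0 < s → s < d → F (u.move s) = 0) (hu : u.base ∈ X) (hd : u.move d ∉ X) :
    u ∈ outgoing X := by
  refine ⟨hu, (hX.germ u).resolve_left fun h => hd ?_⟩
  obtain ⟨ε, h1, h2, h3⟩ := exists_Ioc_of_eventually h h0
  have hsub : u.move '' Set.Ioo 0 d ⊆ X := hs.subset hX
    (isPreconnected_Ioo.image _ u.continuous_move.continuousOn)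
    (by rintro _ ⟨s, hs, rfl⟩; exact hF s hs.1 hs.2)
    ⟨_, ⟨ε, ⟨h1, h2⟩, rfl⟩, h3 ε h1 le_rfl⟩
  have hcl : u.move '' closure (Set.Ioo 0 d) ⊆ X :=
    (image_closure_subset_closure_image u.continuous_move).trans (closure_minimal hsub hX.1)
  rw [closure_Ioo h0.ne] at hcl
  exact hcl ⟨d, ⟨h0.le, le_rfl⟩, rfl⟩

/-- Let `F + div f` be effective along the closed set `Z`, and suppose that at each point of `Z`
either all directions stay in `Z`, or `f` increases in no direction and decreases in all directions
that leave `Z`. Then the connected components of `Z` are cuts saturated for `F`. -/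
lemma saturated_component {F : G.Div} {f : G.Point → ℝ} {Z : Set G.Point} (hZ : IsClosed Z)
    (h1 : ∀ x ∈ Z, 0 ≤ F x + ord f x)
    (h2 : ∀ x ∈ Z, (0 ≤ F x ∧ ∀ w : G.Tangent, w.base = x → ∀ᶠ s in 𝓝[>] (0 : ℝ), w.move s ∈ Z) ∨
      ∀ w : G.Tangent, w.base = x → outSlope f w ≤ 0 ∧
        (outSlope f w = 0 → ∀ᶠ s in 𝓝[>] (0 : ℝ), w.move s ∈ Z)) {x : G.Point} (hx : x ∈ Z) :
    IsCut (connectedComponentIn Z x) ∧ IsSaturated F (connectedComponentIn Z x) := by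
  classical
  have hsub := connectedComponentIn_subset Z x
  have hcl : IsClosed (connectedComponentIn Z x) := by
    refine isClosed_of_closure_subset ?_
    exact isPreconnected_connectedComponentIn.closure.subset_connectedComponentIn
      (subset_closure (mem_connectedComponentIn hx)) (closure_minimal hsub hZ)
  refine ⟨⟨hcl, isConnected_connectedComponentIn_iff.2 hx⟩, ?_⟩
  set C := connectedComponentIn Z x with hC
  have hgerm : ∀ w ∈ outgoing C, ¬ ∀ᶠ s in 𝓝[>] (0 : ℝ), w.move s ∈ Z := fun w hw h => by
    obtain ⟨ε, h0, -, h⟩ := exists_Ioc_of_eventually h one_pos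
    obtain ⟨s, hs, hs0, hs1⟩ := (hw.2.and (Ioo_mem_nhdsGT h0)).exists
    have hseg : w.move '' Set.Icc 0 s ⊆ Z := by
      rintro _ ⟨t, ht, rfl⟩
      rcases ht.1.eq_or_lt with rfl | ht0
      · exact hsub hw.1
      · exact h t ht0 (ht.2.trans hs1.le)
    have hbC : w.base ∈ C := hw.1
    have hmem : w.move '' Set.Icc 0 s ⊆ C := by
      rw [hC, connectedComponentIn_eq hbC]
      exact (isConnected_segment w hs0.le).isPreconnected.subset_connectedComponentIn
        ⟨0, ⟨le_rfl, hs0.le⟩, rfl⟩ hseg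
    exact hs (hmem ⟨s, ⟨hs0.le, le_rfl⟩, rfl⟩)
  intro y hy
  have hyC : y ∈ C := hcl.frontier_subset hy
  rw [outDeg_eq]
  rcases h2 y (hsub hyC) with ⟨h3, h4⟩ | h3
  · rw [Finset.filter_eq_empty_iff.2]
    · simpa using h3
    · exact fun w hw hwo => hgerm w hwo (h4 w (mem_tangents.1 hw))
  · have h4 := h1 y (hsub hyC)
    rw [ord_eq_sum] at h4
    have h5 : ∑ w ∈ tangents y, outSlope f w ≤
        ∑ w ∈ tangents y, if w ∈ outgoing C then (-1 : ℤ) else 0 := by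
      refine Finset.sum_le_sum fun w hw => ?_
      obtain ⟨h6, h7⟩ := h3 w (mem_tangents.1 hw)
      split_ifs with h8
      · have : outSlope f w ≠ 0 := fun h => hgerm w h8 (h7 h)
        omega
      · exact h6
    rw [← Finset.sum_filter, Finset.sum_const] at h5
    simp only [mul_neg, mul_one, nsmul_eq_mul] at h5
    linarith

/-! ### Reduced divisors and maxima of rational functions -/

/-- If `F` is `P`-reduced and `F + div f` is effective away from `P`, then `f` takes its maximum
at `P`: otherwise the components of the locus where `f` is maximal are saturated cuts. -/
lemma IsReduced.le [Finite V] {P : G.Point} {F : G.Div} (hF : IsReduced P F) {f : G.Point → ℝ}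
    (hf : IsPL f) (h : ∀ x, x ≠ P → 0 ≤ F x + ord f x) (x : G.Point) : f x ≤ f P := by
  obtain ⟨y, -, hy⟩ := isCompact_univ.exists_isMaxOn ⟨P, Set.mem_univ P⟩ hf.continuous.continuousOn
  have hy : ∀ x, f x ≤ f y := fun x => hy (Set.mem_univ x)
  by_contra! hlt
  have hP : f P < f y := hlt.trans_le (hy x)
  let Z : Set G.Point := {x | f x = f y}
  have hZ : IsClosed Z := isClosed_eq hf.continuous continuous_const
  have hZP : ∀ x ∈ Z, x ≠ P := by rintro x hx rfl; exact hP.ne hx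
  have hsl : ∀ x ∈ Z, ∀ w : G.Tangent, w.base = x → outSlope f w ≤ 0 ∧
      (outSlope f w = 0 → ∀ᶠ s in 𝓝[>] (0 : ℝ), w.move s ∈ Z) := by
    rintro _ hx w rfl
    have hx : f w.base = f y := hx
    constructor
    · rw [← outSlope_const (f y) w]
      exact hf.outSlope_le (isPL_const _) hx.ge (.of_forall fun s => hy _)
    · intro h0
      filter_upwards [(hf.hasSlope w).eventually] with s hs
      simpa [Z, h0, hx] using hs
  obtain ⟨h1, h2⟩ := saturated_component (F := F) (f := f) hZ (fun x hx => h x (hZP x hx))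
    (fun x hx => .inr (hsl x hx)) (show y ∈ Z from rfl)
  obtain ⟨v, hv, hlt⟩ := hF.2 _ h1 fun hPC => hZP P (connectedComponentIn_subset _ _ hPC) rfl
  exact (h2 v hv).not_gt hlt

/-- A divisor is linearly equivalent to at most one `P`-reduced divisor. -/
lemma IsReduced.eq [Finite V] {P : G.Point} {F F' : G.Div} (hF : IsReduced P F)
    (hF' : IsReduced P F') (h : LinEquiv F F') : F = F' := by
  obtain ⟨f, hf, h⟩ := h
  rw [isRational_iff] at hf
  have h1 := hF'.le hf fun x hx => by rw [← h]; exact hF.1 x hx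
  have h2 := hF.le hf.neg fun x hx => by
    rw [h, hf.ord_neg]; linarith [hF'.1 x hx]
  have : f = fun _ => f P := funext fun x => le_antisymm (h1 x) (neg_le_neg_iff.1 (h2 x))
  ext x
  rw [h, this, ord_const, add_zero]

end

/-! ### Firing a cut -/

lemma eventually_forall_le {p : ℝ → Prop} (h : ∀ᶠ s in 𝓝[>] (0 : ℝ), p s) :
    ∀ᶠ ε in 𝓝[>] (0 : ℝ), ∀ s, 0 < s → s ≤ ε → p s := by
  obtain ⟨ε, h0, -, h⟩ := exists_Ioc_of_eventually h one_pos
  exact eventually_of_Ioo h0 fun ε' _ h2 s h3 h4 => h s h3 (h4.trans h2.le)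

/-- Distinct unit tangent vectors have disjoint germs. -/
lemma eventually_move_ne_move {u w : G.Tangent} (h : u ≠ w) :
    ∀ᶠ ε in 𝓝[>] (0 : ℝ), ∀ s s', 0 < s → s ≤ ε → 0 < s' → s' ≤ ε → u.move s ≠ w.move s' := by
  by_cases he : w.edge = u.edge
  swap
  · filter_upwards [eventually_lt_room u] with ε hε s s' h0 h1 _ _ heq
    exact he (move_eq_move h0 (h1.trans_lt hε.2) heq.symm).1
  by_cases hf : w.fwd = u.fwd
  · have hp : w.pos ≠ u.pos := by
      intro hp
      refine h (eq_of_base_eq ?_ he.symm hf.symm)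
      simp [base, move, he, hf, hp]
    filter_upwards [eventually_lt_room u, Ioo_mem_nhdsGT (abs_pos.2 (sub_ne_zero.2 hp))]
      with ε hε hε' s s' h0 h1 h2 h3 heq
    have := (move_eq_move h0 (h1.trans_lt hε.2) heq.symm).2
    have h4 : w.pos - u.pos = s - s' := by
      simp only [par, he, hf] at this
      split_ifs at this <;> linarith
    rw [h4] at hε'
    have : |s - s'| < ε := abs_lt.2 ⟨by linarith, by linarith⟩
    exact lt_asymm this hε'.2
  · have hev : ∀ᶠ ε in 𝓝[>] (0 : ℝ), 0 < G.len u.edge - u.pos - w.pos →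
        2 * ε < G.len u.edge - u.pos - w.pos := by
      by_cases hg : 0 < G.len u.edge - u.pos - w.pos
      · filter_upwards [Ioo_mem_nhdsGT (half_pos hg)] with ε hε _
        linarith [hε.2]
      · exact .of_forall fun _ h => (hg h).elim
    filter_upwards [eventually_lt_room u, hev] with ε hε hε' s s' h0 h1 h2 h3 heq
    have := (move_eq_move h0 (h1.trans_lt hε.2) heq.symm).2
    have h4 : G.len u.edge - u.pos - w.pos = s + s' := by
      revert hf this
      simp only [par, he]
      cases w.fwd <;> cases u.fwd <;> simp <;> intros <;> linarith
    have := hε' (by linarith)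
    linarith

/-- The segments of length `ε` in the directions leaving `X` are contained in open edges, pairwise
disjoint, and avoid `X` and the further set `T`. -/
structure IsStar (X T : Set G.Point) (ε : ℝ) : Prop where
  pos : 0 < ε
  lt_room : ∀ w ∈ outgoing X, ε < w.room
  notMem : ∀ w ∈ outgoing X, ∀ s, 0 < s → s ≤ ε → w.move s ∉ X
  notMem' : ∀ w ∈ outgoing X, ∀ s, 0 < s → s ≤ ε → w.move s ∉ T
  inj : ∀ w ∈ outgoing X, ∀ w' ∈ outgoing X, ∀ s s', 0 < s → s ≤ ε → 0 < s' → s' ≤ ε →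
    w.move s = w'.move s' → w = w' ∧ s = s'

lemma eventually_isStar {X T : Set G.Point} (hX : (outgoing X).Finite) (hT : T.Finite) :
    ∀ᶠ ε in 𝓝[>] (0 : ℝ), IsStar X T ε := by
  have h1 : ∀ᶠ ε in 𝓝[>] (0 : ℝ), ∀ w ∈ outgoing X, ε < w.room :=
    (eventually_all_finite hX).2 fun w _ => (eventually_lt_room w).mono fun _ h => h.2
  have h2 : ∀ᶠ ε in 𝓝[>] (0 : ℝ), ∀ w ∈ outgoing X, ∀ s, 0 < s → s ≤ ε → w.move s ∉ X :=
    (eventually_all_finite hX).2 fun w hw => eventually_forall_le hw.2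
  have h3 : ∀ᶠ ε in 𝓝[>] (0 : ℝ), ∀ w ∈ outgoing X, ∀ s, 0 < s → s ≤ ε → w.move s ∉ T := by
    refine (eventually_all_finite hX).2 fun w hw => eventually_forall_le ?_
    have hc : IsClosed (T \ {w.base}) := (hT.subset Set.sdiff_subset).isClosed
    filter_upwards [isClosed_iff_germ.1 hc w (by simp), eventually_lt_room w] with s hs hr hsT
    refine hs ⟨hsT, fun h => ?_⟩
    exact hr.1.ne (move_injOn hr.1 hr.2 (s' := 0) h.symm)
  have h4 : ∀ᶠ ε in 𝓝[>] (0 : ℝ), ∀ w ∈ outgoing X, ∀ w' ∈ outgoing X, w ≠ w' →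
      ∀ s s', 0 < s → s ≤ ε → 0 < s' → s' ≤ ε → w.move s ≠ w'.move s' := by
    refine (eventually_all_finite hX).2 fun w _ => (eventually_all_finite hX).2 fun w' _ => ?_
    by_cases h : w = w'
    · exact .of_forall fun _ h' => (h' h).elim
    · exact (eventually_move_ne_move h).mono fun _ h _ => h
  filter_upwards [h1, h2, h3, h4, self_mem_nhdsWithin] with ε h1 h2 h3 h4 h5
  refine ⟨h5, h1, h2, h3, fun w hw w' hw' s s' i1 i2 i3 i4 heq => ?_⟩
  by_cases h : w = w'
  · subst h
    exact ⟨rfl, move_injOn i3 (i4.trans_lt (h1 w hw)) heq⟩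
  · exact (h4 w hw w' hw' h s s' i1 i2 i3 i4 heq).elim

open Classical in
/-- The function that fires the set `X` at height `η`: it equals `η` on `X`, decreases with slope
`c w` in each direction `w` leaving `X` until it reaches zero, and vanishes elsewhere. The number
`ε` is the length of a star around `X` where the descent takes place. -/
def fire (X : Set G.Point) (c : G.Tangent → ℕ) (ε η : ℝ) (x : G.Point) : ℝ :=
  if x ∈ X then η else
    if h : ∃ p : G.Tangent × ℝ, p.1 ∈ outgoing X ∧ 0 < p.2 ∧ p.2 ≤ ε ∧ p.1.move p.2 = x then
      max 0 (η - c h.choose.1 * h.choose.2) else 0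

section Fire

variable {X T : Set G.Point} {c : G.Tangent → ℕ} {ε η : ℝ}

lemma fire_of_mem {x : G.Point} (hx : x ∈ X) : fire X c ε η x = η := by simp [fire, hx]

lemma fire_ray (hst : IsStar X T ε) (hη : 0 ≤ η) {w : G.Tangent} (hw : w ∈ outgoing X) {s : ℝ}
    (h0 : 0 ≤ s) (h1 : s ≤ ε) : fire X c ε η (w.move s) = max 0 (η - c w * s) := by
  rcases h0.eq_or_lt with rfl | h0
  · rw [fire_of_mem (by exact hw.1)]; simp [hη]
  · have hex : ∃ p : G.Tangent × ℝ, p.1 ∈ outgoing X ∧ 0 < p.2 ∧ p.2 ≤ ε ∧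
        p.1.move p.2 = w.move s := ⟨(w, s), hw, h0, h1, rfl⟩
    rw [fire, if_neg (hst.notMem w hw s h0 h1), dif_pos hex]
    obtain ⟨h2, h3, h4, h5⟩ := hex.choose_spec
    obtain ⟨h6, h7⟩ := hst.inj _ h2 _ hw _ _ h3 h4 h0 h1 h5
    rw [h6, h7]

/-- The firing function vanishes away from `X` and the initial parts of the directions
leaving `X`. -/
lemma fire_eq_zero (hst : IsStar X T ε) (hη : 0 ≤ η) (hc : ∀ w ∈ outgoing X, 0 < c w) {x : G.Point}
    (hx : x ∉ X) (hx' : ∀ w ∈ outgoing X, ∀ s, 0 < s → s < η / c w → w.move s ≠ x) :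
    fire X c ε η x = 0 := by
  by_cases h : ∃ p : G.Tangent × ℝ, p.1 ∈ outgoing X ∧ 0 < p.2 ∧ p.2 ≤ ε ∧ p.1.move p.2 = x
  · obtain ⟨⟨w, s⟩, h1, h2, h3, rfl⟩ := h
    rw [fire_ray hst hη h1 h2.le h3]
    have h4 : η / c w ≤ s := not_lt.1 fun h => hx' w h1 s h2 h rfl
    have h5 : (0 : ℝ) < c w := by exact_mod_cast hc w h1
    rw [div_le_iff₀ h5] at h4
    exact max_eq_left (by linarith)
  · rw [fire, if_neg hx, dif_neg h]

lemma fire_nonneg (hη : 0 ≤ η) (x : G.Point) : 0 ≤ fire X c ε η x := by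
  unfold fire
  split_ifs
  exacts [hη, le_max_left _ _, le_rfl]

lemma fireEnd_mem (hη : 0 < η) (hηε : η < ε) (hc : ∀ w ∈ outgoing X, 0 < c w) {w : G.Tangent}
    (hw : w ∈ outgoing X) : 0 < η / c w ∧ η / c w < ε ∧ c w * (η / c w) = η := by
  have h5 : (1 : ℝ) ≤ c w := by exact_mod_cast hc w hw
  exact ⟨by positivity, (div_le_self hη.le h5).trans_lt hηε, by field_simp⟩

lemma hasSlope_fire_outgoing (hst : IsStar X T ε) (hη : 0 < η) (hηε : η < ε)
    (hc : ∀ w ∈ outgoing X, 0 < c w) {w : G.Tangent} (hw : w ∈ outgoing X) :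
    HasSlope (fire X c ε η) w (-c w) := by
  obtain ⟨h1, h2, h3⟩ := fireEnd_mem hη hηε hc hw
  refine ⟨η / c w, h1, fun s hs => ?_⟩
  rw [fire_ray hst hη.le hw hs.1 (hs.2.trans h2.le), fire_of_mem hw.1, max_eq_right]
  · push_cast; ring
  · have := mul_le_mul_of_nonneg_left hs.2 (Nat.cast_nonneg (α := ℝ) (c w))
    linarith

lemma hasSlope_fire_inner (hX : IsCut X) {w : G.Tangent} (hw : w.base ∈ X)
    (hw' : w ∉ outgoing X) : HasSlope (fire X c ε η) w 0 := by
  refine hasSlope_of_eventually ?_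
  filter_upwards [(hX.germ w).resolve_right fun h => hw' ⟨hw, h⟩] with s hs
  rw [fire_of_mem hs, fire_of_mem hw]; simp

lemma hasSlope_fire_rev (hst : IsStar X T ε) (hη : 0 < η) (hηε : η < ε)
    (hc : ∀ w ∈ outgoing X, 0 < c w) {w : G.Tangent} (hw : w ∈ outgoing X) {s : ℝ} (h0 : 0 < s)
    (h1 : s ≤ w.room) (h2 : s ≤ η / c w) : HasSlope (fire X c ε η) (w.rev s h0 h1) (c w) := by
  obtain ⟨h3, h4, h5⟩ := fireEnd_mem hη hηε hc hw
  have h6 : ∀ t, t ≤ s → 0 ≤ η - c w * t := fun t ht => by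
    have := mul_le_mul_of_nonneg_left (ht.trans h2) (Nat.cast_nonneg (α := ℝ) (c w))
    linarith
  refine ⟨s, h0, fun d hd => ?_⟩
  rw [rev_move, rev_base, fire_ray hst hη.le hw (by linarith [hd.2]) (by linarith [hd.1]),
    fire_ray hst hη.le hw h0.le (by linarith), max_eq_right (h6 _ le_rfl),
    max_eq_right (h6 _ (by linarith [hd.1]))]
  push_cast; ring

lemma hasSlope_fire_shift (hst : IsStar X T ε) (hη : 0 < η) (hηε : η < ε)
    (hc : ∀ w ∈ outgoing X, 0 < c w) {w : G.Tangent} (hw : w ∈ outgoing X) {s : ℝ} (h0 : 0 ≤ s)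
    (h1 : s < w.room) (h2 : s < η / c w) : HasSlope (fire X c ε η) (w.shift s h0 h1) (-c w) := by
  obtain ⟨h3, h4, h5⟩ := fireEnd_mem hη hηε hc hw
  have h6 : ∀ t, t ≤ η / c w → 0 ≤ η - c w * t := fun t ht => by
    have := mul_le_mul_of_nonneg_left ht (Nat.cast_nonneg (α := ℝ) (c w))
    linarith
  refine ⟨η / c w - s, by linarith, fun d hd => ?_⟩
  rw [shift_move, shift_base, fire_ray hst hη.le hw (by linarith [hd.1]) (by linarith [hd.2]),
    fire_ray hst hη.le hw h0 (by linarith), max_eq_right (h6 _ (by linarith [hd.2])),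
    max_eq_right (h6 _ (by linarith))]
  push_cast; ring

lemma hasSlope_fire_end (hst : IsStar X T ε) (hη : 0 < η) (hηε : η < ε)
    (hc : ∀ w ∈ outgoing X, 0 < c w) {w : G.Tangent} (hw : w ∈ outgoing X) (h0 h1) :
    HasSlope (fire X c ε η) (w.shift (η / c w) h0 h1) 0 := by
  obtain ⟨h3, h4, h5⟩ := fireEnd_mem hη hηε hc hw
  have h6 : ∀ t, η / c w ≤ t → η - c w * t ≤ 0 := fun t ht => by
    have := mul_le_mul_of_nonneg_left ht (Nat.cast_nonneg (α := ℝ) (c w))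
    linarith
  refine ⟨ε - η / c w, by linarith, fun d hd => ?_⟩
  rw [shift_move, shift_base, fire_ray hst hη.le hw (by linarith [hd.1]) (by linarith [hd.2]),
    fire_ray hst hη.le hw h3.le (by linarith), max_eq_left (h6 _ (by linarith [hd.1])),
    max_eq_left (h6 _ le_rfl)]
  simp

lemma hasSlope_fire_zero (hX : IsCut X) (hfin : (outgoing X).Finite) (hst : IsStar X T ε)
    (hη : 0 < η) (hc : ∀ w ∈ outgoing X, 0 < c w) {v : G.Tangent} (hv : v.base ∉ X)
    (hv' : ∀ w ∈ outgoing X, ∀ s, 0 < s → s ≤ η / c w → w.move s ≠ v.base) :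
    HasSlope (fire X c ε η) v 0 := by
  have hK : IsClosed (X ∪ ⋃ w ∈ outgoing X, w.move '' Set.Icc 0 (η / c w)) :=
    hX.1.union (hfin.isClosed_biUnion fun w _ => isClosed_segment w _ _)
  have hvK : v.base ∉ X ∪ ⋃ w ∈ outgoing X, w.move '' Set.Icc 0 (η / c w) := by
    rintro (h | h)
    · exact hv h
    · obtain ⟨w, hw, s, hs, h⟩ := Set.mem_iUnion₂.1 h
      rcases hs.1.eq_or_lt with rfl | h0
      · exact hv (h ▸ hw.1)
      · exact hv' w hw s h0 hs.2 h
  refine hasSlope_of_eventually ?_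
  filter_upwards [isClosed_iff_germ.1 hK v hvK] with s hs
  rw [fire_eq_zero hst hη.le hc hv fun w hw s h0 h1 => hv' w hw s h0 h1.le,
    fire_eq_zero hst hη.le hc (fun h => hs (.inl h)) fun w hw t h0 h1 h => hs (.inr ?_)]
  · simp
  · exact Set.mem_biUnion hw ⟨t, ⟨h0.le, h1.le⟩, h⟩

lemma isPL_fire (hX : IsCut X) (hfin : (outgoing X).Finite) (hst : IsStar X T ε)
    (hη : 0 < η) (hηε : η < ε) (hc : ∀ w ∈ outgoing X, 0 < c w) : IsPL (fire X c ε η) := by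
  intro v
  by_cases hvX : v.base ∈ X
  · by_cases hv : v ∈ outgoing X
    · exact ⟨_, hasSlope_fire_outgoing hst hη hηε hc hv⟩
    · exact ⟨_, hasSlope_fire_inner hX hvX hv⟩
  by_cases h : ∀ w ∈ outgoing X, ∀ s, 0 < s → s ≤ η / c w → w.move s ≠ v.base
  · exact ⟨_, hasSlope_fire_zero hX hfin hst hη hc hvX h⟩
  push Not at h
  obtain ⟨w, hw, s, h0, h1, h2⟩ := h
  obtain ⟨h3, h4, -⟩ := fireEnd_mem hη hηε hc hw
  have h5 := hst.lt_room w hw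
  rcases eq_shift_or_rev h0 (by linarith) h2.symm with rfl | rfl
  · rcases h1.eq_or_lt with rfl | h1
    · exact ⟨_, hasSlope_fire_end hst hη hηε hc hw _ _⟩
    · exact ⟨_, hasSlope_fire_shift hst hη hηε hc hw _ _ h1⟩
  · exact ⟨_, hasSlope_fire_rev hst hη hηε hc hw _ _ h1⟩

/-- The divisor of the firing function: `c w` chips move from the base of each direction `w`
leaving `X` to distance `η / c w`. -/
lemma divisor_fire [Finite V] [Finite E] (hX : IsCut X) (hfin : (outgoing X).Finite)
    (hst : IsStar X T ε) (hη : 0 < η) (hηε : η < ε) (hc : ∀ w ∈ outgoing X, 0 < c w) :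
    divisor (fire X c ε η) (isPL_fire hX hfin hst hη hηε hc) =
      ∑ w ∈ hfin.toFinset, (c w : ℤ) • (Finsupp.single (w.move (η / c w)) 1 -
        Finsupp.single w.base 1) := by
  classical
  ext x
  rw [divisor_apply, Finsupp.finsetSum_apply]
  simp only [Finsupp.smul_apply, Finsupp.sub_apply, Finsupp.single_apply, smul_eq_mul]
  by_cases hxX : x ∈ X
  · rw [ord_eq_sum, ← Finset.sum_filter_add_sum_filter_not _ (· ∈ outgoing X),
      Finset.sum_eq_zero (s := {w ∈ tangents x | w ∉ outgoing X}), add_zero]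
    · have : ∀ w ∈ hfin.toFinset, (c w : ℤ) * ((if w.move (η / c w) = x then 1 else 0) -
          if w.base = x then 1 else 0) = if w.base = x then -(c w : ℤ) else 0 := by
        intro w hw
        have hw := hfin.mem_toFinset.1 hw
        obtain ⟨h3, h4, -⟩ := fireEnd_mem hη hηε hc hw
        rw [if_neg fun h : w.move _ = x => hst.notMem w hw _ h3 h4.le (h ▸ hxX)]
        split_ifs <;> simp
      rw [Finset.sum_congr rfl this, ← Finset.sum_filter]
      refine Finset.sum_congr ?_ fun w hw => ?_
      · ext w; simp [and_comm]
      · have hw := hfin.mem_toFinset.1 (Finset.mem_filter.1 hw).1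
        exact (hasSlope_fire_outgoing hst hη hηε hc hw).outSlope_eq
    · intro w hw
      obtain ⟨h1, h2⟩ := Finset.mem_filter.1 hw
      exact (hasSlope_fire_inner hX ((mem_tangents.1 h1).symm ▸ hxX) h2).outSlope_eq
  have hbase : ∀ w ∈ outgoing X, w.base ≠ x := fun w hw h => hxX (h ▸ hw.1)
  by_cases h : ∀ w ∈ outgoing X, ∀ s, 0 < s → s ≤ η / c w → w.move s ≠ x
  · rw [ord_eq_sum, Finset.sum_eq_zero, Finset.sum_eq_zero]
    · intro w hw
      have hw := hfin.mem_toFinset.1 hw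
      rw [if_neg (hbase w hw), if_neg (h w hw _ (fireEnd_mem hη hηε hc hw).1 le_rfl)]
      simp
    · intro v hv
      obtain rfl := mem_tangents.1 hv
      exact (hasSlope_fire_zero hX hfin hst hη hc hxX h).outSlope_eq
  push Not at h
  obtain ⟨w, hw, s, h0, h1, rfl⟩ := h
  obtain ⟨h3, h4, -⟩ := fireEnd_mem hη hηε hc hw
  have h5 := hst.lt_room w hw
  have hrays : ∀ w' ∈ outgoing X, w'.move (η / c w') = w.move s → w' = w ∧ s = η / c w := by
    intro w' hw' h
    obtain ⟨h3', h4', -⟩ := fireEnd_mem hη hηε hc hw'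
    obtain ⟨rfl, hs⟩ := hst.inj _ hw' _ hw _ _ h3' h4'.le h0 (by linarith) h
    exact ⟨rfl, hs.symm⟩
  rw [ord_move _ h0 (by linarith), (hasSlope_fire_rev hst hη hηε hc hw _ _ h1).outSlope_eq]
  rcases h1.eq_or_lt with rfl | h1
  · rw [(hasSlope_fire_end hst hη hηε hc hw _ _).outSlope_eq, zero_add,
      Finset.sum_eq_single_of_mem w (by simpa using hw), if_pos rfl, if_neg (hbase w hw)]
    · simp
    · intro w' hw' hne
      have hw' := hfin.mem_toFinset.1 hw'
      rw [if_neg fun h => hne (hrays w' hw' h).1, if_neg (hbase w' hw')]; simp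
  · rw [(hasSlope_fire_shift hst hη hηε hc hw _ _ h1).outSlope_eq, neg_add_cancel,
      Finset.sum_eq_zero]
    intro w' hw'
    have hw' := hfin.mem_toFinset.1 hw'
    rw [if_neg fun h => h1.ne (hrays w' hw' h).2, if_neg (hbase w' hw')]; simp

open Classical in
/-- Firing `X` keeps `F` effective if at each point `F` has enough chips. -/
lemma nonneg_add_ord_fire [Finite V] [Finite E] (hX : IsCut X) (hfin : (outgoing X).Finite)
    (hst : IsStar X T ε) (hη : 0 < η) (hηε : η < ε) (hc : ∀ w ∈ outgoing X, 0 < c w)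
    {F : G.Div} (hF : ∀ x, (∑ w ∈ tangents x with w ∈ outgoing X, (c w : ℤ)) ≤ F x) (x : G.Point) :
    0 ≤ F x + ord (fire X c ε η) x := by
  rw [← divisor_apply (isPL_fire hX hfin hst hη hηε hc), divisor_fire hX hfin hst hη hηε hc,
    Finsupp.finsetSum_apply]
  simp only [Finsupp.smul_apply, Finsupp.sub_apply, Finsupp.single_apply, smul_eq_mul, mul_sub,
    Finset.sum_sub_distrib]
  have h1 : 0 ≤ ∑ w ∈ hfin.toFinset, (c w : ℤ) * if w.move (η / c w) = x then 1 else 0 :=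
    Finset.sum_nonneg fun w _ => by split_ifs <;> simp
  have h2 : ∑ w ∈ hfin.toFinset, (c w : ℤ) * (if w.base = x then 1 else 0) =
      ∑ w ∈ tangents x with w ∈ outgoing X, (c w : ℤ) := by
    simp only [mul_ite, mul_one, mul_zero]
    rw [← Finset.sum_filter]
    refine Finset.sum_congr ?_ fun _ _ => rfl
    ext w; simp [and_comm]
  linarith [hF x]

end Fire

open Classical in
lemma IsSaturated.outDeg_le {F : G.Div} {X : Set G.Point} [Finite E] (hF : 0 ≤ F)
    (hs : IsSaturated F X) (x : G.Point) : (outDeg X x : ℤ) ≤ F x := by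
  by_cases hx : x ∈ frontier X
  · exact hs x hx
  · rw [outDeg_eq, Finset.filter_eq_empty_iff.2]
    · simpa using hF x
    · rintro w hw h
      exact hx (mem_tangents.1 hw ▸ base_mem_frontier h)

/-- Conversely to `IsReduced.le`, an effective divisor `F` is `P`-reduced if all functions `f` with
`F + div f` effective have their maximum at `P`: a saturated cut off `P` could be fired. -/
lemma isReduced_of_le [Finite V] [Finite E] {P : G.Point} {F : G.Div} (hF : 0 ≤ F)
    (h : ∀ f, IsPL f → (∀ x, 0 ≤ F x + ord f x) → ∀ x, f x ≤ f P) : IsReduced P F := by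
  classical
  refine ⟨fun v _ => hF v, fun X hX hP => ?_⟩
  by_contra! hs
  have hs : IsSaturated F X := hs
  have hfin := hs.finite_outgoing hX
  obtain ⟨ε, hst⟩ := (eventually_isStar hfin (Set.finite_singleton P)).exists
  have hη : 0 < ε / 2 := half_pos hst.pos
  have hηε : ε / 2 < ε := half_lt_self hst.pos
  have hc : ∀ w ∈ outgoing X, 0 < (fun _ : G.Tangent => 1) w := fun _ _ => one_pos
  obtain ⟨x, hx⟩ := hX.2.nonempty
  have := h _ (isPL_fire hX hfin hst hη hηε hc)
    (nonneg_add_ord_fire hX hfin hst hη hηε hc fun x => by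
      simpa [outDeg_eq] using hs.outDeg_le hF x) x
  rw [fire_of_mem hx, fire_eq_zero hst hη.le hc hP] at this
  · linarith
  · rintro w hw s h0 h1 rfl
    refine hst.notMem' w hw s h0 ?_ rfl
    simp at h1; linarith

/-! ### Free segments -/

/-- The open segment of length `l` ahead of `v` avoids `S`, and its end lies in `S`. -/
structure IsFree (S : Set G.Point) (v : G.Tangent) (l : ℝ) : Prop where
  pos : 0 < l
  le_room : l ≤ v.room
  end_mem : v.move l ∈ S
  notMem : ∀ s, 0 < s → s < l → v.move s ∉ S

lemma exists_isFree {S : Set G.Point} (hS : S.Finite) (hV : ∀ v, Point.vertex v ∈ S)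
    (v : G.Tangent) : ∃ l, IsFree S v l := by
  let A : Set ℝ := {s | 0 < s ∧ s ≤ v.room ∧ v.move s ∈ S}
  have hA : A.Finite := by
    have h : (A \ {v.room}).Finite := by
      refine Set.Finite.of_finite_image (f := v.move) (hS.subset ?_) ?_
      · rintro _ ⟨s, hs, rfl⟩; exact hs.1.2.2
      · rintro s hs s' hs' h
        exact move_injOn hs'.1.1 (lt_of_le_of_ne hs'.1.2.1 hs'.2) h
    exact (h.union (Set.finite_singleton v.room)).subset fun s hs => by
      by_cases h : s = v.room
      · exact .inr h
      · exact .inl ⟨hs, h⟩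
  obtain ⟨l, hl, hmin⟩ := Set.exists_min_image A id hA
    ⟨v.room, v.room_pos, le_rfl, by obtain ⟨p, hp⟩ := v.move_room; rw [hp]; exact hV p⟩
  exact ⟨l, hl.1, hl.2.1, hl.2.2, fun s h0 h1 hs =>
    (hmin s ⟨h0, h1.le.trans hl.2.1, hs⟩).not_gt h1⟩

lemma IsFree.unique {S : Set G.Point} {v : G.Tangent} {l l' : ℝ} (h : IsFree S v l)
    (h' : IsFree S v l') : l = l' := by
  rcases lt_trichotomy l l' with hlt | rfl | hlt
  · exact (h'.notMem l h.pos hlt h.end_mem).elim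
  · rfl
  · exact (h.notMem l' h'.pos hlt h'.end_mem).elim

lemma IsFree.rev {S : Set G.Point} {v : G.Tangent} {l : ℝ} (h : IsFree S v l) (hv : v.base ∈ S) :
    IsFree S (v.rev l h.pos h.le_room) l where
  pos := h.pos
  le_room := le_rev_room _ _ _
  end_mem := by simpa [base] using hv
  notMem s h0 h1 := by rw [rev_move]; exact h.notMem _ (by linarith) (by linarith)

/-- Every point off `S` lies in the first half of a free segment issuing from a point of `S`. -/
lemma exists_isFree_of_notMem {S : Set G.Point} (hS : S.Finite) (hV : ∀ v, Point.vertex v ∈ S)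
    {x : G.Point} (hx : x ∉ S) : ∃ (v : G.Tangent) (l s : ℝ), v.base ∈ S ∧ IsFree S v l ∧ 0 < s ∧
      s ≤ l / 2 ∧ v.move s = x := by
  obtain p | ⟨e, t, ht⟩ := x
  · exact (hx (hV p)).elim
  obtain ⟨u, a, h0, h1, h2⟩ := exists_move_of_inner e t ht
  rw [← h2] at hx ⊢
  obtain ⟨b, hb⟩ := exists_isFree hS hV (u.rev a h0 h1.le)
  set w := u.rev a h0 h1.le with hw
  set v := w.rev b hb.pos hb.le_room with hv
  have hvS : v.base ∈ S := by rw [hv, rev_base]; exact hb.end_mem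
  have hvb : v.move b = u.move a := by rw [hv, rev_move, hw, rev_move]; simp
  obtain ⟨l, hl⟩ := exists_isFree hS hV v
  have hbl : b < l := by
    by_contra! h
    rcases h.eq_or_lt with h | h
    · rw [← hvb, ← h] at hx; exact hx hl.end_mem
    · refine hb.notMem (b - l) (by linarith) (by linarith [hl.pos]) ?_
      have := hl.end_mem
      rwa [hv, rev_move] at this
  rcases le_or_gt b (l / 2) with h | h
  · exact ⟨v, l, b, hvS, hl, hb.pos, h, hvb⟩
  · exact ⟨v.rev l hl.pos hl.le_room, l, l - b, by simpa using hl.end_mem, hl.rev hvS,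
      by linarith, by linarith, by rw [rev_move]; simpa using hvb⟩

lemma finite_tangents [Finite E] {S : Set G.Point} (hS : S.Finite) :
    {v : G.Tangent | v.base ∈ S}.Finite := by
  refine (hS.biUnion fun x _ => finite_base x).subset fun v hv => ?_
  simp only [Set.mem_iUnion]
  exact ⟨_, hv, rfl⟩

/-- The finite set consisting of the vertices, the support of `F` and a further point `P`. -/
def nodes (F : G.Div) (P : G.Point) : Set G.Point :=
  Set.range Point.vertex ∪ F.support ∪ {P}

lemma finite_nodes [Finite V] (F : G.Div) (P : G.Point) : (nodes F P).Finite :=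
  ((Set.finite_range _).union F.support.finite_toSet).union (Set.finite_singleton P)

lemma vertex_mem_nodes (F : G.Div) (P : G.Point) (v : V) : .vertex v ∈ nodes F P :=
  .inl (.inl ⟨v, rfl⟩)

lemma mem_nodes (F : G.Div) (P : G.Point) : P ∈ nodes F P := .inr rfl

lemma eq_zero_of_notMem_nodes {F : G.Div} {P x : G.Point} (h : x ∉ nodes F P) : F x = 0 := by
  by_contra hx
  exact h (.inl (.inr (Finsupp.mem_support_iff.2 hx)))

/-! ### Existence of reduced divisors -/

/-- The rational functions `f` with `F + div f` effective, normalized to vanish at `P`. -/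
def normalized (F : G.Div) (P : G.Point) : Set (G.Point → ℝ) :=
  {f | IsPL f ∧ (∀ x, 0 ≤ F x + ord f x) ∧ f P = 0}

lemma IsPL.move_le {f : G.Point → ℝ} (hf : IsPL f) {n : ℤ} (h : ∀ u, outSlope f u ≤ n)
    (u : G.Tangent) {s : ℝ} (h0 : 0 ≤ s) (h1 : s ≤ u.room) : f (u.move s) ≤ f u.base + n * s := by
  rcases h0.eq_or_lt with rfl | h0
  · simp [base]
  have := hf.segment_induction u (l := u.room) le_rfl
    (P := fun a b => f (u.move b) ≤ f (u.move a) + n * (b - a)) ?_ ?_ le_rfl h0 h1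
  · simpa [base] using this
  · intro a b m ha hab hb H
    have e1 : outSlope f (u.shift a ha (hab.trans_le hb)) = m := HasSlope.outSlope_eq
      ⟨b - a, sub_pos.2 hab, fun d hd => by
        simpa using H (a + d) ⟨by linarith [hd.1], by linarith [hd.2]⟩⟩
    have h2 : (m : ℝ) ≤ n := by exact_mod_cast e1 ▸ h _
    rw [H b ⟨hab.le, le_rfl⟩]
    have := mul_le_mul_of_nonneg_right h2 (sub_nonneg.2 hab.le)
    linarith
  · intro a s b _ _ _ _ h1 h2
    linarith

/-- The pointwise supremum of the functions in `normalized F P`. -/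
def upper (F : G.Div) (P x : G.Point) : ℝ := sSup ((fun f : G.Point → ℝ => f x) '' normalized F P)

lemma zero_mem_normalized [Finite E] {F : G.Div} (hF : 0 ≤ F) (P : G.Point) :
    (fun _ => 0) ∈ normalized F P :=
  ⟨isPL_const 0, fun x => by rw [ord_const, add_zero]; exact hF x, rfl⟩

lemma upper_le [Finite E] {F : G.Div} (hF : 0 ≤ F) {P x : G.Point} {C : ℝ}
    (h : ∀ f ∈ normalized F P, f x ≤ C) : upper F P x ≤ C :=
  csSup_le ⟨_, _, zero_mem_normalized hF P, rfl⟩ (by rintro _ ⟨f, hf, rfl⟩; exact h f hf)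

section
variable [Fintype V] [Fintype E]

lemma bddAbove_normalized [ConnectedSpace G.Point] {F : G.Div} (hF : 0 ≤ F) (P x : G.Point) :
    BddAbove ((fun f : G.Point → ℝ => f x) '' normalized F P) := by
  let A : Set G.Point := {x | BddAbove ((fun f : G.Point → ℝ => f x) '' normalized F P)}
  have hmove : ∀ (u : G.Tangent) s, 0 ≤ s → s ≤ u.room → u.base ∈ A → u.move s ∈ A := by
    rintro u s h0 h1 ⟨C, hC⟩
    refine ⟨C + deg F * s, ?_⟩
    rintro _ ⟨f, hf, rfl⟩
    have h2 := hf.1.move_le (hf.1.outSlope_le_deg hF hf.2.1) u h0 h1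
    have h3 := hC ⟨f, hf, rfl⟩
    dsimp only at h3 ⊢
    linarith
  have hopen : IsOpen A := isOpen_iff_germ.2 fun w hw =>
    (eventually_lt_room w).mono fun s hs => hmove w s hs.1.le hs.2.le hw
  have hclosed : IsClosed A := isClosed_iff_germ.2 fun w hw =>
    (eventually_lt_room w).mono fun s hs h => hw <| by
      have := hmove (w.rev s hs.1 hs.2.le) s hs.1.le (le_rev_room _ _ _) (by simpa using h)
      simpa [base] using this
  have : A = Set.univ := IsClopen.eq_univ ⟨hclosed, hopen⟩ ⟨P, 0, by
    rintro _ ⟨f, hf, rfl⟩; exact hf.2.2.le⟩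
  exact (this ▸ Set.mem_univ x : x ∈ A)

lemma le_upper [ConnectedSpace G.Point] {F : G.Div} (hF : 0 ≤ F) {P : G.Point} {f : G.Point → ℝ}
    (hf : f ∈ normalized F P) (x : G.Point) : f x ≤ upper F P x :=
  le_csSup (bddAbove_normalized hF P x) ⟨f, hf, rfl⟩

/-- Near a point, the supremum of the normalized functions is again linear in each direction, and
its slope is at least that of any normalized function that is almost maximal at the point. On a
free segment the normalized functions are convex with bounded integral slopes, that is, maxima of
finitely many linear functions with prescribed slopes. -/
lemma hasSlope_upper [ConnectedSpace G.Point] {F : G.Div} (hF : 0 ≤ F) (P : G.Point)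
    (u : G.Tangent) : ∃ m : ℤ, HasSlope (upper F P) u m ∧ ∃ η > 0, ∀ f ∈ normalized F P,
      upper F P u.base - η < f u.base → outSlope f u ≤ m := by
  obtain ⟨l, hl⟩ := exists_isFree (finite_nodes F P) (vertex_mem_nodes F P) u
  have hord : ∀ f ∈ normalized F P, ∀ s, 0 < s → s < l → 0 ≤ ord f (u.move s) :=
    fun f hf s h0 h1 => by
      have := hf.2.1 (u.move s)
      rwa [eq_zero_of_notMem_nodes (hl.notMem s h0 h1), zero_add] at this
  have htan : ∀ f ∈ normalized F P, ∀ s (h0 : 0 ≤ s) (h1 : s < l), ∀ t, 0 ≤ t → t ≤ l →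
      f (u.move s) + outSlope f (u.shift s h0 (h1.trans_le hl.le_room)) * (t - s) ≤
        f (u.move t) := by
    intro f hf s h0 h1 t ht0 ht1
    rcases le_total s t with h | h
    · exact hf.1.tangent_le_shift u hl.le_room (hord f hf) h0 _ h ht1
    · rcases h0.eq_or_lt with rfl | h0
      · obtain rfl : t = 0 := le_antisymm h ht0
        simp
      · have h2 := hf.1.tangent_le_rev u (hord f hf) h0 (h1.le.trans hl.le_room) h1.le ht0 h
        have h3 := hord f hf s h0 h1
        rw [ord_move f h0 (h1.trans_le hl.le_room)] at h3
        have h4 : (0 : ℝ) ≤ outSlope f (u.shift s h0.le (h1.trans_le hl.le_room)) +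
          outSlope f (u.rev s h0 (h1.le.trans hl.le_room)) := by exact_mod_cast h3
        nlinarith
  -- The slope is the least `m` such that all tangent lines of slope greater than `m` stay below the
  -- supremum at the base point, by a fixed amount `η`.
  let Q : ℤ → Prop := fun m => ∃ η > 0,
      ∀ f ∈ normalized F P, ∀ s (h0 : 0 ≤ s) (h1 : s < l),
        m < outSlope f (u.shift s h0 (h1.trans_le hl.le_room)) →
        f (u.move s) - outSlope f (u.shift s h0 (h1.trans_le hl.le_room)) * s ≤
          upper F P u.base - η
  have hQ1 : ∃ b, ∀ m, Q m → b ≤ m := by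
    refine ⟨-deg F, fun m ⟨η, hη, hm⟩ => ?_⟩
    by_contra! hlt
    have : upper F P u.base ≤ upper F P u.base - η := upper_le hF fun f hf => by
      have := hm f hf 0 le_rfl hl.pos (hlt.trans_le (hf.1.neg_deg_le_outSlope hF hf.2.1 _))
      simpa [base] using this
    linarith
  have hQ2 : ∃ m, Q m := ⟨deg F, 1, one_pos, fun f hf s h0 h1 h =>
    ((hf.1.outSlope_le_deg hF hf.2.1 _).not_gt h).elim⟩
  obtain ⟨m, ⟨η, hη, hm⟩, hmin⟩ := Int.exists_least_of_bdd hQ1 hQ2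
  refine ⟨m, ?_, η, hη, fun f hf h => ?_⟩
  swap
  · by_contra! hlt
    have := hm f hf 0 le_rfl hl.pos (by simpa using hlt)
    simp only [mul_zero, sub_zero] at this
    exact this.not_gt h
  have hd : 0 < |(deg F : ℝ) - m| + 1 := by positivity
  refine ⟨min (l / 2) (η / (|(deg F : ℝ) - m| + 1)), lt_min (half_pos hl.pos) (by positivity),
    fun s hs => le_antisymm ?_ ?_⟩
  · have hs1 : s < l := by linarith [hs.2.trans (min_le_left _ _), hl.pos]
    have hs2 : s * (|(deg F : ℝ) - m| + 1) ≤ η :=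
      (le_div_iff₀ hd).1 (hs.2.trans (min_le_right _ _))
    refine upper_le hF fun f hf => ?_
    have h1 := htan f hf s hs.1 hs1 0 le_rfl hl.pos.le
    have h2 : f u.base ≤ upper F P u.base := le_upper hF hf _
    have h3 : (outSlope f (u.shift s hs.1 (hs1.trans_le hl.le_room)) : ℝ) ≤ deg F := by
      exact_mod_cast hf.1.outSlope_le_deg hF hf.2.1 _
    change _ ≤ f u.base at h1
    rcases le_or_gt (outSlope f (u.shift s hs.1 (hs1.trans_le hl.le_room))) m with h | h
    · have h4 : (outSlope f (u.shift s hs.1 (hs1.trans_le hl.le_room)) : ℝ) ≤ m := by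
        exact_mod_cast h
      have := mul_le_mul_of_nonneg_right h4 hs.1
      linarith
    · have h4 := hm f hf s hs.1 hs1 h
      have h5 := mul_le_mul_of_nonneg_right h3 hs.1
      have h6 := mul_le_mul_of_nonneg_left (le_abs_self ((deg F : ℝ) - m)) hs.1
      linarith [hs.1]
  · have hs1 : s < l := by linarith [hs.2.trans (min_le_left _ _), hl.pos]
    refine le_of_forall_pos_le_add fun η' hη' => ?_
    have : ¬ Q (m - 1) := fun h => by linarith [hmin _ h]
    simp only [Q] at this
    push Not at this
    obtain ⟨f, hf, t, h0, h1, h2, h3⟩ := this η' hη'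
    have h4 := htan f hf t h0 h1 s hs.1 hs1.le
    have h5 : (m : ℝ) ≤ outSlope f (u.shift t h0 (h1.trans_le hl.le_room)) := by
      exact_mod_cast Int.sub_one_lt_iff.1 h2
    have h6 := mul_le_mul_of_nonneg_right h5 hs.1
    have h7 := le_upper hF hf (u.move s)
    linarith

/-- The supremum of the normalized functions is itself a normalized function. -/
lemma upper_mem [ConnectedSpace G.Point] {F : G.Div} (hF : 0 ≤ F) (P : G.Point) :
    upper F P ∈ normalized F P := by
  have hPL : IsPL (upper F P) := fun u => ⟨_, (hasSlope_upper hF P u).choose_spec.1⟩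
  refine ⟨hPL, fun x => ?_, ?_⟩
  · have h : ∀ u : G.Tangent, ∃ η > 0, ∀ f ∈ normalized F P,
        upper F P u.base - η < f u.base → outSlope f u ≤ outSlope (upper F P) u := fun u => by
      obtain ⟨m, hm, h⟩ := hasSlope_upper hF P u
      rwa [hm.outSlope_eq]
    choose η hη h using h
    obtain ⟨η₀, hη₀, hle⟩ : ∃ η₀ > 0, ∀ u ∈ tangents x, η₀ ≤ η u := by
      have : ∀ᶠ ε in 𝓝[>] (0 : ℝ), ∀ u ∈ tangents x, ε < η u :=
        (eventually_all_finset _).2 fun u _ => mem_of_superset (Ioo_mem_nhdsGT (hη u)) fun ε h => h.2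
      obtain ⟨ε, h1, h2⟩ := (this.and self_mem_nhdsWithin).exists
      exact ⟨ε, h2, fun u hu => (h1 u hu).le⟩
    obtain ⟨_, ⟨f, hf, rfl⟩, hfx⟩ := exists_lt_of_lt_csSup
      (⟨_, _, zero_mem_normalized hF P, rfl⟩ :
        ((fun f : G.Point → ℝ => f x) '' normalized F P).Nonempty)
      (show upper F P x - η₀ < upper F P x by linarith)
    refine (hf.2.1 x).trans ?_
    rw [ord_eq_sum, ord_eq_sum]
    gcongr with u hu
    have := hle u hu
    obtain rfl := mem_tangents.1 hu
    exact h u f hf (by dsimp only at hfx; linarith)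
  · exact le_antisymm (upper_le hF fun f hf => hf.2.2.le) (le_upper hF (zero_mem_normalized hF P) P)

/-- Every effective divisor is linearly equivalent to an effective `P`-reduced divisor. -/
lemma exists_isReduced [ConnectedSpace G.Point] {F : G.Div} (hF : 0 ≤ F) (P : G.Point) :
    ∃ F' : G.Div, 0 ≤ F' ∧ LinEquiv F' F ∧ IsReduced P F' := by
  obtain ⟨h1, h2, h3⟩ := upper_mem hF P
  have hF' : 0 ≤ F + divisor _ h1 := fun x => h2 x
  refine ⟨_, hF', linEquiv_add_divisor F h1, isReduced_of_le hF' fun f hf h x => ?_⟩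
  have hmem : (fun y => (upper F P + f) y + -f P) ∈ normalized F P := by
    refine ⟨(h1.add hf).add (isPL_const _), fun y => ?_, by simp [h3]⟩
    rw [(h1.add hf).ord_add_const, h1.ord_add hf, ← add_assoc]
    exact h y
  have := le_upper hF hmem x
  simp only [Pi.add_apply] at this
  linarith

end

/-! ### Functions of small variation -/

/-- A function of small variation that is convex on a free segment increases at neither end of the
segment, and takes its minimum on the segment in the middle. -/
lemma flat_of_small [Finite E] {S : Set G.Point} {v : G.Tangent} {l M : ℝ} (hl : IsFree S v l)
    {f : G.Point → ℝ} (hf : IsPL f) (hord : ∀ x ∉ S, 0 ≤ ord f x) (h0 : ∀ x, 0 ≤ f x)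
    (hM : ∀ x, f x ≤ M) (hMl : M < l / 2) :
    outSlope f v ≤ 0 ∧ ∀ s, 0 ≤ s → s ≤ l → f (v.move (l / 2)) ≤ f (v.move s) := by
  have hpos := hl.pos
  have hord' : ∀ s, 0 < s → s < l → 0 ≤ ord f (v.move s) :=
    fun s h1 h2 => hord _ (hl.notMem s h1 h2)
  have aux : ∀ (n : ℤ) (a x y : ℝ), l / 2 ≤ a → 0 ≤ x → y ≤ M → x + n * a ≤ y → n ≤ 0 := by
    intro n a x y h1 h2 h3 h4
    by_contra! hn
    have : (1 : ℝ) ≤ n := by exact_mod_cast hn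
    nlinarith
  have hm1 : l / 2 < v.room := by linarith [hl.le_room]
  have e1 : ∀ s, l / 2 ≤ s → s ≤ l → _ := fun s h1 h2 =>
    hf.tangent_le_shift v hl.le_room hord' (half_pos hpos).le hm1 h1 h2
  have e2 : ∀ s, 0 ≤ s → s ≤ l / 2 → _ := fun s h1 h2 =>
    hf.tangent_le_rev v hord' (half_pos hpos) hm1.le (by linarith) h1 h2
  have h1 := aux _ (l - l / 2) _ _ (by linarith) (h0 _) (hM _) (e1 l (by linarith) le_rfl)
  have h2 := aux _ (l / 2 - 0) _ _ (by linarith) (h0 _) (hM _) (e2 0 le_rfl (by linarith))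
  have h3 := hord' (l / 2) (half_pos hpos) (by linarith)
  rw [ord_move f (half_pos hpos) hm1] at h3
  refine ⟨aux _ l _ _ (by linarith) (h0 _) (hM _)
    (hf.tangent_le v hl.le_room hord' hpos.le le_rfl), fun s hs0 hs1 => ?_⟩
  rcases le_total (l / 2) s with h | h
  · have := e1 s h hs1
    rw [show outSlope f (v.shift (l / 2) (half_pos hpos).le hm1) = 0 by omega] at this
    simpa using this
  · have := e2 s hs0 h
    rw [show outSlope f (v.rev (l / 2) (half_pos hpos) hm1.le) = 0 by omega] at this
    simpa using this

/-- The sum of the slopes in the other directions being bounded above, the slope in the direction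
of `u` is bounded below. -/
lemma neg_le_outSlope [Finite E] {f : G.Point → ℝ} {F : G.Div} {u : G.Tangent} {b : ℤ}
    (h : 0 ≤ F u.base + ord f u.base) [DecidableEq G.Tangent]
    (h' : ∑ w ∈ (tangents u.base).erase u, outSlope f w ≤ b) : -F u.base - b ≤ outSlope f u := by
  rw [ord_eq_sum, ← Finset.add_sum_erase _ _ (mem_tangents.2 rfl : u ∈ tangents u.base)] at h
  linarith

lemma IsSaturated.segment_subset [Finite E] {F : G.Div} {X S : Set G.Point} (hX : IsCut X) (hs : IsSaturated F X)
    (hS : ∀ x ∉ S, F x = 0) {v : G.Tangent} {l : ℝ} (hl : IsFree S v l) {s : ℝ} (h0 : 0 < s)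
    (h1 : s < l) (hv : v.move s ∈ X) : v.move '' Set.Icc 0 l ⊆ X := by
  have hsub : v.move '' Set.Ioo 0 l ⊆ X := hs.subset hX
    (isPreconnected_Ioo.image _ v.continuous_move.continuousOn)
    (by rintro _ ⟨s, hs, rfl⟩; exact hS _ (hl.notMem s hs.1 hs.2))
    ⟨_, ⟨s, ⟨h0, h1⟩, rfl⟩, hv⟩
  rw [← closure_Ioo hl.pos.ne]
  exact (image_closure_subset_closure_image v.continuous_move).trans (closure_minimal hsub hX.1)

section
variable [Finite V] [Finite E] {F : G.Div} {u : G.Tangent} {f : G.Point → ℝ} {δ l₀ : ℝ}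

/-- If `f` decreases in the directions other than `u` by at least `b` in total, then it decreases in
the direction `u` by at most `F u.base - b`. -/
lemma le_of_sum_le (hF : IsReduced u.base F) (hf : IsPL f)
    (h : ∀ x, 0 ≤ F x + ord f x) [DecidableEq G.Tangent] {b : ℤ}
    (h' : ∑ w ∈ (tangents u.base).erase u, outSlope f w ≤ b) (hδ : 0 ≤ δ)
    {l : ℝ} (hl : IsFree (nodes F u.base) u l) (hδl : δ ≤ l) (hQ : f (u.move δ) = 0)
    (x : G.Point) : f x ≤ (F u.base + b : ℤ) * δ := by
  refine (hF.le hf (fun x _ => h x) x).trans ?_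
  have h2 := hf.tangent_le u hl.le_room (fun s h0 h1 => by
    have := h (u.move s)
    rwa [eq_zero_of_notMem_nodes (hl.notMem s h0 h1), zero_add] at this) hδ hδl
  have h3 : ((-F u.base - b : ℤ) : ℝ) ≤ outSlope f u := by
    exact_mod_cast neg_le_outSlope (h _) h'
  have h4 := mul_le_mul_of_nonneg_right h3 hδ
  push_cast at h4 ⊢
  linarith

lemma outSlope_nonpos_of_isReduced (hF : IsReduced u.base F) (hf : IsPL f)
    (h : ∀ x, 0 ≤ F x + ord f x) {w : G.Tangent} (hw : w.base = u.base) : outSlope f w ≤ 0 := by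
  rw [← outSlope_const (f u.base) w]
  exact hf.outSlope_le (isPL_const _) (by rw [hw]) (.of_forall fun s => hF.le hf (fun x _ => h x) _)

/-- Let `F` be reduced at the base of `u`, and let `f ≥ 0` vanish at a point close to the base in
the direction `u`, with `F + div f` effective. Up to small segments, the locus where `f` is positive
is a union of saturated cuts which contain the base and which `u` leaves: along each free segment
`f` is constant except close to its ends, so the locus can be described by the values of `f` at the
nodes and at the midpoints of the free segments. -/
lemma subset_sUnion_satCuts (hF0 : 0 ≤ F) (hF : IsReduced u.base F) (hf : IsPL f)
    (h : ∀ x, 0 ≤ F x + ord f x) (h0 : ∀ x, 0 ≤ f x) (hδ : 0 < δ) (hQ : f (u.move δ) = 0)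
    (hl₀ : ∀ v l, v.base ∈ nodes F u.base → IsFree (nodes F u.base) v l → l₀ ≤ l)
    (hδl : δ < l₀) (hM : F u.base * δ < l₀ / 2) :
    (∀ x ∈ nodes F u.base, 0 < f x → x ∈ ⋃₀ satCuts F u) ∧
    ∀ v l, v.base ∈ nodes F u.base → IsFree (nodes F u.base) v l → 0 < f (v.move (l / 2)) →
      ∀ s, 0 ≤ s → s ≤ l → v.move s ∈ ⋃₀ satCuts F u := by
  classical
  set S := nodes F u.base with hS
  choose L hL using exists_isFree (finite_nodes F u.base) (vertex_mem_nodes F u.base)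
  have huS : u.base ∈ S := mem_nodes _ _
  have hord : ∀ x ∉ S, 0 ≤ ord f x := fun x hx => by
    have := h x
    rwa [eq_zero_of_notMem_nodes hx, zero_add] at this
  have hfM : ∀ x, f x ≤ F u.base * δ := fun x => by
    have := le_of_sum_le hF hf h (b := 0) (Finset.sum_nonpos fun w hw =>
      outSlope_nonpos_of_isReduced hF hf h (mem_tangents.1 (Finset.mem_of_mem_erase hw))) hδ.le
      (hL u) (hδl.le.trans (hl₀ u _ huS (hL u))) hQ x
    simpa using this
  have hflat : ∀ v : G.Tangent, v.base ∈ S → _ := fun v hv =>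
    flat_of_small (hL v) hf hord h0 hfM (hM.trans_le (by linarith [hl₀ v _ hv (hL v)]))
  let B : Set G.Tangent := {v | v.base ∈ S ∧ 0 < f (v.move (L v / 2))}
  let Z : Set G.Point := {x | x ∈ S ∧ 0 < f x} ∪ ⋃ v ∈ B, v.move '' Set.Icc 0 (L v)
  have hZ : IsClosed Z :=
    (((finite_nodes F u.base).subset fun x hx => hx.1).isClosed).union
      (((finite_tangents (finite_nodes F u.base)).subset fun v hv => hv.1).isClosed_biUnion
        fun v _ => isClosed_segment v _ _)
  have hZpos : ∀ x ∈ Z, 0 < f x := by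
    rintro x (hx | hx)
    · exact hx.2
    · obtain ⟨v, hv, s, hs, rfl⟩ := Set.mem_iUnion₂.1 hx
      exact hv.2.trans_le ((hflat v hv.1).2 s hs.1 hs.2)
  have hBZ : ∀ v ∈ B, ∀ s, 0 ≤ s → s ≤ L v → v.move s ∈ Z := fun v hv s h1 h2 =>
    .inr (Set.mem_biUnion hv ⟨s, ⟨h1, h2⟩, rfl⟩)
  have hcomp : ∀ x ∈ Z, x ∈ ⋃₀ satCuts F u := by
    intro x hx
    obtain ⟨h1, h2⟩ := saturated_component (F := F) (f := f) hZ (fun x _ => h x) (fun x hx => by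
      by_cases hxS : x ∈ S
      · right
        rintro w rfl
        refine ⟨(hflat w hxS).1, fun hw => ?_⟩
        have hmid : 0 < f (w.move (L w / 2)) := by
          have := hf.tangent_le w (hL w).le_room
            (fun s h0 h1 => hord _ ((hL w).notMem s h0 h1))
            (s := L w / 2) (by linarith [(hL w).pos]) (by linarith [(hL w).pos])
          rw [hw] at this
          have h3 := hZpos _ hx
          simp at this
          linarith
        exact eventually_of_Ioo (hL w).pos fun s h3 h4 => hBZ w ⟨hxS, hmid⟩ s h3.le h4.le
      · left
        refine ⟨hF0 x, ?_⟩
        rcases hx with hx | hx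
        · exact (hxS hx.1).elim
        obtain ⟨v, hv, s, hs, rfl⟩ := Set.mem_iUnion₂.1 hx
        have hs0 : 0 < s := hs.1.lt_of_ne (by rintro rfl; exact hxS hv.1)
        have hs1 : s < L v := hs.2.lt_of_ne (by rintro rfl; exact hxS (hL v).end_mem)
        intro w hw
        rcases eq_shift_or_rev hs0 (hs1.trans_le (hL v).le_room) hw with rfl | rfl
        · exact eventually_of_Ioo (sub_pos.2 hs1) fun d h3 h4 => by
            rw [shift_move]; exact hBZ v hv _ (by linarith) (by linarith)
        · exact eventually_of_Ioo hs0 fun d h3 h4 => by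
            rw [rev_move]; exact hBZ v hv _ (by linarith) (by linarith)) hx
    have hP : u.base ∈ connectedComponentIn Z x := by
      by_contra hP
      obtain ⟨y, hy, hlt⟩ := hF.2 _ h1 hP
      exact (h2 y hy).not_gt hlt
    refine ⟨_, ⟨h1, ?_, h2⟩, mem_connectedComponentIn hx⟩
    refine h2.mem_outgoing h1 hδ (fun s h3 h4 => ?_) hP fun hd => ?_
    · exact eq_zero_of_notMem_nodes ((hL u).notMem s h3
        (h4.trans (hδl.trans_le (hl₀ u _ huS (hL u)))))
    · exact (hZpos _ (connectedComponentIn_subset _ _ hd)).ne' hQ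
  refine ⟨fun x hx hfx => hcomp x (.inl ⟨hx, hfx⟩), fun v l hv hl hfv s h1 h2 => ?_⟩
  obtain rfl := hl.unique (hL v)
  exact hcomp _ (hBZ v ⟨hv, hfv⟩ s h1 h2)

/-! ### The largest saturated cut -/

/-- The union of all saturated cuts which `u` leaves at its base is again one of them. It is closed,
as a union of finitely many nodes and closed free segments: a saturated cut contains each free
segment that it meets in an interior point. -/
lemma sUnion_satCuts_mem (hne : (satCuts F u).Nonempty) : ⋃₀ satCuts F u ∈ satCuts F u := by
  classical
  set S := nodes F u.base with hS
  have hSF : ∀ x ∉ S, F x = 0 := fun x => eq_zero_of_notMem_nodes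
  choose L hL using exists_isFree (finite_nodes F u.base) (vertex_mem_nodes F u.base)
  set Y := ⋃₀ satCuts F u with hY
  have hcl : IsClosed Y := by
    have : Y = (Y ∩ S) ∪ ⋃ v ∈ {v : G.Tangent | v.base ∈ S ∧ v.move (L v / 2) ∈ Y},
        v.move '' Set.Icc 0 (L v) := by
      apply Set.Subset.antisymm
      · rintro x ⟨X, hX, hx⟩
        by_cases hxS : x ∈ S
        · exact .inl ⟨⟨X, hX, hx⟩, hxS⟩
        · obtain ⟨v, l, s, h1, h2, h3, h4, rfl⟩ := exists_isFree_of_notMem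
            (finite_nodes F u.base) (vertex_mem_nodes F u.base) hxS
          obtain rfl := h2.unique (hL v)
          have hpos := h2.pos
          have := hX.2.2.segment_subset hX.1 hSF (hL v) h3 (by linarith) hx
          have hm : v.move (L v / 2) ∈ X := this ⟨_, ⟨by linarith, by linarith⟩, rfl⟩
          have hv : v ∈ {v : G.Tangent | v.base ∈ S ∧ v.move (L v / 2) ∈ Y} := ⟨h1, X, hX, hm⟩
          exact .inr (Set.mem_biUnion hv ⟨s, ⟨h3.le, by linarith⟩, rfl⟩)
      · rintro x (hx | hx)
        · exact hx.1
        · obtain ⟨v, ⟨-, X, hX, hv⟩, hx⟩ := Set.mem_iUnion₂.1 hx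
          have hpos := (hL v).pos
          exact ⟨X, hX, hX.2.2.segment_subset hX.1 hSF (hL v) (by linarith) (by linarith) hv hx⟩
    rw [this]
    exact (((finite_nodes F u.base).subset Set.inter_subset_right).isClosed).union
      (((finite_tangents (finite_nodes F u.base)).subset fun v hv => hv.1).isClosed_biUnion
        fun v _ => isClosed_segment v _ _)
  obtain ⟨X₀, hX₀⟩ := hne
  have hcut : IsCut Y := ⟨hcl, ⟨u.base, X₀, hX₀, hX₀.2.1.1⟩,
    isPreconnected_sUnion u.base _ (fun X hX => hX.2.1.1) fun X hX => hX.1.2.isPreconnected⟩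
  refine ⟨hcut, ⟨⟨X₀, hX₀, hX₀.2.1.1⟩, ?_⟩, ?_⟩
  · refine eventually_of_Ioo (hL u).pos fun s h0 h1 => ?_
    rintro ⟨X, hX, hs⟩
    have hsub := hX.2.2.segment_subset hX.1 hSF (hL u) h0 h1 hs
    obtain ⟨t, ht, ht0, ht1⟩ := (hX.2.1.2.and (Ioo_mem_nhdsGT (hL u).pos)).exists
    exact ht (hsub ⟨t, ⟨ht0.le, ht1.le⟩, rfl⟩)
  · intro v hv
    obtain ⟨X, hX, hvX⟩ := hcl.frontier_subset hv
    have hsub : X ⊆ Y := Set.subset_sUnion_of_mem hX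
    have hvX' : v ∈ frontier X :=
      ⟨subset_closure hvX, fun h => hv.2 (interior_mono hsub h)⟩
    refine le_trans ?_ (hX.2.2 v hvX')
    rw [outDeg_eq, outDeg_eq]
    norm_cast
    refine Finset.card_le_card fun w hw => ?_
    simp only [Finset.mem_filter, mem_tangents] at hw ⊢
    exact ⟨hw.1, hw.1 ▸ hvX, hw.2.2.mono fun s hs h => hs (hsub h)⟩

lemma isGreatest_sUnion_satCuts (hne : (satCuts F u).Nonempty) :
    IsGreatest (satCuts F u) (⋃₀ satCuts F u) :=
  ⟨sUnion_satCuts_mem hne, fun _ hX => Set.subset_sUnion_of_mem hX⟩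

end

/-! ### The local form of the reduced divisor -/

open Classical in
/-- The weights with which a cut is fired: `k` chips move in the direction `u`, and one chip in
every other direction leaving the cut. -/
def weight (u : G.Tangent) (k : ℕ) (w : G.Tangent) : ℕ := if w = u then k else 1

lemma weight_self (u : G.Tangent) (k : ℕ) : weight u k u = k := by simp [weight]

lemma weight_of_ne {u w : G.Tangent} (k : ℕ) (h : w ≠ u) : weight u k w = 1 := by simp [weight, h]

lemma weight_pos (u : G.Tangent) {k : ℕ} (hk : 0 < k) (w : G.Tangent) : 0 < weight u k w := by
  unfold weight; split_ifs <;> omega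

lemma exists_pos_le_isFree [Finite V] [Finite E] (F : G.Div) (P : G.Point) :
    ∃ l₀ > 0, ∀ v l, v.base ∈ nodes F P → IsFree (nodes F P) v l → l₀ ≤ l := by
  choose L hL using exists_isFree (finite_nodes F P) (vertex_mem_nodes F P)
  have : ∀ᶠ ε in 𝓝[>] (0 : ℝ), ∀ v ∈ {v : G.Tangent | v.base ∈ nodes F P}, ε < L v :=
    (eventually_all_finite (finite_tangents (finite_nodes F P))).2 fun v _ =>
      mem_of_superset (Ioo_mem_nhdsGT (hL v).pos) fun ε h => h.2
  obtain ⟨ε, h1, h2⟩ := (this.and self_mem_nhdsWithin).exists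
  exact ⟨ε, h2, fun v l hv hl => hl.unique (hL v) ▸ (h1 v hv).le⟩

section
variable [Finite E] {F : G.Div} {Y : Set G.Point} {u : G.Tangent} {k : ℕ}

/-- The modification of `F` along `Y` is the effect of firing `Y` with the weights `weight u k`. -/
lemma modify_eq (hfin : (outgoing Y).Finite) (hu : u ∈ outgoing Y)
    (hk : excess F Y u.base = k) (hk0 : 0 < k) (δ : ℝ) : modify F Y u δ = F +
      ∑ w ∈ hfin.toFinset, (weight u k w : ℤ) • (Finsupp.single (w.move (k * δ / weight u k w)) 1 -
        Finsupp.single w.base 1) := by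
  classical
  have huf : u ∈ hfin.toFinset := hfin.mem_toFinset.2 hu
  have h1 : ∑ᶠ w ∈ outgoing Y \ {u}, Finsupp.single (w.move ((k : ℤ) * δ)) (1 : ℤ) =
      ∑ w ∈ hfin.toFinset.erase u, Finsupp.single (w.move (k * δ)) (1 : ℤ) := by
    have hset : outgoing Y \ {u} = ↑(hfin.toFinset.erase u) := by
      ext w; simp [and_comm]
    rw [hset, finsum_mem_coe_finset]
    push_cast; rfl
  have h2 : ∑ᶠ w ∈ outgoing Y, Finsupp.single w.base (1 : ℤ) =
      Finsupp.single u.base 1 + ∑ w ∈ hfin.toFinset.erase u, Finsupp.single w.base (1 : ℤ) := by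
    rw [finsum_mem_eq_finite_toFinset_sum _ hfin,
      Finset.add_sum_erase _ (fun w => Finsupp.single w.base (1 : ℤ)) huf]
  have h3 : (∑ᶠ w ∈ outgoing Y, Finsupp.single w.base (1 : ℤ)) u.base = outDeg Y u.base := by
    rw [finsum_mem_eq_finite_toFinset_sum _ hfin, Finsupp.finsetSum_apply, outDeg_eq]
    simp only [Finsupp.single_apply, Finset.sum_boole]
    congr 2
    ext w; simp [and_comm]
  have h4 : ∑ w ∈ hfin.toFinset.erase u, (weight u k w : ℤ) •
      (Finsupp.single (w.move (k * δ / weight u k w)) 1 - Finsupp.single w.base 1) =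
      ∑ w ∈ hfin.toFinset.erase u, Finsupp.single (w.move (k * δ)) (1 : ℤ) -
        ∑ w ∈ hfin.toFinset.erase u, Finsupp.single w.base (1 : ℤ) := by
    rw [← Finset.sum_sub_distrib]
    refine Finset.sum_congr rfl fun w hw => ?_
    rw [weight_of_ne k (Finset.ne_of_mem_erase hw)]
    simp
  have h5 : (F - ∑ᶠ w ∈ outgoing Y, Finsupp.single w.base (1 : ℤ)).erase u.base =
      F - ∑ᶠ w ∈ outgoing Y, Finsupp.single w.base (1 : ℤ) -
        Finsupp.single u.base ((k : ℤ) - 1) := by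
    ext x
    rw [Finsupp.sub_apply]
    by_cases hx : x = u.base
    · rw [hx, Finsupp.erase_same, Finsupp.sub_apply, h3, Finsupp.single_eq_same, ← hk, excess]
      ring
    · rw [Finsupp.erase_ne hx, Finsupp.single_eq_of_ne hx, sub_zero]
  have hk' : (k : ℝ) ≠ 0 := by exact_mod_cast hk0.ne'
  rw [modify, hk, h1, h5, h2, ← Finset.add_sum_erase _ _ huf, h4, weight_self,
    mul_div_cancel_left₀ _ hk', Finsupp.single_sub, smul_sub, Finsupp.smul_single,
    Finsupp.smul_single, smul_eq_mul, mul_one]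
  abel

lemma modify_zero (hfin : (outgoing Y).Finite) (hu : u ∈ outgoing Y)
    (hk : excess F Y u.base = k) (hk0 : 0 < k) : modify F Y u 0 = F := by
  rw [modify_eq hfin hu hk hk0, Finset.sum_eq_zero, add_zero]
  intro w _
  simp [base]

end

section
variable [Finite V] [Finite E] {F : G.Div} {u : G.Tangent}

/-- If no saturated cut is left by `u`, the divisor remains reduced in the direction of `u`. -/
lemma isReduced_move_of_satCuts_eq_empty (hF0 : 0 ≤ F) (hF : IsReduced u.base F)
    (he : satCuts F u = ∅) : ∃ ε > 0, ∀ δ ∈ Set.Icc (0 : ℝ) ε, IsReduced (u.move δ) F := by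
  obtain ⟨l₀, hl₀, hl⟩ := exists_pos_le_isFree F u.base
  have hev : ∀ᶠ δ in 𝓝[>] (0 : ℝ), δ < l₀ ∧ F u.base * δ < l₀ / 2 := by
    refine Filter.Eventually.and (mem_of_superset (Ioo_mem_nhdsGT hl₀) fun δ h => h.2) ?_
    have : Tendsto (fun δ : ℝ => (F u.base : ℝ) * δ) (𝓝[>] 0) (𝓝 (F u.base * 0)) :=
      (Continuous.tendsto (by fun_prop) 0).mono_left nhdsWithin_le_nhds
    rw [mul_zero] at this
    exact this.eventually_lt_const (half_pos hl₀)
  obtain ⟨ε, hε, -, H⟩ := exists_Ioc_of_eventually hev one_pos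
  refine ⟨ε, hε, fun δ hδ => ?_⟩
  rcases hδ.1.eq_or_lt with rfl | hδ0
  · exact hF
  obtain ⟨h1, h2⟩ := H δ hδ0 hδ.2
  refine isReduced_of_le hF0 fun g hg hgF x => ?_
  -- Consider the positive part of `g - g Q`, where `Q` is the point at distance `δ`.
  set f : G.Point → ℝ := (fun y => g y + -g (u.move δ)) ⊔ fun _ => 0 with hf
  have hg' : IsPL fun y => g y + -g (u.move δ) := hg.add (isPL_const _)
  have hfPL : IsPL f := hg'.sup (isPL_const 0)
  have hfF : ∀ x, 0 ≤ F x + ord f x := hg'.nonneg_sup (isPL_const 0)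
    (fun x => by rw [hg.ord_add_const]; exact hgF x)
    (fun x => by rw [ord_const, add_zero]; exact hF0 x)
  have hQ : f (u.move δ) = 0 := by simp [hf]
  have hf0 : ∀ x, 0 ≤ f x := fun x => le_max_right _ _
  have := (subset_sUnion_satCuts hF0 hF hfPL hfF hf0 hδ0 hQ hl h1 h2).1 u.base (mem_nodes _ _)
  rw [he] at this
  have hP : f u.base ≤ 0 := by
    by_contra! h; simpa using this h
  have h3 : g x + -g (u.move δ) ≤ f x := le_max_left _ _
  have h4 := hF.le hfPL (fun x _ => hfF x) x
  linarith

/-- The heart of the matter: if `Y` is the largest saturated cut left by `u`, every function `f`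
with `F + div f` effective which vanishes at distance `δ` in the direction `u` and is bounded below
by the function firing `Y` is also bounded above by it. The factor `k` arises as follows: at the base
of `u`, the function `f` decreases in each of the other directions leaving `Y`, and as its order there
is at least `-F u.base`, it decreases in the direction `u` with slope at most `k`. -/
lemma le_fire (hF0 : 0 ≤ F) (hF : IsReduced u.base F) (hne : (satCuts F u).Nonempty) {k : ℕ}
    (hk : excess F (⋃₀ satCuts F u) u.base = k) (hk0 : 0 < k) {ε δ l₀ : ℝ}
    {T : Set G.Point} (hst : IsStar (⋃₀ satCuts F u) T ε)
    (hδ : 0 < δ) (hδε : k * δ < ε)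
    (hl₀ : ∀ v l, v.base ∈ nodes F u.base → IsFree (nodes F u.base) v l → l₀ ≤ l)
    (hδl : δ < l₀) (hM : F u.base * δ < l₀ / 2) {f : G.Point → ℝ} (hf : IsPL f)
    (h : ∀ x, 0 ≤ F x + ord f x) (hQ : f (u.move δ) = 0)
    (hfh : ∀ x, fire (⋃₀ satCuts F u) (weight u k) ε (k * δ) x ≤ f x) (x : G.Point) :
    f x ≤ fire (⋃₀ satCuts F u) (weight u k) ε (k * δ) x := by
  classical
  have hk1 : (0 : ℝ) < k := by exact_mod_cast hk0
  have hη : 0 < k * δ := mul_pos hk1 hδ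
  have f0 : ∀ x, 0 ≤ f x := fun x => (fire_nonneg hη.le x).trans (hfh x)
  obtain ⟨hZ1, hZ2⟩ := subset_sUnion_satCuts hF0 hF hf h f0 hδ hQ hl₀ hδl hM
  obtain ⟨hYcut, huY, hYsat⟩ := sUnion_satCuts_mem hne
  set Y := ⋃₀ satCuts F u with hY
  set S := nodes F u.base with hS
  have hSF : ∀ x ∉ S, F x = 0 := fun x => eq_zero_of_notMem_nodes
  choose L hL using exists_isFree (finite_nodes F u.base) (vertex_mem_nodes F u.base)
  have hord : ∀ x ∉ S, 0 ≤ ord f x := fun x hx => by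
    have := h x
    rwa [hSF x hx, zero_add] at this
  have hord' : ∀ v s, 0 < s → s < L v → 0 ≤ ord f (v.move s) :=
    fun v s h1 h2 => hord _ ((hL v).notMem s h1 h2)
  have huS : u.base ∈ S := mem_nodes _ _
  have hδL : δ < L u := hδl.trans_le (hl₀ u _ huS (hL u))
  have hfY : ∀ x ∈ Y, k * δ ≤ f x := fun x hx => by
    have := hfh x; rwa [fire_of_mem hx] at this
  -- In all directions leaving `Y` the function `f` vanishes in the middle of the free segment.
  have hmid : ∀ w : G.Tangent, w.base ∈ S → (∃ s, 0 ≤ s ∧ s ≤ L w ∧ w.move s ∉ Y) →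
      f (w.move (L w / 2)) = 0 := by
    rintro w hw ⟨s, h1, h2, h3⟩
    refine le_antisymm (not_lt.1 fun hpos => h3 ?_) (f0 _)
    exact hZ2 w _ hw (hL w) hpos s h1 h2
  have hmid' : ∀ w : G.Tangent, w.base ∈ S → w ∈ outgoing Y → f (w.move (L w / 2)) = 0 := by
    intro w hw hwY
    obtain ⟨s, h1, h2, h3⟩ := (hwY.2.and (Ioo_mem_nhdsGT (hL w).pos)).exists
    exact hmid w hw ⟨s, h2.le, h3.le, h1⟩
  -- The slopes at the base in the directions leaving `Y` bound `f` by `k δ`.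
  have hsum : ∑ w ∈ (tangents u.base).erase u, outSlope f w ≤ 1 - outDeg Y u.base := by
    have h1 : ∀ w ∈ (tangents u.base).erase u,
        outSlope f w ≤ if w ∈ outgoing Y then (-1 : ℤ) else 0 := by
      intro w hw
      have hwb := mem_tangents.1 (Finset.mem_of_mem_erase hw)
      split_ifs with hwY
      · have hpos := (hL w).pos
        have h2 := hf.tangent_le w (hL w).le_room (hord' w) (s := L w / 2) (by linarith)
          (by linarith)
        rw [hmid' w (hwb ▸ huS) hwY] at h2
        have h3 := hfY _ hwY.1
        by_contra! h4
        have h5 : (0 : ℝ) ≤ outSlope f w := by exact_mod_cast Int.lt_iff_add_one_le.1 h4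
        nlinarith
      · exact outSlope_nonpos_of_isReduced hF hf h hwb
    refine (Finset.sum_le_sum h1).trans ?_
    rw [← Finset.sum_filter, Finset.sum_const, outDeg_eq, Finset.filter_erase,
      Finset.card_erase_of_mem (by simpa using huY)]
    have : 0 < {w ∈ tangents u.base | w ∈ outgoing Y}.card :=
      Finset.card_pos.2 ⟨u, by simpa using huY⟩
    simp only [nsmul_eq_mul]
    push_cast [Nat.cast_sub (Nat.one_le_iff_ne_zero.2 this.ne')]
    linarith
  have hfk : ∀ x, f x ≤ k * δ := fun x => by
    have h1 := le_of_sum_le hF hf h hsum hδ.le (hL u) hδL.le hQ x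
    have h2 : F u.base + (1 - (outDeg Y u.base : ℤ)) = k := by rw [← hk, excess]; ring
    rw [h2] at h1
    exact_mod_cast h1
  by_cases hxY : x ∈ Y
  · rw [fire_of_mem hxY]; exact hfk x
  by_cases hfx : f x = 0
  · rw [hfx]; exact fire_nonneg hη.le x
  have hfx : 0 < f x := (f0 x).lt_of_ne (Ne.symm hfx)
  have hxS : x ∉ S := fun hxS => hxY (hZ1 x hxS hfx)
  obtain ⟨v, l, s, hvS, hl, hs0, hs1, rfl⟩ := exists_isFree_of_notMem (finite_nodes F u.base)
    (vertex_mem_nodes F u.base) hxS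
  obtain rfl := hl.unique (hL v)
  have hpos := hl.pos
  have hroom := hl.le_room
  have hvmid := hmid v hvS ⟨s, hs0.le, by linarith, hxY⟩
  have hs2 : s < L v / 2 := hs1.lt_of_ne (by rintro rfl; exact hfx.ne' hvmid)
  -- Since `f` is positive at `x` and vanishes at the midpoint, it increases towards the base of `v`.
  have hslope : 1 ≤ outSlope f (v.rev s hs0 (by linarith)) := by
    have hsr : s < v.room := by linarith
    have h1 := hf.tangent_le_shift v hroom (hord' v) hs0.le hsr hs1 (by linarith)
    rw [hvmid] at h1
    have h2 := hord' v s hs0 (by linarith)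
    rw [ord_move f hs0 hsr] at h2
    by_contra! h3
    have h4 : (0 : ℝ) ≤ outSlope f (v.shift s hs0.le hsr) := by
      exact_mod_cast (by omega : 0 ≤ outSlope f (v.shift s hs0.le hsr))
    nlinarith
  have hdec : ∀ t, 0 ≤ t → t ≤ s → f (v.move s) + (s - t) ≤ f (v.move t) := fun t ht0 ht1 => by
    have h1 := hf.tangent_le_rev v (hord' v) hs0 (by linarith) (by linarith) ht0 ht1
    have h2 : (1 : ℝ) ≤ outSlope f (v.rev s hs0 (by linarith)) := by exact_mod_cast hslope
    nlinarith
  have hvY : v.base ∈ Y := hZ1 _ hvS (by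
    have := hdec 0 le_rfl hs0.le
    change 0 < f (v.move 0)
    linarith)
  have hvout : v ∈ outgoing Y := ⟨hvY, (hYcut.germ v).resolve_left fun hg => hxY <| by
    obtain ⟨t, ht, ht0, ht1⟩ := (hg.and (Ioo_mem_nhdsGT hpos)).exists
    exact hYsat.segment_subset hYcut hSF hl ht0 ht1 ht ⟨s, ⟨hs0.le, by linarith⟩, rfl⟩⟩
  have hle : f (v.move s) ≤ k * δ - weight u k v * s := by
    by_cases hvu : v = u
    · subst hvu
      rw [weight_self]
      have hsδ : s < δ := by
        by_contra! hcon
        have := hdec δ hδ.le hcon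
        linarith
      have h1 := hf.le_chord v hroom (hord' v) hs0 hsδ hδL.le
      rw [hQ, mul_zero, add_zero] at h1
      have h2 := mul_le_mul_of_nonneg_left (hfk v.base) (sub_nonneg.2 hsδ.le)
      have h3 : δ * f (v.move s) ≤ δ * (k * δ - k * s) := by linarith
      exact le_of_mul_le_mul_left h3 hδ
    · rw [weight_of_ne k hvu]
      have h1 := hdec 0 le_rfl hs0.le
      have h2 := hfk (v.move 0)
      push_cast
      linarith
  have hw1 : (1 : ℝ) ≤ weight u k v := by exact_mod_cast weight_pos u hk0 v
  rw [fire_ray hst hη.le hvout hs0.le (by nlinarith)]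
  exact hle.trans (le_max_right _ _)

/-- If `Y` is the largest saturated cut left by `u`, then the modification of `F` along `Y` is
reduced in the direction of `u`. -/
lemma isReduced_modify (hF0 : 0 ≤ F) (hF : IsReduced u.base F) (hne : (satCuts F u).Nonempty)
    {k : ℕ} (hk : excess F (⋃₀ satCuts F u) u.base = k) (hk0 : 0 < k) :
    ∃ ε > 0, IsStar (⋃₀ satCuts F u) (nodes F u.base) (k * ε) ∧ ∀ δ ∈ Set.Icc (0 : ℝ) ε,
      0 ≤ modify F (⋃₀ satCuts F u) u δ ∧ LinEquiv (modify F (⋃₀ satCuts F u) u δ) F ∧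
        IsReduced (u.move δ) (modify F (⋃₀ satCuts F u) u δ) := by
  classical
  obtain ⟨l₀, hl₀, hl⟩ := exists_pos_le_isFree F u.base
  obtain ⟨hYcut, huY, hYsat⟩ := sUnion_satCuts_mem hne
  have hfin := hYsat.finite_outgoing hYcut
  obtain ⟨ε₀, hε₀, -, hst⟩ := exists_Ioc_of_eventually
    (eventually_isStar hfin (finite_nodes F u.base)) one_pos
  have hst₀ := hst ε₀ hε₀ le_rfl
  have hk1 : (0 : ℝ) < k := by exact_mod_cast hk0
  have hlim : ∀ c b : ℝ, 0 < b → ∀ᶠ δ in 𝓝[>] (0 : ℝ), c * δ < b := fun c b hb => by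
    have : Tendsto (fun δ : ℝ => c * δ) (𝓝[>] 0) (𝓝 (c * 0)) :=
      (Continuous.tendsto (by fun_prop) 0).mono_left nhdsWithin_le_nhds
    rw [mul_zero] at this
    exact this.eventually_lt_const hb
  obtain ⟨ε, hε, -, H⟩ := exists_Ioc_of_eventually
    (((hlim 1 l₀ hl₀).and (hlim (F u.base) _ (half_pos hl₀))).and (hlim k ε₀ hε₀)) one_pos
  refine ⟨ε, hε, hst _ (mul_pos hk1 hε) (H ε hε le_rfl).2.le, fun δ hδ => ?_⟩
  rcases hδ.1.eq_or_lt with rfl | hδ0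
  · rw [modify_zero hfin huY hk hk0]
    exact ⟨hF0, LinEquiv.refl F, hF⟩
  obtain ⟨⟨h1, h2⟩, h3⟩ := H δ hδ0 hδ.2
  rw [one_mul] at h1
  set Y := ⋃₀ satCuts F u with hY
  have hη : 0 < k * δ := mul_pos hk1 hδ0
  have hc : ∀ w ∈ outgoing Y, 0 < weight u k w := fun w _ => weight_pos u hk0 w
  set φ := fire Y (weight u k) ε₀ (k * δ) with hφ
  have hφPL : IsPL φ := isPL_fire hYcut hfin hst₀ hη h3 hc
  have hmod : modify F Y u δ = F + divisor φ hφPL := by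
    rw [modify_eq hfin huY hk hk0, divisor_fire hYcut hfin hst₀ hη h3 hc]
  have hφF : ∀ x, 0 ≤ F x + ord φ x := by
    refine nonneg_add_ord_fire hYcut hfin hst₀ hη h3 hc fun x => ?_
    by_cases hx : x = u.base
    · subst hx
      have hu : u ∈ ({w ∈ tangents u.base | w ∈ outgoing Y} : Finset _) := by simpa using huY
      rw [← Finset.add_sum_erase _ _ hu, weight_self,
        Finset.sum_congr rfl fun w hw => by rw [weight_of_ne k (Finset.ne_of_mem_erase hw)],
        Finset.sum_const, Finset.card_erase_of_mem hu, ← outDeg_eq, ← hk, excess]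
      have : 0 < outDeg Y u.base := outDeg_pos huY
      simp only [nsmul_eq_mul, Nat.cast_one, mul_one]
      push_cast [Nat.cast_sub (Nat.one_le_iff_ne_zero.2 this.ne')]
      linarith
    · rw [Finset.sum_congr rfl fun w hw => by
        rw [weight_of_ne k fun h => hx (by
          rw [← h, mem_tangents.1 (Finset.mem_filter.1 hw).1])]]
      simpa [outDeg_eq] using hYsat.outDeg_le hF0 x
  have heff : 0 ≤ modify F Y u δ := by rw [hmod]; exact fun x => hφF x
  have hφQ : φ (u.move δ) = 0 := by
    have : δ ≤ k * δ := le_mul_of_one_le_left hδ0.le (by exact_mod_cast hk0)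
    rw [hφ, fire_ray hst₀ hη.le huY hδ0.le (by linarith), weight_self, sub_self, max_self]
  refine ⟨heff, hmod ▸ linEquiv_add_divisor F hφPL, isReduced_of_le heff fun g hg hgF x => ?_⟩
  -- Both `φ + g`, shifted so as to vanish at distance `δ`, and `φ` can be added to `F`; their maximum
  -- is bounded below by `φ`, hence bounded above by `φ`.
  set g' : G.Point → ℝ := fun y => (φ + g) y + -(φ + g) (u.move δ) with hg'
  have hg'PL : IsPL g' := (hφPL.add hg).add (isPL_const _)
  have hg'F : ∀ x, 0 ≤ F x + ord g' x := fun x => by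
    rw [hg', (hφPL.add hg).ord_add_const, hφPL.ord_add hg, ← add_assoc]
    have := hgF x
    rwa [hmod] at this
  have := le_fire hF0 hF hne hk hk0 hst₀ hδ0 h3 hl h1 h2 (hg'PL.sup hφPL)
    (hg'PL.nonneg_sup hφPL hg'F hφF) (by simp [hg', hφQ]) (fun x => le_max_right _ _) x
  have h4 : g' x ≤ φ x := (le_max_left _ _).trans this
  simp only [hg', Pi.add_apply, hφQ] at h4
  linarith

end

/-! ### Effective divisors and the symmetric product -/

lemma toDiv_apply [DecidableEq G.Point] {N : ℕ} (x : Sym G.Point N) (P : G.Point) :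
    toDiv x P = ((x : Multiset G.Point).count P : ℤ) := by
  have : ∀ s : Multiset G.Point,
      (s.map fun P => Finsupp.single P (1 : ℤ)).sum P = (s.count P : ℤ) := fun s => by
    induction s using Multiset.induction with
    | empty => simp
    | cons a s ih =>
      rw [Multiset.map_cons, Multiset.sum_cons, Finsupp.add_apply, ih, Multiset.count_cons,
        Finsupp.single_apply]
      push_cast
      simp only [eq_comm (a := a)]
      ring
  exact this x

lemma toDiv_injective {N : ℕ} : Function.Injective (toDiv (G := G) (N := N)) := by
  classical
  intro x y h
  refine Sym.coe_injective (Multiset.ext.2 fun P => ?_)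
  have := DFunLike.congr_fun h P
  rw [toDiv_apply, toDiv_apply] at this
  exact_mod_cast this

lemma toDiv_nonneg {N : ℕ} (x : Sym G.Point N) : 0 ≤ toDiv x := by
  classical
  intro P
  rw [toDiv_apply]
  exact Int.natCast_nonneg _

lemma exists_toDiv_eq {N : ℕ} {F : G.Div} (hF : 0 ≤ F) (hN : deg F = N) :
    ∃ x : Sym G.Point N, toDiv x = F := by
  classical
  let F' : G.Point →₀ ℕ := F.mapRange Int.toNat rfl
  have hcard : (Finsupp.toMultiset F').card = N := by
    rw [Finsupp.card_toMultiset]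
    have h1 : F'.sum (fun _ => id) = F.sum fun _ a => a.toNat :=
      Finsupp.sum_mapRange_index fun _ => rfl
    have h2 : ((F.sum fun _ a => a.toNat : ℕ) : ℤ) = deg F := by
      rw [deg, Finsupp.sum, Finsupp.sum]
      push_cast
      exact Finset.sum_congr rfl fun x _ => Int.toNat_of_nonneg (hF x)
    rw [h1]
    exact_mod_cast h2.trans hN
  refine ⟨⟨Finsupp.toMultiset F', hcard⟩, ?_⟩
  ext P
  refine (toDiv_apply _ P).trans ?_
  change ((Finsupp.toMultiset F').count P : ℤ) = F P
  rw [Finsupp.count_toMultiset]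
  exact Int.toNat_of_nonneg (hF P)

/-! ### Integral affine families of divisors -/

/-- The point reached from `x` when moving back for the time `d` with velocity `n x`; the vertices
do not move. -/
def flow (n : G.Point → ℤ) (d : ℝ) : G.Point → G.Point
  | .vertex v => .vertex v
  | .inner e r h => G.edgePt e (r - d * n (.inner e r h))

lemma flow_of_eq_zero {n : G.Point → ℤ} {x : G.Point} (h : n x = 0) (d : ℝ) :
    flow n d x = x := by
  obtain v | ⟨e, r, hr⟩ := x
  · rfl
  · simp [flow, h, edgePt_of_mem hr]

lemma sum_map_sort {M : Type*} [AddCommMonoid M] (T : Finset ℝ) (g : ℝ → M) :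
    ((T.sort (· ≤ ·)).map g).sum = ∑ r ∈ T, g r := by
  rw [Finset.sum_eq_multiset_sum, ← Finset.sort_eq T (· ≤ ·), Multiset.map_coe, Multiset.sum_coe]

lemma finite_edge_support (F : G.Div) (e : E) :
    {r | r ∈ Set.Ioo 0 (G.len e) ∧ F (G.edgePt e r) ≠ 0}.Finite := by
  refine Set.Finite.of_finite_image (f := G.edgePt e) (F.support.finite_toSet.subset ?_) ?_
  · rintro _ ⟨r, hr, rfl⟩; exact Finsupp.mem_support_iff.2 hr.2
  · rintro r hr r' hr' h
    rw [edgePt_of_mem hr'.1] at h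
    exact (edgePt_eq_inner h).2

/-- The positions inside the edge `e` of the points of a divisor. -/
def edgeSupport (F : G.Div) (e : E) : Finset ℝ := (finite_edge_support F e).toFinset

lemma mem_edgeSupport {F : G.Div} {e : E} {r : ℝ} :
    r ∈ edgeSupport F e ↔ (0 < r ∧ r < G.len e) ∧ F (G.edgePt e r) ≠ 0 := by
  simp [edgeSupport]

lemma sum_eq_edgeSupport [Fintype V] [Fintype E] (F : G.Div) {M : Type*} [AddCommMonoid M]
    (g : G.Point → ℤ → M) (hg : ∀ x, g x 0 = 0) :
    F.sum g = ∑ v, g (.vertex v) (F (.vertex v)) +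
      ∑ e, ∑ r ∈ edgeSupport F e, g (G.edgePt e r) (F (G.edgePt e r)) := by
  rw [sum_eq_edges F g hg]
  congr 1
  refine Finset.sum_congr rfl fun e _ => ?_
  apply finsum_mem_eq_sum_of_inter_support_eq
  ext r
  simp only [Set.mem_inter_iff, Set.mem_Ioo, Function.mem_support, Finset.mem_coe,
    mem_edgeSupport]
  constructor
  · rintro ⟨h3, h4⟩
    exact ⟨⟨h3, fun h => h4 (by rw [h, hg])⟩, h4⟩
  · rintro ⟨h3, h4⟩
    exact ⟨h3.1, h4⟩

section Cells

variable [Fintype V] [Fintype E] {N : ℕ}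

lemma toDiv_cellParam (τ : CellType V E N) (x : τ.Coord → ℝ) :
    toDiv (cellParam G τ x) = ∑ v, τ.vmult v • Finsupp.single (Point.vertex v) (1 : ℤ) +
      ∑ e, ∑ i : Fin (τ.parts e).length,
        (τ.parts e).get i • Finsupp.single (G.edgePt e (x ⟨e, i⟩)) (1 : ℤ) := by
  let φ : Multiset G.Point →+ G.Div :=
    Multiset.sumAddMonoidHom.comp (Multiset.mapAddMonoidHom fun P => Finsupp.single P (1 : ℤ))
  have hφ : ∀ n P, φ (Multiset.replicate n P) = n • Finsupp.single P (1 : ℤ) := fun n P => by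
    simp [φ, Multiset.map_replicate, Multiset.sum_replicate]
  change φ (_ + _) = _
  simp only [map_add, map_sum, hφ]

/-- The parametrization of a cell is continuous. -/
lemma continuous_cellParam (τ : CellType V E N) : Continuous (cellParam G τ) := by
  let ι := (Σ v, Fin (τ.vmult v)) ⊕ (Σ c : τ.Coord, Fin ((τ.parts c.1).get c.2))
  have hcard : Fintype.card (Fin N) = Fintype.card ι := by
    have h : ∀ l : List ℕ, ∑ i : Fin l.length, l.get i = l.sum := fun l => by simp
    rw [Fintype.card_fin, Fintype.card_sum, Fintype.card_sigma, Fintype.card_sigma,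
      Fintype.sum_sigma]
    simp only [Fintype.card_fin, h]
    exact τ.total.symm
  let q := Fintype.equivOfCardEq hcard
  let p : (τ.Coord → ℝ) → ι → G.Point := fun x => Sum.elim (fun a => .vertex a.1)
    fun c => G.edgePt c.1.1 (x c.1)
  have hp : Continuous fun (x : τ.Coord → ℝ) (j : Fin N) => p x (q j) := by
    refine continuous_pi fun j => ?_
    rcases q j with a | c
    · exact continuous_const
    · exact (continuous_edgePt _).comp (continuous_apply _)
  have heq : cellParam G τ = fun x => toSym G.Point N fun j => p x (q j) := by
    funext x
    apply Subtype.ext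
    change _ = Finset.univ.val.map fun j => p x (q j)
    have h1 : (Finset.univ.val.map fun j => p x (q j)) = ∑ j, {p x (q j)} := by
      refine (Multiset.sum_map_singleton _).symm.trans ?_
      rw [Multiset.map_map]
      rfl
    rw [h1, Equiv.sum_comp q fun i => ({p x i} : Multiset G.Point), Fintype.sum_sum_type,
      Fintype.sum_sigma, Fintype.sum_sigma, Fintype.sum_sigma]
    simp [p, cellParam, Multiset.nsmul_singleton]
  have hc : Continuous (toSym G.Point N) := continuous_coinduced_rng
  rw [heq]
  exact hc.comp hp

lemma isClosed_cellPoly (τ : CellType V E N) : IsClosed (cellPoly G τ) := by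
  have : cellPoly G τ = ⋂ e, (⋂ i, {x | 0 ≤ x ⟨e, i⟩} ∩ {x | x ⟨e, i⟩ ≤ G.len e}) ∩
      ⋂ i, ⋂ j, ⋂ _ : i ≤ j, {x | x ⟨e, i⟩ ≤ x ⟨e, j⟩} := by
    ext x; simp [cellPoly]
  rw [this]
  refine isClosed_iInter fun e => (isClosed_iInter fun i => ?_).inter
    (isClosed_iInter fun i => isClosed_iInter fun j => isClosed_iInter fun _ => ?_)
  · exact (isClosed_le continuous_const (continuous_apply _)).inter
      (isClosed_le (continuous_apply _) continuous_const)
  · exact isClosed_le (continuous_apply _) (continuous_apply _)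

lemma cellInt_subset_cellPoly (τ : CellType V E N) : cellInt G τ ⊆ cellPoly G τ := by
  intro x hx e
  refine ⟨fun i => ⟨((hx e).1 i).1.le, ((hx e).1 i).2.le⟩, fun i j hij => ?_⟩
  rcases hij.eq_or_lt with rfl | h
  · exact le_rfl
  · exact ((hx e).2 i j h).le

/-- Let points move along the edges with constant integral velocities `n`, so as to form the
effective divisor `F` at time `ε`. If they meet neither each other nor the vertices at the times
`0 < t ≤ ε`, then the motion is a straight line in the interior of a cell of the symmetric product,
up to the time `0`. -/
lemma exists_cell {F : G.Div} (hF : 0 ≤ F) (hN : deg F = N) (n : G.Point → ℤ) {ε : ℝ}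
    (h1 : ∀ e r h, F (.inner e r h) ≠ 0 → ∀ d, 0 ≤ d → d < ε →
      0 < r - d * n (.inner e r h) ∧ r - d * n (.inner e r h) < G.len e)
    (h2 : ∀ x y, F x ≠ 0 → F y ≠ 0 → x ≠ y → ∀ d, 0 ≤ d → d < ε → flow n d x ≠ flow n d y) :
    ∃ (τ : CellType V E N) (a : τ.Coord → ℝ) (m : τ.Coord → ℤ),
      (∀ t, 0 < t → t ≤ ε → (fun i => a i + t * m i) ∈ cellInt G τ) ∧
      ∀ t, toDiv (cellParam G τ fun i => a i + t * m i) = F.mapDomain (flow n (ε - t)) := by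
  classical
  let l : E → List ℝ := fun e => (edgeSupport F e).sort (· ≤ ·)
  have hl : ∀ {e r}, r ∈ l e ↔ r ∈ edgeSupport F e := by intro e r; simp [l]
  let τ : CellType V E N :=
    { vmult := fun v => (F (.vertex v)).toNat
      parts := fun e => (l e).map fun r => (F (G.edgePt e r)).toNat
      parts_pos := by
        intro e m hm
        obtain ⟨r, hr, rfl⟩ := List.mem_map.1 hm
        have := (mem_edgeSupport.1 (hl.1 hr)).2
        have := hF (G.edgePt e r)
        simp only [Finsupp.coe_zero, Pi.zero_apply] at this
        omega
      total := by
        have := sum_eq_edgeSupport F (fun _ a => a) fun _ => rfl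
        rw [← Int.natCast_inj, ← hN, deg, this]
        simp only [l, sum_map_sort]
        rw [Nat.cast_add, Nat.cast_sum, Nat.cast_sum]
        congr 1
        · exact Finset.sum_congr rfl fun v _ => Int.toNat_of_nonneg (hF _)
        · refine Finset.sum_congr rfl fun e _ => ?_
          rw [Nat.cast_sum]
          exact Finset.sum_congr rfl fun r _ => Int.toNat_of_nonneg (hF _) }
  have hlen : ∀ e, (τ.parts e).length = (l e).length := fun e => List.length_map _
  let pt : τ.Coord → ℝ := fun c => (l c.1).get (c.2.cast (hlen c.1))
  have hpt : ∀ c, pt c ∈ edgeSupport F c.1 := fun c => hl.1 (List.get_mem _ _)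
  refine ⟨τ, fun c => pt c - ε * n (G.edgePt c.1 (pt c)), fun c => n (G.edgePt c.1 (pt c)), ?_, ?_⟩
  · intro t ht0 htε e
    have hpos : ∀ i, _ := fun i : Fin (τ.parts e).length => mem_edgeSupport.1 (hpt ⟨e, i⟩)
    have heq : ∀ (r : ℝ) (m : ℤ), r - ε * m + t * m = r - (ε - t) * m := fun r m => by ring
    simp only [heq]
    refine ⟨fun i => ?_, fun i j hij => ?_⟩
    · obtain ⟨h3, h4⟩ := hpos i
      rw [edgePt_of_mem h3] at h4 ⊢
      exact h1 _ _ _ h4 _ (by linarith) (by linarith)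
    · obtain ⟨h3, h4⟩ := hpos i
      obtain ⟨h5, h6⟩ := hpos j
      have hlt : pt ⟨e, i⟩ < pt ⟨e, j⟩ := by
        have := (edgeSupport F e).sortedLT_sort
        exact this.strictMono_get (by exact hij)
      rw [edgePt_of_mem h3] at h4
      rw [edgePt_of_mem h5] at h6
      rw [edgePt_of_mem h3, edgePt_of_mem h5]
      have hne := h2 _ _ h4 h6 (by simpa using hlt.ne)
      -- The order of two points on an edge cannot change, as they never meet.
      by_contra! hcon
      obtain ⟨d, hd, hd0⟩ := intermediate_value_Icc' (f := fun d : ℝ =>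
        (pt ⟨e, j⟩ - d * n (.inner e _ h5)) - (pt ⟨e, i⟩ - d * n (.inner e _ h3)))
        (show 0 ≤ ε - t by linarith) (by fun_prop)
        (show (0 : ℝ) ∈ Set.Icc _ _ from ⟨by linarith, by linarith⟩)
      refine hne d hd.1 (by linarith [hd.2]) ?_
      simp only [flow]
      congr 1
      linarith
  · intro t
    have heq : ∀ (r : ℝ) (m : ℤ), r - ε * m + t * m = r - (ε - t) * m := fun r m => by ring
    have hlist : ∀ e, ∑ i : Fin (τ.parts e).length, (τ.parts e).get i •
        Finsupp.single (G.edgePt e (pt ⟨e, i⟩ - (ε - t) * n (G.edgePt e (pt ⟨e, i⟩)))) (1 : ℤ) =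
        ((l e).map fun r => (F (G.edgePt e r)).toNat •
          Finsupp.single (G.edgePt e (r - (ε - t) * n (G.edgePt e r))) (1 : ℤ)).sum := by
      intro e
      rw [← List.sum_ofFn]
      congr 1
      refine List.ext_getElem (by simp [hlen]) fun i h3 h4 => ?_
      simp [pt, τ]
    rw [toDiv_cellParam]
    simp only [heq, hlist, l, sum_map_sort]
    rw [Finsupp.mapDomain, sum_eq_edgeSupport F (fun x => Finsupp.single (flow n (ε - t) x))
      fun x => Finsupp.single_zero _]
    congr 1
    · refine Finset.sum_congr rfl fun v _ => ?_
      rw [← natCast_zsmul, Int.toNat_of_nonneg (hF _), Finsupp.smul_single, smul_eq_mul, mul_one]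
      rfl
    · refine Finset.sum_congr rfl fun e _ => Finset.sum_congr rfl fun r hr => ?_
      rw [← natCast_zsmul, Int.toNat_of_nonneg (hF _), Finsupp.smul_single, smul_eq_mul, mul_one]
      obtain ⟨h3, -⟩ := mem_edgeSupport.1 hr
      rw [edgePt_of_mem h3]
      rfl

end Cells

/-- A divisor of non-negative rank is linearly equivalent to an effective divisor. -/
lemma exists_mem_linearSystem {D : G.Div} (hD : 0 ≤ rank D) : ∃ F : G.Div, 0 ≤ F ∧ LinEquiv F D := by
  by_contra hcon
  have h : linearSystem (D - 0) = ∅ := by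
    rw [sub_zero, Set.eq_empty_iff_forall_notMem]
    exact fun F hF => hcon ⟨F, hF⟩
  -- Otherwise the zero divisor shows that the minimum defining the rank is zero.
  have h0 : sInf {n : ℕ | ∃ F : G.Div, 0 ≤ F ∧ deg F = n ∧ linearSystem (D - F) = ∅} = 0 :=
    Nat.sInf_eq_zero.2 (.inl ⟨0, le_rfl, by simp [deg], h⟩)
  rw [rank, h0] at hD
  simp at hD

section
variable [Fintype V] [Fintype E] {N : ℕ}

/-- The modification of a divisor along a cut moves the points with constant integral velocities
along the edges. -/
lemma exists_cell_modify {F : G.Div} {Y T : Set G.Point} {u : G.Tangent} {k : ℕ} {ε : ℝ}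
    (hfin : (outgoing Y).Finite) (hu : u ∈ outgoing Y) (hk : excess F Y u.base = k) (hk0 : 0 < k)
    (hε : 0 < ε) (hst : IsStar Y T (k * ε)) (hT : ∀ x ∉ T, F x = 0)
    (hF : 0 ≤ modify F Y u ε) (hN : deg (modify F Y u ε) = N) :
    ∃ (τ : CellType V E N) (a : τ.Coord → ℝ) (m : τ.Coord → ℤ),
      (∀ t, 0 < t → t ≤ ε → (fun i => a i + t * m i) ∈ cellInt G τ) ∧
      ∀ t, toDiv (cellParam G τ fun i => a i + t * m i) = modify F Y u t := by
  classical
  -- The speeds with which the points move away from `Y`.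
  let q : G.Tangent → ℕ := fun w => if w = u then 1 else k
  have hq : ∀ w (t : ℝ), k * t / weight u k w = q w * t := fun w t => by
    have : (k : ℝ) ≠ 0 := by exact_mod_cast hk0.ne'
    by_cases h : w = u
    · simp [q, h, weight_self, this]
    · simp [q, h, weight_of_ne]
  have hq0 : ∀ w t, 0 < t → t ≤ ε → 0 < q w * t ∧ q w * t ≤ k * ε := fun w t h0 h1 => by
    have h2 : 0 < q w ∧ q w ≤ k := by simp only [q]; split_ifs <;> omega
    have h3 : (0 : ℝ) < q w := by exact_mod_cast h2.1
    have h4 : (q w : ℝ) ≤ k := by exact_mod_cast h2.2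
    exact ⟨by positivity, by gcongr⟩
  have hmod : ∀ t, modify F Y u t = F + ∑ w ∈ hfin.toFinset, (weight u k w : ℤ) •
      (Finsupp.single (w.move (q w * t)) 1 - Finsupp.single w.base 1) := fun t => by
    simp only [modify_eq hfin hu hk hk0, hq]
  -- In the parameters of the edges, the speeds get a sign. The velocity of a point is attached to its
  -- position at time `ε`, where different points are apart.
  let sgn : G.Tangent → ℤ := fun w => if w.fwd then q w else -q w
  let n : G.Point → ℤ := fun x =>
    if h : ∃ w ∈ outgoing Y, w.move (q w * ε) = x then sgn h.choose else 0
  have hn : ∀ w ∈ outgoing Y, n (w.move (q w * ε)) = sgn w := fun w hw => by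
    have hex : ∃ w' ∈ outgoing Y, w'.move (q w' * ε) = w.move (q w * ε) := ⟨w, hw, rfl⟩
    simp only [n, dif_pos hex]
    obtain ⟨h1, h2⟩ := hex.choose_spec
    have h3 := hq0 hex.choose ε hε le_rfl
    have h4 := hq0 w ε hε le_rfl
    rw [(hst.inj _ h1 _ hw _ _ h3.1 h3.2 h4.1 h4.2 h2).1]
  have hn0 : ∀ x, (¬ ∃ w ∈ outgoing Y, w.move (q w * ε) = x) → n x = 0 := fun x h => by
    simp only [n, dif_neg h]
  have hpar : ∀ w d, w.par (q w * ε) - d * sgn w = w.par (q w * (ε - d)) := fun w d => by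
    simp only [par, sgn]; split_ifs <;> push_cast <;> ring
  have hinner : ∀ w ∈ outgoing Y, ∃ h, w.move (q w * ε) = .inner w.edge (w.par (q w * ε)) h :=
    fun w hw => ⟨_, move_inner (hq0 w ε hε le_rfl).1
      ((hq0 w ε hε le_rfl).2.trans_lt (hst.lt_room w hw))⟩
  have hflow : ∀ w ∈ outgoing Y, ∀ d, flow n d (w.move (q w * ε)) = w.move (q w * (ε - d)) := by
    intro w hw d
    obtain ⟨h', e⟩ := hinner w hw
    have h := hn w hw
    rw [e] at h ⊢
    simp only [flow, h, hpar]
    rfl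
  have hstat : ∀ x, modify F Y u ε x ≠ 0 → n x = 0 ∧ x ∈ T ∪ Y ∨
      ∃ w ∈ outgoing Y, w.move (q w * ε) = x := by
    intro x hx
    by_cases h : ∃ w ∈ outgoing Y, w.move (q w * ε) = x
    · exact .inr h
    · refine .inl ⟨hn0 x h, ?_⟩
      by_contra hxTY
      refine hx ?_
      rw [hmod, Finsupp.add_apply, hT x fun h' => hxTY (.inl h'), zero_add,
        Finsupp.finsetSum_apply]
      refine Finset.sum_eq_zero fun w hw => ?_
      have hw := hfin.mem_toFinset.1 hw
      have h1 : w.move (q w * ε) ≠ x := fun h' => h ⟨w, hw, h'⟩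
      have h2 : w.base ≠ x := fun h' => hxTY (.inr (h' ▸ hw.1))
      simp [h1, h2]
  have hTY : ∀ w ∈ outgoing Y, ∀ t, 0 < t → t ≤ ε → w.move (q w * t) ∉ T ∪ Y := by
    rintro w hw t h0 h1 (h | h)
    · exact hst.notMem' w hw _ (hq0 w t h0 h1).1 (hq0 w t h0 h1).2 h
    · exact hst.notMem w hw _ (hq0 w t h0 h1).1 (hq0 w t h0 h1).2 h
  obtain ⟨τ, a, m, h1, h2⟩ := exists_cell hF hN n (ε := ε) (by
      intro e r h hx d hd0 hd1
      rcases hstat _ hx with ⟨h0, -⟩ | ⟨w, hw, hwx⟩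
      · rw [h0]; simpa using h
      · have h3 := hn w hw
        obtain ⟨h', h4⟩ := hinner w hw
        rw [hwx] at h3 h4
        rw [h3]
        obtain ⟨rfl, h5⟩ := (Point.inner.injEq ..).mp h4
        have h6 := hq0 w (ε - d) (by linarith) (by linarith)
        rw [h5, hpar]
        exact par_mem h6.1 (h6.2.trans_lt (hst.lt_room w hw))) (by
      intro x y hx hy hxy d hd0 hd1
      have hd2 : 0 < ε - d := by linarith
      have hd3 : ε - d ≤ ε := by linarith
      rcases hstat x hx with ⟨h0, h1⟩ | ⟨w, hw, rfl⟩ <;>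
        rcases hstat y hy with ⟨h0', h1'⟩ | ⟨w', hw', rfl⟩
      · rwa [flow_of_eq_zero h0, flow_of_eq_zero h0']
      · rw [flow_of_eq_zero h0, hflow w' hw']
        rintro rfl
        exact hTY w' hw' _ hd2 hd3 h1
      · rw [flow_of_eq_zero h0', hflow w hw]
        rintro rfl
        exact hTY w hw _ hd2 hd3 h1'
      · rw [hflow w hw, hflow w' hw']
        intro h
        have h3 := hq0 w _ hd2 hd3
        have h4 := hq0 w' _ hd2 hd3
        obtain ⟨rfl, -⟩ := hst.inj _ hw _ hw' _ _ h3.1 h3.2 h4.1 h4.2 h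
        exact hxy rfl)
  refine ⟨τ, a, m, h1, fun t => ?_⟩
  rw [h2, hmod, hmod, Finsupp.mapDomain_add, Finsupp.mapDomain_finsetSum]
  congr 1
  · have : ∀ x ∈ F.support, flow n (ε - t) x = id x := fun x hx => by
      refine flow_of_eq_zero (hn0 x ?_) _
      rintro ⟨w, hw, rfl⟩
      refine Finsupp.mem_support_iff.1 hx (hT _ fun h => ?_)
      exact hTY w hw ε hε le_rfl (.inl h)
    rw [Finsupp.mapDomain_congr this, Finsupp.mapDomain_id]
  · refine Finset.sum_congr rfl fun w hw => ?_
    have hw := hfin.mem_toFinset.1 hw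
    have h3 : n w.base = 0 := hn0 _ (by
      rintro ⟨w', hw', h⟩
      exact hTY w' hw' ε hε le_rfl (.inr (h ▸ hw.1)))
    have h4 := map_sub (Finsupp.mapDomain.addMonoidHom (M := ℤ) (flow n (ε - t)))
      (Finsupp.single (w.move (q w * ε)) 1) (Finsupp.single w.base 1)
    simp only [Finsupp.mapDomain.addMonoidHom_apply] at h4
    rw [Finsupp.mapDomain_smul, h4, Finsupp.mapDomain_single, Finsupp.mapDomain_single,
      hflow w hw, flow_of_eq_zero h3, sub_sub_cancel]

lemma exists_cell_const {F : G.Div} (hF : 0 ≤ F) (hN : deg F = N) :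
    ∃ (τ : CellType V E N) (a : τ.Coord → ℝ) (m : τ.Coord → ℤ),
      (∀ t : ℝ, 0 < t → t ≤ 1 → (fun i => a i + t * m i) ∈ cellInt G τ) ∧
      ∀ t : ℝ, toDiv (cellParam G τ fun i => a i + t * m i) = F := by
  have hfl : ∀ d x, flow (G := G) (fun _ => 0) d x = x := fun d x => flow_of_eq_zero rfl d
  obtain ⟨τ, a, m, h1, h2⟩ := exists_cell hF hN (fun _ => 0) (ε := 1)
    (fun e r h _ d _ _ => by simpa using h)
    (fun x y _ _ hxy d _ _ => by rwa [hfl, hfl])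
  refine ⟨τ, a, m, h1, fun t => ?_⟩
  rw [h2, show flow (fun _ => 0) (1 - t) = id from funext (hfl _), Finsupp.mapDomain_id]

/-! ### Maps that are locally straight lines in open cells -/

/-- In every direction, the map `φ` runs for a short time through the interior of a cell, on a
straight line with integral velocity. -/
def IsLocallyStraight (φ : G.Point → Sym G.Point N) : Prop :=
  ∀ u : G.Tangent, ∃ ε : ℝ, 0 < ε ∧ ε ≤ u.room ∧
    ∃ (τ : CellType V E N) (a : τ.Coord → ℝ) (m : τ.Coord → ℤ),
      (∀ t, 0 < t → t ≤ ε → (fun i => a i + t * m i) ∈ cellInt G τ) ∧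
      ∀ t ∈ Set.Icc (0 : ℝ) ε, cellParam G τ (fun i => a i + t * m i) = φ (u.move t)

lemma mem_closure_of_Ioc {ι : Type*} {a : ι → ℝ} {m : ι → ℤ} {ε : ℝ} (hε : 0 < ε)
    {A : Set (ι → ℝ)} (h : ∀ t, 0 < t → t ≤ ε → (fun i => a i + t * m i) ∈ A) {t : ℝ}
    (ht : t ∈ Set.Icc 0 ε) : (fun i => a i + t * m i) ∈ closure A := by
  have hc : Continuous fun (t : ℝ) (i : ι) => a i + t * m i := by fun_prop
  have := image_closure_subset_closure_image hc (s := Set.Ioc 0 ε)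
  rw [closure_Ioc hε.ne] at this
  refine closure_mono ?_ (this ⟨t, ht, rfl⟩)
  rintro _ ⟨s, hs, rfl⟩
  exact h s hs.1 hs.2

lemma IsLocallyStraight.isIntegralAffine_symCells {φ : G.Point → Sym G.Point N}
    (h : IsLocallyStraight φ) : IsIntegralAffine (symCells G N) φ := by
  intro u
  obtain ⟨ε, h0, h1, τ, a, m, h2, h3⟩ := h u
  refine ⟨ε, h0, h1, τ, a, m, fun t ht => ⟨?_, h3 t ht⟩⟩
  have := mem_closure_of_Ioc h0 h2 ht
  exact closure_minimal (cellInt_subset_cellPoly τ) (isClosed_cellPoly τ) this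

lemma IsLocallyStraight.isIntegralAffine_sysCells {D : G.Div}
    {φ : G.Point → Sym G.Point (deg D).toNat} (h : IsLocallyStraight φ)
    (hφ : ∀ P, φ P ∈ symLinearSystem D) : IsIntegralAffine (sysCells D) φ := by
  intro u
  obtain ⟨ε, h0, h1, τ, a, m, h2, h3⟩ := h u
  have hmem : ∀ t, 0 < t → t ≤ ε → (fun i => a i + t * m i) ∈ sysInt D τ := fun t ht0 ht1 =>
    ⟨h2 t ht0 ht1, by rw [h3 t ⟨ht0.le, ht1⟩]; exact hφ _⟩
  have hc : Continuous fun (t : ℝ) (i : τ.Coord) => a i + t * m i := by fun_prop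
  have hcomp : ∀ t, 0 < t → t ≤ ε → (fun i => a i + t * m i) ∈
      connectedComponentIn (sysInt D τ) (fun i => a i + ε * m i) := fun t ht0 ht1 =>
    (isPreconnected_Ioc.image _ hc.continuousOn).subset_connectedComponentIn
      ⟨ε, ⟨h0, le_rfl⟩, rfl⟩ (by rintro _ ⟨s, hs, rfl⟩; exact hmem s hs.1 hs.2)
      ⟨t, ⟨ht0, ht1⟩, rfl⟩
  refine ⟨ε, h0, h1, ⟨τ, ⟨_, hmem ε h0 le_rfl⟩⟩, a, m, fun t ht => ⟨?_, h3 t ht⟩⟩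
  exact mem_closure_of_Ioc h0 hcomp ht

lemma IsLocallyStraight.continuous {φ : G.Point → Sym G.Point N} (h : IsLocallyStraight φ) :
    Continuous φ := by
  refine ⟨fun U hU => isOpen_iff_germ.2 fun u hu => ?_⟩
  obtain ⟨ε, h0, h1, τ, a, m, h2, h3⟩ := h u
  have hc : Continuous fun t : ℝ => cellParam G τ fun i => a i + t * m i :=
    (continuous_cellParam τ).comp (by fun_prop)
  have h4 := h3 0 ⟨le_rfl, h0.le⟩
  have h5 := (hU.preimage hc).mem_nhds (x := 0) (by
    change cellParam G τ _ ∈ U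
    rw [h4]; exact hu)
  filter_upwards [nhdsWithin_le_nhds h5, Ioo_mem_nhdsGT h0] with t ht ht'
  rw [Set.mem_preimage, ← h3 t ⟨ht'.1.le, ht'.2.le⟩]
  exact ht

/-! ### The reduced divisor map -/

lemma exists_isReducedMap [ConnectedSpace G.Point] {D : G.Div} (hD : 0 ≤ rank D) :
    (((deg D).toNat : ℕ) : ℤ) = deg D ∧
    ∃ Red : G.Point → Sym G.Point (deg D).toNat, IsReducedMap D Red := by
  obtain ⟨F, hF, hFD⟩ := exists_mem_linearSystem hD
  have hdeg : (((deg D).toNat : ℕ) : ℤ) = deg D := by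
    refine Int.toNat_of_nonneg ?_
    rw [← hFD.deg_eq]
    exact Finset.sum_nonneg fun x _ => hF x
  have : ∀ P, ∃ x : Sym G.Point (deg D).toNat, LinEquiv (toDiv x) D ∧ IsReduced P (toDiv x) := by
    intro P
    obtain ⟨F', h1, h2, h3⟩ := exists_isReduced hF P
    have h4 := h2.trans hFD
    obtain ⟨x, hx⟩ := exists_toDiv_eq h1 (h4.deg_eq.trans hdeg.symm)
    exact ⟨x, hx ▸ h4, hx ▸ h3⟩
  choose Red h1 h2 using this
  refine ⟨hdeg, Red, fun P => ⟨⟨toDiv_nonneg _, h1 P⟩, fun D' => ⟨fun h => ?_, ?_⟩⟩⟩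
  · exact h.2.eq (h2 P) (h.1.trans (h1 P).symm)
  · rintro rfl
    exact ⟨h1 P, h2 P⟩

/-- The local form of the reduced divisor map in the direction `u`, together with the straight line
in a cell of the symmetric product that it follows. -/
lemma IsReducedMap.local_form {D : G.Div} {Red : G.Point → Sym G.Point (deg D).toNat}
    (hdeg : (((deg D).toNat : ℕ) : ℤ) = deg D) (hRed : IsReducedMap D Red) (u : G.Tangent) :
    ((satCuts (toDiv (Red u.base)) u = ∅ ∧
      ∃ ε > 0, ∀ δ ∈ Set.Icc (0 : ℝ) ε, Red (u.move δ) = Red u.base) ∨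
    ∃ Y, IsGreatest (satCuts (toDiv (Red u.base)) u) Y ∧
      1 ≤ excess (toDiv (Red u.base)) Y u.base ∧
      ∃ ε > 0, ∀ δ ∈ Set.Icc (0 : ℝ) ε,
        toDiv (Red (u.move δ)) = modify (toDiv (Red u.base)) Y u δ) ∧
    ∃ ε : ℝ, 0 < ε ∧ ε ≤ u.room ∧
      ∃ (τ : CellType V E (deg D).toNat) (a : τ.Coord → ℝ) (m : τ.Coord → ℤ),
        (∀ t, 0 < t → t ≤ ε → (fun i => a i + t * m i) ∈ cellInt G τ) ∧
        ∀ t ∈ Set.Icc (0 : ℝ) ε, cellParam G τ (fun i => a i + t * m i) = Red (u.move t) := by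
  have hmem := (hRed u.base).1
  have hred := ((hRed u.base).2 _).2 rfl
  have huniq : ∀ P D', LinEquiv D' D → IsReduced P D' → toDiv (Red P) = D' := fun P D' h1 h2 =>
    (((hRed P).2 D').1 ⟨h1, h2⟩).symm
  set F := toDiv (Red u.base) with hF
  have hF0 : 0 ≤ F := toDiv_nonneg _
  by_cases hne : (satCuts F u).Nonempty
  · obtain ⟨hYcut, huY, hYsat⟩ := sUnion_satCuts_mem hne
    have hex : 1 ≤ excess F (⋃₀ satCuts F u) u.base := by
      have := hYsat _ (base_mem_frontier huY)
      rw [excess]; linarith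
    obtain ⟨k, hk⟩ := Int.eq_ofNat_of_zero_le (by linarith : 0 ≤ excess F (⋃₀ satCuts F u) u.base)
    have hk0 : 0 < k := by omega
    obtain ⟨ε, hε, hst, H⟩ := isReduced_modify hF0 hred.2 hne hk hk0
    have hloc : ∀ δ ∈ Set.Icc (0 : ℝ) ε,
        toDiv (Red (u.move δ)) = modify F (⋃₀ satCuts F u) u δ := fun δ hδ =>
      huniq _ _ ((H δ hδ).2.1.trans hred.1) (H δ hδ).2.2
    refine ⟨.inr ⟨_, isGreatest_sUnion_satCuts hne, hex, ε, hε, hloc⟩, ?_⟩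
    obtain ⟨h1, h2, -⟩ := H ε ⟨hε.le, le_rfl⟩
    obtain ⟨τ, a, m, h3, h4⟩ := exists_cell_modify (hYsat.finite_outgoing hYcut) huY hk hk0 hε hst
      (fun x => eq_zero_of_notMem_nodes) h1 ((h2.trans hred.1).deg_eq.trans hdeg.symm)
    refine ⟨min ε u.room, lt_min hε u.room_pos, min_le_right _ _, τ, a, m,
      fun t ht0 ht1 => h3 t ht0 (ht1.trans (min_le_left _ _)), fun t ht => toDiv_injective ?_⟩
    rw [h4, hloc t ⟨ht.1, ht.2.trans (min_le_left _ _)⟩]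
  · have he := Set.not_nonempty_iff_eq_empty.1 hne
    obtain ⟨ε, hε, H⟩ := isReduced_move_of_satCuts_eq_empty hF0 hred.2 he
    have hloc : ∀ δ ∈ Set.Icc (0 : ℝ) ε, Red (u.move δ) = Red u.base := fun δ hδ =>
      toDiv_injective (huniq _ _ hred.1 (H δ hδ))
    refine ⟨.inl ⟨he, ε, hε, hloc⟩, ?_⟩
    obtain ⟨τ, a, m, h3, h4⟩ := exists_cell_const hF0 (hred.1.deg_eq.trans hdeg.symm)
    refine ⟨min (min ε 1) u.room, lt_min (lt_min hε one_pos) u.room_pos, min_le_right _ _, τ, a, m,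
      fun t ht0 ht1 => h3 t ht0 (ht1.trans ((min_le_left _ _).trans (min_le_right _ _))),
      fun t ht => ?_⟩
    rw [hloc t ⟨ht.1, ht.2.trans ((min_le_left _ _).trans (min_le_left _ _))⟩]
    exact toDiv_injective (h4 t)

end

end Trop.WGraph

end

open Trop WGraph in
theorem theorem3 {V E : Type*} [Fintype V] [Fintype E] (G : Trop.WGraph V E)
    [ConnectedSpace G.Point] (D : G.Div) (hD : 0 ≤ rank D) :
    ∃ Red : G.Point → Sym G.Point (deg D).toNat,
      IsReducedMap D Red ∧
      IsIntegralAffine (symCells G (deg D).toNat) Red ∧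
      IsIntegralAffine (sysCells D) Red ∧
      Continuous Red ∧
      ∀ u : G.Tangent,
        (satCuts (toDiv (Red u.base)) u = ∅ ∧
          ∃ ε > 0, ∀ δ ∈ Set.Icc (0 : ℝ) ε, Red (u.move δ) = Red u.base) ∨
        ∃ Y, IsGreatest (satCuts (toDiv (Red u.base)) u) Y ∧
          1 ≤ excess (toDiv (Red u.base)) Y u.base ∧
          ∃ ε > 0, ∀ δ ∈ Set.Icc (0 : ℝ) ε,
            toDiv (Red (u.move δ)) = modify (toDiv (Red u.base)) Y u δ := by
  obtain ⟨hdeg, Red, hRed⟩ := exists_isReducedMap hD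
  have hstraight : IsLocallyStraight Red := fun u => (hRed.local_form hdeg u).2
  exact ⟨Red, hRed, hstraight.isIntegralAffine_symCells,
    hstraight.isIntegralAffine_sysCells fun P => (hRed P).1, hstraight.continuous,
    fun u => (hRed.local_form hdeg u).1⟩
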